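/- **Model.** An $n\times n$ input-queued switch in discrete time has queue lengths $q(t)=(q_{ij}(t))\in\mathbb Z_+^{n\times n}$. In slot $t$ a feasible schedule $s(t)$ is chosen ($s_{ij}\in\{0,1\}$, all row and column sums at most $1$), then arrivals $a(t)\in\mathbb Z_+^{n\times n}$ occur, and $q_{ij}(t+1)=[q_{ij}(t)+a_{ij}(t)-s_{ij}(t)]^+$. The arrivals are i.i.d. in $t$, independent over the pairs $(i,j)$, and $a(t)$ is independent of the past and of the schedules up to slot $t$. The MaxWeight algorithm chooses, as a (possibly randomized) function of $q(t)$, a perfect matching $s$ maximizing $\sum_{ij}q_{ij}s_{ij}$ over all feasible schedules, with ties broken arbitrarily. The capacity region is $\mathcal C=\{x\in\mathbb R_+^{n\times n}:\sum_j x_{ij}\le 1\ \forall i,\ \sum_i x_{ij}\le 1\ \forall j\}$. Write $\langle x,y\rangle=\sum_{ij}x_{ij}y_{ij}$. **Setting.** Let $0\le n_1,n_2<n$, and let $\nu$ with $\min_{ij}\nu_{ij}>0$ lie in the relative interior of the face $\{x\in\mathcal C:\sum_j x_{ij}=1\ (i\le n_1),\ \sum_i x_{ij}=1\ (j\le n_2)\}$.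 Let $k\in\mathbb R_+^{n\times n}$ with $\sum_{ij}k_{ij}=n$, and put $\kappa_i=\sum_j k_{ij}$, $\tilde\kappa_j=\sum_i k_{ij}$; assume $\kappa_i>0$ for $i\le n_1$ and $\tilde\kappa_j>0$ for $j\le n_2$. For some $\varepsilon_0>0$ and each $0<\varepsilon<\varepsilon_0$, let the arrivals $a^{(\varepsilon)}$ be bounded by $a_{\max}$ (independent of $\varepsilon$), with mean $\nu-\varepsilon k$ and variances $(\sigma^{(\varepsilon)}_{ij})^2\to\sigma_{ij}^2$ as $\varepsilon\downarrow0$; write $\sigma^2=(\sigma_{ij}^2)_{ij}$. Let $$\zeta_{ij}=\begin{cases}2-\frac{2n-n_1-n_2}{n^2-n_1n_2}& i\le n_1,\ j\le n_2\\ 1+\frac{n_2}{n^2-n_1n_2}& i\le n_1,\ j>n_2\\ 1+\frac{n_1}{n^2-n_1n_2}& i>n_1,\ j\le n_2\\ 0& i>n_1,\ j>n_2,\end{cases}$$ let $\kappa_{\max}$ and $\kappa_{\min}$ be the maximum and the minimum of the numbers $\kappa_i$ $(i\le n_1)$ and $\tilde\kappa_j$ $(j\le n_2)$, and let $\zeta'_{ij}=1/\kappa_i$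 if $i\le n_1$ and $\zeta'_{ij}=0$ otherwise, $\zeta''_{ij}=1/\tilde\kappa_j$ if $j\le n_2$ and $\zeta''_{ij}=0$ otherwise. **Claim.** (1) Under MaxWeight, for each $0<\varepsilon<\varepsilon_0$ the queue length Markov chain has exactly one stationary distribution, and if $\bar q^{(\varepsilon)}$ has this distribution, then $$\frac{\langle\sigma^2,\zeta\rangle}{2\kappa_{\max}}\le\liminf_{\varepsilon\downarrow0}\varepsilon\,\mathbb E\Big[\sum_{ij}\bar q^{(\varepsilon)}_{ij}\Big]\le\limsup_{\varepsilon\downarrow0}\varepsilon\,\mathbb E\Big[\sum_{ij}\bar q^{(\varepsilon)}_{ij}\Big]\le\frac{\langle\sigma^2,\zeta\rangle}{2\kappa_{\min}}.$$ (If $n_1=n_2=0$, then $\zeta=0$ and both bounds are read as $0$.) (2) Suppose that for each $0<\varepsilon<\varepsilon_0$ the switch is operated under any non-anticipating scheduling policy (the schedule may depend on the whole past and on extra randomness) under which it is stable, in the sense that $q^{(\varepsilon)}(t)$ converges in distribution as $t\to\infty$ to a (finite) random vector $\bar q^{(\varepsilon)}$. Then $$\liminf_{\varepsilon\downarrow0}\varepsilon\,\mathbb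 E\Big[\sum_{ij}\bar q^{(\varepsilon)}_{ij}\Big]\ge\tfrac12\max\{\langle\sigma^2,\zeta'\rangle,\langle\sigma^2,\zeta''\rangle\},$$ where the expectation may be $+\infty$. -/

import Mathlib

open Filter Topology MeasureTheory ProbabilityTheory
open scoped ENNReal

namespace Switch

/-- Queue lengths, arrivals and schedules of an `n × n` switch: natural numbers indexed by
(input port, output port). -/
abbrev Config (n : ℕ) : Type := Fin n → Fin n → ℕ

/-- Real `n × n` arrays, regarded as vectors of `ℝ^{n²}`. -/
abbrev RVec (n : ℕ) : Type := Fin n → Fin n → ℝ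

/-- The scalar product of `ℝ^{n²}`. -/
def dot {n : ℕ} (x y : RVec n) : ℝ := ∑ i, ∑ j, x i j * y i j

/-- Sum of row `i` (input port `i`). -/
def rowSum {n : ℕ} (x : RVec n) (i : Fin n) : ℝ := ∑ j, x i j

/-- Sum of column `j` (output port `j`). -/
def colSum {n : ℕ} (x : RVec n) (j : Fin n) : ℝ := ∑ i, x i j

/-- The capacity region of the switch. -/
def capacityRegion (n : ℕ) : Set (RVec n) :=
  {x | (∀ i j, 0 ≤ x i j) ∧ (∀ i, rowSum x i ≤ 1) ∧ ∀ j, colSum x j ≤ 1}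

/-- The face of the capacity region on which the first `n₁` input ports and the first `n₂`
output ports are saturated. -/
def face (n n₁ n₂ : ℕ) : Set (RVec n) :=
  {x | x ∈ capacityRegion n ∧ (∀ i : Fin n, (i : ℕ) < n₁ → rowSum x i = 1) ∧
    ∀ j : Fin n, (j : ℕ) < n₂ → colSum x j = 1}

/-- The saturation rates `κ i`, `κ̃ j` of the saturated input and output ports. -/
def saturationRates {n : ℕ} (n₁ n₂ : ℕ) (k : RVec n) : Set ℝ :=
  {x | (∃ i : Fin n, (i : ℕ) < n₁ ∧ x = rowSum k i) ∨
    ∃ j : Fin n, (j : ℕ) < n₂ ∧ x = colSum k j}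

/-- The largest saturation rate of a saturated port (`0` if no port is saturated). -/
noncomputable def kappaMax {n : ℕ} (n₁ n₂ : ℕ) (k : RVec n) : ℝ :=
  sSup (saturationRates n₁ n₂ k)

/-- The smallest saturation rate of a saturated port (`0` if no port is saturated). -/
noncomputable def kappaMin {n : ℕ} (n₁ n₂ : ℕ) (k : RVec n) : ℝ :=
  sInf (saturationRates n₁ n₂ k)

/-- The vector `ζ`. -/
noncomputable def zeta (n n₁ n₂ : ℕ) : RVec n := fun i j =>
  if (i : ℕ) < n₁ then
    if (j : ℕ) < n₂ then 2 - (2 * (n : ℝ) - n₁ - n₂) / ((n : ℝ) ^ 2 - n₁ * n₂)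
    else 1 + (n₂ : ℝ) / ((n : ℝ) ^ 2 - n₁ * n₂)
  else
    if (j : ℕ) < n₂ then 1 + (n₁ : ℝ) / ((n : ℝ) ^ 2 - n₁ * n₂)
    else 0

/-- The vector `ζ'`: `1 / κ i` in the rows of saturated input ports, `0` elsewhere. -/
noncomputable def zetaRow {n : ℕ} (n₁ : ℕ) (k : RVec n) : RVec n := fun i _ =>
  if (i : ℕ) < n₁ then 1 / rowSum k i else 0

/-- The vector `ζ''`: `1 / κ̃ j` in the columns of saturated output ports, `0` elsewhere. -/
noncomputable def zetaCol {n : ℕ} (n₂ : ℕ) (k : RVec n) : RVec n := fun _ j =>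
  if (j : ℕ) < n₂ then 1 / colSum k j else 0

/-- The feasible schedules: (partial) matchings of input ports with output ports. -/
def feasibleSchedules (n : ℕ) : Set (Config n) :=
  {s | (∀ i, ∑ j, s i j ≤ 1) ∧ ∀ j, ∑ i, s i j ≤ 1}

/-- The maximal feasible schedules: perfect matchings. -/
def maximalSchedules (n : ℕ) : Set (Config n) :=
  {s | (∀ i, ∑ j, s i j = 1) ∧ ∀ j, ∑ i, s i j = 1}

/-- The weight of schedule `s` when the queue lengths are `q`. -/
def weight {n : ℕ} (q s : Config n) : ℕ := ∑ i, ∑ j, q i j * s i j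

/-- The queue lengths `[q + a - s]⁺` after one time slot. Subtraction of natural numbers is
truncated at `0`, which is the positive part. -/
def nextQueue {n : ℕ} (q a s : Config n) : Config n := fun i j => q i j + a i j - s i j

/-- The law of the arrivals of one time slot: independent over the pairs `(i, j)`, with marginal
laws `A i j`. -/
noncomputable def arrivalLaw {n : ℕ} (A : Fin n → Fin n → PMF ℕ) : Measure (Config n) :=
  Measure.pi fun i => Measure.pi fun j => (A i j).toMeasure

/-- A (stationary, possibly randomized) scheduling rule: the law of the schedule as a function of
the current queue lengths. -/
abbrev Policy (n : ℕ) : Type := Config n → PMF (Config n)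

/-- `pol` is a MaxWeight rule: it always chooses a maximal schedule whose weight is the largest
among all feasible schedules. Ties may be broken in any way, deterministic or random. -/
def Policy.IsMaxWeight {n : ℕ} (pol : Policy n) : Prop :=
  ∀ q, ∀ s ∈ (pol q).support,
    s ∈ maximalSchedules n ∧ ∀ s' ∈ feasibleSchedules n, weight q s' ≤ weight q s

/-- The transition kernel of the queue length Markov chain: given the queue lengths, the schedule
is drawn according to the scheduling rule and the arrivals are independent of it. -/
noncomputable def queueKernel {n : ℕ} (A : Fin n → Fin n → PMF ℕ) (pol : Policy n) :
    Kernel (Config n) (Config n) :=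
  Kernel.ofFunOfCountable fun q =>
    ((pol q).toMeasure.prod (arrivalLaw A)).map fun p => nextQueue q p.2 p.1

/-- `π` is a steady-state (stationary) distribution of the chain with kernel `K`. -/
def IsSteadyState {n : ℕ} (K : Kernel (Config n) (Config n)) (π : Measure (Config n)) : Prop :=
  IsProbabilityMeasure π ∧ K.Invariant π

/-- The expectation, possibly `∞`, of the total queue length under the law `π`. -/
noncomputable def meanTotal {n : ℕ} (π : Measure (Config n)) : ℝ≥0∞ :=
  ∫⁻ q, ((∑ i, ∑ j, q i j : ℕ) : ℝ≥0∞) ∂π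

/-- The switch run by an arbitrary non-anticipating scheduling policy. The queue lengths `q t`
and the feasible schedule `s t` are known at the beginning of slot `t` (the schedule may depend
on the whole past and on extra randomness); the arrivals `a t` are then drawn from the arrival
law, independently of the past and of the schedule. -/
structure IsSwitchProcess {n : ℕ} {Ω : Type*} [mΩ : MeasurableSpace Ω] (P : Measure Ω)
    (A : Fin n → Fin n → PMF ℕ) (ℱ : Filtration ℕ mΩ) (a s q : ℕ → Ω → Config n) : Prop where
  arrivals_meas : ∀ t, Measurable[ℱ (t + 1)] (a t)
  schedule_meas : ∀ t, Measurable[ℱ t] (s t)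
  queue_meas : ∀ t, Measurable[ℱ t] (q t)
  arrivals_law : ∀ t, P.map (a t) = arrivalLaw A
  arrivals_indep : ∀ t, Indep (MeasurableSpace.comap (a t) inferInstance) (ℱ t) P
  schedule_mem : ∀ t ω, s t ω ∈ feasibleSchedules n
  evolve : ∀ t ω, q (t + 1) ω = nextQueue (q t ω) (a t ω) (s t ω)

end Switch

/-! A MaxWeight schedule is a perfect matching, so its sums over saturated ports equal those of `ν`.
The linear span of the saturated row and column indicators therefore does not see the schedule.
There the dynamics reduce to centred arrivals, a drift of order `ε` and unused service. Orthogonally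
to the cone generated by these indicators, MaxWeight pulls the queue back at a rate that does not
depend on `ε`.

Collapse onto the cone. Write `q = para + perp` by Moreau's decomposition. Since `ν` is in the
relative interior of the face, it can be moved by a fixed `δ` in any unit direction of the polar
cone without leaving the capacity region (`exists_slack`). By Birkhoff's theorem a MaxWeight
schedule outweighs every point of that region (`dot_le_of_weight_le`), hence the drift of `perp` in
`dot_perp_sub_le`. With the cube of `perpNorm` as Lyapunov function, Foster's bound controls the
second moment of `perpNorm` uniformly in small `ε` (`lintegral_perpNorm_sq_le`). With no saturated
port the cone is `0` and `perp` is the identity. The same argument then gives, for each fixed `ε`, a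
stationary law and finite second moments. Uniqueness holds because the empty state is reachable from
every state.

Quadratic identity. Let `spanProj` be the orthogonal projection onto the span. In steady state the
mean increment of `⟨q, spanProj q⟩` is zero. The arrivals contribute `⟨σ², ζ⟩ / n`, the drift
contributes `2 ε E⟨spanProj q, k⟩`, and unused service contributes a vanishing error: a queue left
with unused service is empty, so the projection there is controlled by `perpNorm`, and the mean
unused service on saturated ports is of order `ε` (`SteadySlot.abs_quad_le`). On the cone, `n⟨·, k⟩`
lies between `kappaMin` and `kappaMax` times the total queue length (`abs_rate_terms_le`), which
turns the identity into the two bounds.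

Arbitrary stable policies. A port serves at most one packet per slot, so its load dominates a single
server recursion. The limit law inherits this (`portDominated_of_process`), and testing it with a
truncated square gives a Kingman type lower bound (`PortDominated.var_le`). Distinct rows are
disjoint, as are distinct columns, so the bounds add up within each family. -/

namespace Switch

variable {n : ℕ}

/-! ### The scalar product of `ℝ^{n²}` -/

lemma dot_eq_sum_prod (x y : RVec n) :
    dot x y = ∑ p : Fin n × Fin n, x p.1 p.2 * y p.1 p.2 := by
  rw [dot, Fintype.sum_prod_type]

lemma dot_comm (x y : RVec n) : dot x y = dot y x := by simp only [dot, mul_comm]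

lemma dot_add_left (x y z : RVec n) : dot (x + y) z = dot x z + dot y z := by
  simp only [dot, Pi.add_apply, add_mul, Finset.sum_add_distrib]

lemma dot_sub_left (x y z : RVec n) : dot (x - y) z = dot x z - dot y z := by
  simp only [dot, Pi.sub_apply, sub_mul, Finset.sum_sub_distrib]

lemma dot_smul_left (c : ℝ) (x z : RVec n) : dot (c • x) z = c * dot x z := by
  simp only [dot, Pi.smul_apply, smul_eq_mul, mul_assoc, Finset.mul_sum]

lemma dot_add_right (x y z : RVec n) : dot x (y + z) = dot x y + dot x z := by
  simp only [dot_comm x, dot_add_left]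

lemma dot_sub_right (x y z : RVec n) : dot x (y - z) = dot x y - dot x z := by
  simp only [dot_comm x, dot_sub_left]

lemma dot_smul_right (c : ℝ) (x z : RVec n) : dot x (c • z) = c * dot x z := by
  simp only [dot_comm x, dot_smul_left]

lemma dot_neg_right (x z : RVec n) : dot x (-z) = -dot x z := by
  simp only [dot, Pi.neg_apply, mul_neg, Finset.sum_neg_distrib]

lemma dot_self_nonneg (x : RVec n) : 0 ≤ dot x x :=
  Finset.sum_nonneg fun _ _ => Finset.sum_nonneg fun _ _ => mul_self_nonneg _

/-- The Euclidean norm on `ℝ^{n²}`. -/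
noncomputable def nrm (x : RVec n) : ℝ := √(dot x x)

lemma nrm_nonneg (x : RVec n) : 0 ≤ nrm x := Real.sqrt_nonneg _

lemma nrm_sq (x : RVec n) : nrm x ^ 2 = dot x x := Real.sq_sqrt (dot_self_nonneg x)

lemma abs_dot_le (x y : RVec n) : |dot x y| ≤ nrm x * nrm y := by
  rw [nrm, nrm, ← Real.sqrt_mul (dot_self_nonneg x)]
  apply Real.abs_le_sqrt
  simp only [dot_eq_sum_prod, ← sq]
  exact Finset.sum_mul_sq_le_sq_mul_sq _ _ _

lemma dot_le (x y : RVec n) : dot x y ≤ nrm x * nrm y := (le_abs_self _).trans (abs_dot_le x y)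

lemma nrm_add_le (x y : RVec n) : nrm (x + y) ≤ nrm x + nrm y := by
  rw [nrm, Real.sqrt_le_left (by positivity [nrm_nonneg x, nrm_nonneg y])]
  have := dot_le x y
  rw [dot_add_left, dot_add_right, dot_add_right, dot_comm y x]
  nlinarith [nrm_sq x, nrm_sq y]

lemma nrm_neg (x : RVec n) : nrm (-x) = nrm x := by
  simp [nrm, dot]

lemma nrm_smul (c : ℝ) (x : RVec n) : nrm (c • x) = |c| * nrm x := by
  rw [nrm, dot_smul_left, dot_smul_right, ← mul_assoc, Real.sqrt_mul (mul_self_nonneg c),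
    Real.sqrt_mul_self_eq_abs, nrm]

lemma abs_apply_le_nrm (x : RVec n) (i j : Fin n) : |x i j| ≤ nrm x := by
  apply Real.abs_le_sqrt
  rw [dot_eq_sum_prod]
  refine le_trans (le_of_eq ?_) (Finset.single_le_sum (f := fun p : Fin n × Fin n =>
    x p.1 p.2 * x p.1 p.2) (fun p _ => mul_self_nonneg _) (Finset.mem_univ (i, j)))
  simp [sq]

lemma nrm_le_of_abs_le {x : RVec n} {c : ℝ} (hc : 0 ≤ c) (h : ∀ i j, |x i j| ≤ c) :
    nrm x ≤ n * c := by
  rw [nrm, Real.sqrt_le_left (by positivity), dot]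
  calc ∑ i, ∑ j, x i j * x i j ≤ ∑ _i : Fin n, ∑ _j : Fin n, c ^ 2 := by
        gcongr with i _ j _
        rw [← sq]
        exact sq_le_sq' (abs_le.1 (h i j)).1 (abs_le.1 (h i j)).2
    _ = (n * c) ^ 2 := by simp; ring

lemma rowSum_add (x y : RVec n) (i : Fin n) : rowSum (x + y) i = rowSum x i + rowSum y i := by
  simp [rowSum, Finset.sum_add_distrib]

lemma rowSum_sub (x y : RVec n) (i : Fin n) : rowSum (x - y) i = rowSum x i - rowSum y i := by
  simp [rowSum, Finset.sum_sub_distrib]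

lemma rowSum_smul (c : ℝ) (x : RVec n) (i : Fin n) : rowSum (c • x) i = c * rowSum x i := by
  simp [rowSum, Finset.mul_sum]

lemma rowSum_neg (x : RVec n) (i : Fin n) : rowSum (-x) i = -rowSum x i := by
  simp [rowSum]

lemma colSum_add (x y : RVec n) (i : Fin n) : colSum (x + y) i = colSum x i + colSum y i := by
  simp [colSum, Finset.sum_add_distrib]

lemma colSum_sub (x y : RVec n) (i : Fin n) : colSum (x - y) i = colSum x i - colSum y i := by
  simp [colSum, Finset.sum_sub_distrib]

lemma colSum_smul (c : ℝ) (x : RVec n) (i : Fin n) : colSum (c • x) i = c * colSum x i := by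
  simp [colSum, Finset.mul_sum]

lemma colSum_neg (x : RVec n) (i : Fin n) : colSum (-x) i = -colSum x i := by
  simp [colSum]

/-- The vector with all entries `1`. -/
def ones (n : ℕ) : RVec n := fun _ _ => 1

lemma rowSum_ones (i : Fin n) : rowSum (ones n) i = n := by simp [rowSum, ones]

lemma colSum_ones (i : Fin n) : colSum (ones n) i = n := by simp [colSum, ones]

lemma nrm_ones : nrm (ones n) = n := by
  rw [nrm, Real.sqrt_eq_iff_mul_self_eq (dot_self_nonneg _) (by positivity)]
  simp [dot, ones]

/-! ### The polar cone of the saturated ports and the projection onto it -/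

/-- The polar cone of the cone generated by the saturated rows and columns. -/
def polarCone (n n₁ n₂ : ℕ) : Set (RVec n) :=
  {y | (∀ i : Fin n, (i : ℕ) < n₁ → rowSum y i ≤ 0) ∧
    ∀ j : Fin n, (j : ℕ) < n₂ → colSum y j ≤ 0}

/-- Moreau's decomposition: `p` is the nearest point of the closed convex polar cone, and the
residual `x - p` lies in the polar of that cone. The arrays are moved to `EuclideanSpace` only to
use the projection theorem. -/
lemma exists_polar_projection (n n₁ n₂ : ℕ) (x : RVec n) :
    ∃ p ∈ polarCone n n₁ n₂, dot (x - p) p = 0 ∧ ∀ y ∈ polarCone n n₁ n₂, dot (x - p) y ≤ 0 := by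
  let e : RVec n → EuclideanSpace ℝ (Fin n × Fin n) := fun x => WithLp.toLp 2 fun p => x p.1 p.2
  let d : EuclideanSpace ℝ (Fin n × Fin n) → RVec n := fun v i j => v (i, j)
  have hinner : ∀ v w : EuclideanSpace ℝ (Fin n × Fin n), inner ℝ v w = dot (d v) (d w) := by
    intro v w
    simp [dot_eq_sum_prod, PiLp.inner_apply, d, mul_comm]
  have hde : ∀ x, d (e x) = x := fun x => rfl
  have hdsub : ∀ v w, d (v - w) = d v - d w := fun v w => rfl
  have hdadd : ∀ v w, d (v + w) = d v + d w := fun v w => rfl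
  have hdsmul : ∀ (c : ℝ) v, d (c • v) = c • d v := fun v w => rfl
  have hdcont : Continuous d := by
    refine continuous_pi fun i => continuous_pi fun j => ?_
    simp only [d]
    fun_prop
  set C : Set (EuclideanSpace ℝ (Fin n × Fin n)) := d ⁻¹' polarCone n n₁ n₂ with hC
  have hcone : ∀ c : ℝ, 0 ≤ c → ∀ y ∈ polarCone n n₁ n₂, c • y ∈ polarCone n n₁ n₂ := by
    intro c hc y hy
    refine ⟨fun i hi => ?_, fun j hj => ?_⟩
    · rw [rowSum_smul]; exact mul_nonpos_of_nonneg_of_nonpos hc (hy.1 i hi)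
    · rw [colSum_smul]; exact mul_nonpos_of_nonneg_of_nonpos hc (hy.2 j hj)
  have hadd : ∀ y ∈ polarCone n n₁ n₂, ∀ z ∈ polarCone n n₁ n₂, y + z ∈ polarCone n n₁ n₂ := by
    intro y hy z hz
    refine ⟨fun i hi => ?_, fun j hj => ?_⟩
    · rw [rowSum_add]; exact add_nonpos (hy.1 i hi) (hz.1 i hi)
    · rw [colSum_add]; exact add_nonpos (hy.2 j hj) (hz.2 j hj)
  have hclosed : IsClosed C := by
    apply IsClosed.preimage hdcont
    simp only [polarCone, Set.ofPred_and, Set.ofPred_forall]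
    refine IsClosed.inter ?_ ?_
    · refine isClosed_iInter fun i => isClosed_iInter fun _ =>
        isClosed_le ?_ continuous_const
      unfold rowSum; fun_prop
    · refine isClosed_iInter fun i => isClosed_iInter fun _ =>
        isClosed_le ?_ continuous_const
      unfold colSum; fun_prop
  have hconv : Convex ℝ C := by
    intro v hv w hw a b ha hb _
    change d (a • v + b • w) ∈ polarCone n n₁ n₂
    rw [hdadd, hdsmul, hdsmul]
    exact hadd _ (hcone a ha _ hv) _ (hcone b hb _ hw)
  have hne : C.Nonempty := ⟨0, by
    change d 0 ∈ polarCone n n₁ n₂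
    have : d 0 = 0 := rfl
    rw [this]
    refine ⟨fun i _ => ?_, fun i _ => ?_⟩ <;> simp [rowSum, colSum]⟩
  obtain ⟨v, hv, hmin⟩ := exists_norm_eq_iInf_of_complete_convex hne hclosed.isComplete hconv (e x)
  rw [norm_eq_iInf_iff_real_inner_le_zero hconv hv] at hmin
  have key : ∀ y ∈ polarCone n n₁ n₂, dot (x - d v) (y - d v) ≤ 0 := by
    intro y hy
    have := hmin (e y) hy
    rwa [hinner, hdsub, hdsub, hde, hde] at this
  -- The cone contains `0` and twice the minimiser; the variational inequality at these two points
  -- gives both signs.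
  have h0 : dot (x - d v) (d v) = 0 := by
    have h1 := key _ (hcone 2 (by norm_num) _ hv)
    have h2 := key _ (hcone 0 le_rfl _ hv)
    rw [dot_sub_right, dot_smul_right] at h1 h2
    linarith
  refine ⟨d v, hv, h0, fun y hy => ?_⟩
  have := key y hy
  rw [dot_sub_right, h0] at this
  linarith

/-- The component of `x` orthogonal to the cone of the saturated ports. -/
noncomputable def perp (n₁ n₂ : ℕ) (x : RVec n) : RVec n :=
  (exists_polar_projection n n₁ n₂ x).choose

/-- The component of `x` in the cone of the saturated ports. -/
noncomputable def para (n₁ n₂ : ℕ) (x : RVec n) : RVec n := x - perp n₁ n₂ x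

lemma perp_mem (n₁ n₂ : ℕ) (x : RVec n) : perp n₁ n₂ x ∈ polarCone n n₁ n₂ :=
  (exists_polar_projection n n₁ n₂ x).choose_spec.1

lemma dot_para_perp (n₁ n₂ : ℕ) (x : RVec n) : dot (para n₁ n₂ x) (perp n₁ n₂ x) = 0 :=
  (exists_polar_projection n n₁ n₂ x).choose_spec.2.1

lemma dot_para_nonpos {n₁ n₂ : ℕ} (x : RVec n) {y : RVec n} (hy : y ∈ polarCone n n₁ n₂) :
    dot (para n₁ n₂ x) y ≤ 0 :=
  (exists_polar_projection n n₁ n₂ x).choose_spec.2.2 y hy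

lemma para_add_perp (n₁ n₂ : ℕ) (x : RVec n) : para n₁ n₂ x + perp n₁ n₂ x = x :=
  sub_add_cancel _ _

/-- Both `y` and `-y` belong to the polar cone. -/
lemma dot_para_eq_zero {n₁ n₂ : ℕ} (x : RVec n) {y : RVec n}
    (h₁ : ∀ i : Fin n, (i : ℕ) < n₁ → rowSum y i = 0)
    (h₂ : ∀ j : Fin n, (j : ℕ) < n₂ → colSum y j = 0) : dot (para n₁ n₂ x) y = 0 := by
  have ha := dot_para_nonpos x (y := y) (n₁ := n₁) (n₂ := n₂)
    ⟨fun i hi => (h₁ i hi).le, fun j hj => (h₂ j hj).le⟩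
  have hb := dot_para_nonpos x (y := -y) (n₁ := n₁) (n₂ := n₂)
    ⟨fun i hi => by rw [rowSum_neg, h₁ i hi, neg_zero],
      fun j hj => by rw [colSum_neg, h₂ j hj, neg_zero]⟩
  rw [dot_neg_right] at hb
  linarith

/-- Without saturated ports the polar cone is the whole space. This lets the bounds on `perpNorm`
serve as bounds on the full queue vector. -/
lemma perp_zero_zero (x : RVec n) : perp 0 0 x = x := by
  have h := dot_para_nonpos x (y := para 0 0 x) (n₁ := 0) (n₂ := 0) ⟨by simp, by simp⟩
  have h0 : nrm (para 0 0 x) = 0 := by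
    rw [nrm, Real.sqrt_eq_zero']; exact h
  have : para 0 0 x = 0 := by
    funext i j
    have := abs_apply_le_nrm (para 0 0 x) i j
    rw [h0] at this
    simpa using this
  rw [para, sub_eq_zero] at this
  exact this.symm

/-- The distance of `x` to the cone of the saturated ports. -/
noncomputable def perpNorm (n₁ n₂ : ℕ) (x : RVec n) : ℝ := nrm (perp n₁ n₂ x)

lemma perpNorm_nonneg (n₁ n₂ : ℕ) (x : RVec n) : 0 ≤ perpNorm n₁ n₂ x := nrm_nonneg _

/-- The point `para x` is a competitor for the distance from `y` to the cone. Pairing `y - para x`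
with `perp y` gives at least `‖perp y‖²`, and Cauchy–Schwarz concludes. -/
lemma perpNorm_le_nrm_sub_para (n₁ n₂ : ℕ) (x y : RVec n) :
    perpNorm n₁ n₂ y ≤ nrm (y - para n₁ n₂ x) := by
  have h1 : nrm (perp n₁ n₂ y) ^ 2 ≤ nrm (y - para n₁ n₂ x) * nrm (perp n₁ n₂ y) := by
    refine le_trans ?_ (dot_le _ _)
    have h2 := dot_para_nonpos x (perp_mem n₁ n₂ y)
    have h3 := dot_para_perp n₁ n₂ y
    rw [para, dot_sub_left] at h3
    rw [nrm_sq, dot_sub_left]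
    linarith
  rcases (nrm_nonneg (perp n₁ n₂ y)).eq_or_lt with h | h
  · rw [perpNorm, ← h]; exact nrm_nonneg _
  · rw [sq] at h1
    exact le_of_mul_le_mul_right h1 h

lemma perpNorm_add_le (n₁ n₂ : ℕ) (x d : RVec n) :
    perpNorm n₁ n₂ (x + d) ≤ nrm (perp n₁ n₂ x + d) := by
  refine (perpNorm_le_nrm_sub_para n₁ n₂ x (x + d)).trans (le_of_eq ?_)
  congr 1
  rw [para]
  abel

lemma abs_perpNorm_add_sub_le (n₁ n₂ : ℕ) (x d : RVec n) :
    |perpNorm n₁ n₂ (x + d) - perpNorm n₁ n₂ x| ≤ nrm d := by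
  have h1 := (perpNorm_add_le n₁ n₂ x d).trans (nrm_add_le _ _)
  have h2 := (perpNorm_add_le n₁ n₂ (x + d) (-d)).trans (nrm_add_le _ _)
  rw [nrm_neg, add_neg_cancel_right] at h2
  rw [abs_le]
  unfold perpNorm at *
  constructor <;> linarith

/-! ### Slack of a point of the relative interior of the face -/

lemma exists_pos_le_of_forall_pos {ι : Type*} [Finite ι] {f : ι → ℝ} (h : ∀ i, 0 < f i) :
    ∃ δ > 0, ∀ i, δ ≤ f i := by
  have : ∀ᶠ δ in 𝓝[>] (0 : ℝ), ∀ i, δ ≤ f i := eventually_all.2 fun i =>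
    (eventually_le_nhds (h i)).filter_mono nhdsWithin_le_nhds
  obtain ⟨δ, hδ, hpos⟩ := (this.and self_mem_nhdsWithin).exists
  exact ⟨δ, hpos, hδ⟩

lemma abs_rowSum_le (x : RVec n) (i : Fin n) : |rowSum x i| ≤ n * nrm x := by
  refine (Finset.abs_sum_le_sum_abs _ _).trans ?_
  refine (Finset.sum_le_sum fun j _ => abs_apply_le_nrm x i j).trans ?_
  simp

lemma abs_colSum_le (x : RVec n) (i : Fin n) : |colSum x i| ≤ n * nrm x := by
  refine (Finset.abs_sum_le_sum_abs _ _).trans ?_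
  refine (Finset.sum_le_sum fun j _ => abs_apply_le_nrm x j i).trans ?_
  simp

/-- Directions of the polar cone do not increase saturated sums; positivity of the entries and
strict slack at the other ports absorb a small step. The resulting `δ` is the strength of the
collapse. -/
lemma exists_slack {n₁ n₂ : ℕ} {ν : RVec n} (hpos : ∀ i j, 0 < ν i j)
    (hν : ν ∈ capacityRegion n)
    (hrow : ∀ i : Fin n, ¬ (i : ℕ) < n₁ → rowSum ν i < 1)
    (hcol : ∀ j : Fin n, ¬ (j : ℕ) < n₂ → colSum ν j < 1) :
    ∃ δ > (0 : ℝ), ∀ y ∈ polarCone n n₁ n₂, nrm y ≤ 1 → ν + δ • y ∈ capacityRegion n := by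
  rcases Nat.eq_zero_or_pos n with rfl | hn
  · exact ⟨1, one_pos, fun y _ _ => ⟨fun i => i.elim0, fun i => i.elim0, fun i => i.elim0⟩⟩
  have hn' : (0 : ℝ) < n := by exact_mod_cast hn
  obtain ⟨δ₁, hδ₁, h₁⟩ := exists_pos_le_of_forall_pos
    (f := fun p : Fin n × Fin n => ν p.1 p.2) fun p => hpos p.1 p.2
  obtain ⟨δ₂, hδ₂, h₂⟩ := exists_pos_le_of_forall_pos
    (f := fun i : {i : Fin n // ¬ (i : ℕ) < n₁} => 1 - rowSum ν i)
    fun i => sub_pos.2 (hrow i i.2)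
  obtain ⟨δ₃, hδ₃, h₃⟩ := exists_pos_le_of_forall_pos
    (f := fun i : {i : Fin n // ¬ (i : ℕ) < n₂} => 1 - colSum ν i)
    fun i => sub_pos.2 (hcol i i.2)
  -- Entries of a unit vector are at most `1` and its port sums at most `n` in absolute value, hence
  -- the divisions by `n`.
  refine ⟨min δ₁ (min (δ₂ / n) (δ₃ / n)), by positivity, fun y hy hy1 => ?_⟩
  set δ := min δ₁ (min (δ₂ / n) (δ₃ / n)) with hδ
  have hδ0 : 0 < δ := by positivity
  have ha : δ ≤ δ₁ := min_le_left _ _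
  have hb : δ * n ≤ δ₂ := by
    rw [← le_div_iff₀ hn']; exact (min_le_right _ _).trans (min_le_left _ _)
  have hc : δ * n ≤ δ₃ := by
    rw [← le_div_iff₀ hn']; exact (min_le_right _ _).trans (min_le_right _ _)
  refine ⟨fun i j => ?_, fun i => ?_, fun j => ?_⟩
  · have hy2 := (abs_le.1 ((abs_apply_le_nrm y i j).trans hy1)).1
    have := h₁ (i, j)
    simp only [Pi.add_apply, Pi.smul_apply, smul_eq_mul] at this ⊢
    nlinarith
  · rw [rowSum_add, rowSum_smul]
    by_cases hi : (i : ℕ) < n₁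
    · have := hν.2.1 i
      have := hy.1 i hi
      nlinarith
    · have h4 := h₂ ⟨i, hi⟩
      have h5 := (le_abs_self _).trans (abs_rowSum_le y i)
      have h6 : δ * rowSum y i ≤ δ * (n * 1) := by gcongr; exact h5.trans (by gcongr)
      simp only at h4
      linarith
  · rw [colSum_add, colSum_smul]
    by_cases hi : (j : ℕ) < n₂
    · have := hν.2.2 j
      have := hy.2 j hi
      nlinarith
    · have h4 := h₃ ⟨j, hi⟩
      have h5 := (le_abs_self _).trans (abs_colSum_le y j)
      have h6 : δ * colSum y j ≤ δ * (n * 1) := by gcongr; exact h5.trans (by gcongr)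
      simp only at h4
      linarith

lemma intrinsicInterior_face_lt {n₁ n₂ : ℕ} (hn₁ : n₁ < n) (hn₂ : n₂ < n) {ν : RVec n}
    (hν : ν ∈ intrinsicInterior ℝ (face n n₁ n₂)) :
    ν ∈ face n n₁ n₂ ∧ (∀ i : Fin n, ¬ (i : ℕ) < n₁ → rowSum ν i < 1) ∧
      ∀ j : Fin n, ¬ (j : ℕ) < n₂ → colSum ν j < 1 := by
  have hn : (0 : ℝ) < n := by exact_mod_cast (Nat.zero_le _).trans_lt hn₁
  have hνf : ν ∈ face n n₁ n₂ := intrinsicInterior_subset hν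
  -- A point of the face at which every unsaturated port is strictly slack: an unsaturated row sums
  -- to `n₂ / n` and an unsaturated column to `n₁ / n`.
  let x : RVec n := fun i j => if (i : ℕ) < n₁ ∨ (j : ℕ) < n₂ then 1 / n else 0
  have hcard : ∀ m : ℕ, m < n → ∑ i : Fin n, (if (i : ℕ) < m then (1 : ℝ) / n else 0) < 1 := by
    intro m hm
    rw [← Finset.sum_filter, Finset.sum_const, nsmul_eq_mul, mul_one_div, div_lt_one hn]
    have : (Finset.univ.filter fun i : Fin n => (i : ℕ) < m).card = m := by
      rw [Fin.card_filter_val_lt, min_eq_right hm.le]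
    rw [this]
    exact_mod_cast hm
  have hxr1 : ∀ i : Fin n, (i : ℕ) < n₁ → rowSum x i = 1 := by
    intro i hi
    simp [rowSum, x, hi, hn.ne']
  have hxr2 : ∀ i : Fin n, ¬ (i : ℕ) < n₁ → rowSum x i < 1 := by
    intro i hi
    simpa [rowSum, x, hi] using hcard n₂ hn₂
  have hxc1 : ∀ i : Fin n, (i : ℕ) < n₂ → colSum x i = 1 := by
    intro i hi
    simp [colSum, x, hi, hn.ne']
  have hxc2 : ∀ i : Fin n, ¬ (i : ℕ) < n₂ → colSum x i < 1 := by
    intro i hi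
    simpa [colSum, x, hi] using hcard n₁ hn₁
  have hxf : x ∈ face n n₁ n₂ := by
    refine ⟨⟨fun i j => ?_, fun i => ?_, fun j => ?_⟩, hxr1, hxc1⟩
    · simp only [x]; split_ifs <;> positivity
    · by_cases hi : (i : ℕ) < n₁
      exacts [(hxr1 i hi).le, (hxr2 i hi).le]
    · by_cases hi : (j : ℕ) < n₂
      exacts [(hxc1 j hi).le, (hxc2 j hi).le]
  -- From a relative interior point the segment coming from `x` can be prolonged inside the face. If
  -- an unsaturated port had sum `1` at `ν`, the prolongation would exceed `1`.
  obtain ⟨t, ht, htf⟩ : ∃ t > (0 : ℝ), ν + t • (ν - x) ∈ face n n₁ n₂ := by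
    obtain ⟨y, hy, rfl⟩ := mem_intrinsicInterior.1 hν
    have hxs : x ∈ affineSpan ℝ (face n n₁ n₂) := subset_affineSpan ℝ _ hxf
    let g : ℝ → affineSpan ℝ (face n n₁ n₂) := fun t =>
      ⟨AffineMap.lineMap (y : RVec n) x (-t), AffineMap.lineMap_mem _ y.2 hxs⟩
    have hg : Continuous g := by
      refine Continuous.subtype_mk ?_ _
      simp only [AffineMap.lineMap_apply]
      fun_prop
    have hg0 : g 0 = y := by simp [g]
    have hev : ∀ᶠ t in 𝓝 (0 : ℝ), g t ∈ interior ((↑) ⁻¹' face n n₁ n₂ : Set (affineSpan ℝ _)) :=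
      hg.continuousAt.eventually_mem (isOpen_interior.mem_nhds (by rw [hg0]; exact hy))
    obtain ⟨t, ht, htpos⟩ := ((hev.filter_mono nhdsWithin_le_nhds).and
      (self_mem_nhdsWithin : _ ∈ 𝓝[>] (0 : ℝ))).exists
    refine ⟨t, htpos, ?_⟩
    have := interior_subset ht
    have h2 : (g t : RVec n) = (y : RVec n) + t • ((y : RVec n) - x) := by
      simp only [g, AffineMap.lineMap_apply, vsub_eq_sub, vadd_eq_add]
      module
    rw [← h2]
    exact this
  refine ⟨hνf, fun i hi => ?_, fun i hi => ?_⟩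
  · have h1 := htf.1.2.1 i
    rw [rowSum_add, rowSum_smul, rowSum_sub] at h1
    have := hxr2 i hi
    by_contra! h
    nlinarith
  · have h1 := htf.1.2.2 i
    rw [colSum_add, colSum_smul, colSum_sub] at h1
    have := hxc2 i hi
    by_contra! h
    nlinarith

/-! ### MaxWeight and the capacity region -/

/-- Natural numbers regarded as real numbers, entrywise. -/
def toReal (q : Config n) : RVec n := fun i j => (q i j : ℝ)

lemma dot_toReal (q s : Config n) : dot (toReal q) (toReal s) = weight q s := by
  simp [dot, toReal, weight]

/-- Every point of the capacity region is dominated by a doubly stochastic matrix. -/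
lemma exists_doublyStochastic_ge {x : RVec n} (hx : x ∈ capacityRegion n) :
    ∃ M ∈ doublyStochastic ℝ (Fin n), ∀ i j, x i j ≤ M i j := by
  set D : ℝ := ∑ i, (1 - rowSum x i) with hD
  have hD' : D = ∑ j, (1 - colSum x j) := by
    simp only [hD, Finset.sum_sub_distrib, rowSum, colSum]
    rw [Finset.sum_comm]
  have hr : ∀ i, 0 ≤ 1 - rowSum x i := fun i => sub_nonneg.2 (hx.2.1 i)
  have hc : ∀ i, 0 ≤ 1 - colSum x i := fun i => sub_nonneg.2 (hx.2.2 i)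
  have hD0 : 0 ≤ D := Finset.sum_nonneg fun i _ => hr i
  -- A rank one correction fills all row and column deficits at once, because both families of
  -- deficits have total `D`. If `D = 0`, every deficit is `0` and the quotient is `0` by
  -- convention.
  refine ⟨Matrix.of fun i j => x i j + (1 - rowSum x i) * (1 - colSum x j) / D, ?_, fun i j => ?_⟩
  · rw [mem_doublyStochastic_iff_sum]
    refine ⟨fun i j => ?_, fun i => ?_, fun j => ?_⟩
    · have := hx.1 i j
      have := hr i
      have := hc j
      simp only [Matrix.of_apply]
      positivity
    · simp only [Matrix.of_apply, Finset.sum_add_distrib, ← Finset.sum_div, ← Finset.mul_sum,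
        ← hD']
      rcases hD0.eq_or_lt with h | h
      · have := (Finset.sum_eq_zero_iff_of_nonneg fun i _ => hr i).1 (hD ▸ h.symm) i
          (Finset.mem_univ i)
        rw [this]
        simp only [rowSum] at this
        simp only [zero_mul, zero_div, add_zero]
        linarith
      · rw [mul_div_cancel_right₀ _ h.ne']
        simp [rowSum]
    · simp only [Matrix.of_apply, Finset.sum_add_distrib, ← Finset.sum_div, ← Finset.sum_mul,
        ← hD]
      rcases hD0.eq_or_lt with h | h
      · have := (Finset.sum_eq_zero_iff_of_nonneg fun i _ => hc i).1 (hD' ▸ h.symm) j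
          (Finset.mem_univ j)
        rw [this]
        simp only [colSum] at this
        simp only [mul_zero, zero_div, add_zero]
        linarith
      · rw [mul_div_cancel_left₀ _ h.ne']
        simp [colSum]
  · have := hr i
    have := hc j
    have : 0 ≤ (1 - rowSum x i) * (1 - colSum x j) / D := by positivity
    simp only [Matrix.of_apply]
    linarith

/-- By Birkhoff's theorem the dominating doubly stochastic matrix is a convex combination of
permutation matrices, which are feasible schedules. -/
lemma dot_le_of_weight_le {q : Config n} {w : ℕ}
    (hw : ∀ s ∈ feasibleSchedules n, weight q s ≤ w) {x : RVec n} (hx : x ∈ capacityRegion n) :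
    dot (toReal q) x ≤ w := by
  obtain ⟨M, hM, hxM⟩ := exists_doublyStochastic_ge hx
  obtain ⟨c, hc0, hc1, hcM⟩ := exists_eq_sum_perm_of_mem_doublyStochastic hM
  have h1 : dot (toReal q) x ≤ dot (toReal q) M := by
    refine Finset.sum_le_sum fun i _ => Finset.sum_le_sum fun j _ => ?_
    exact mul_le_mul_of_nonneg_left (hxM i j) (Nat.cast_nonneg _)
  have h2 : ∀ τ : Equiv.Perm (Fin n), dot (toReal q) (τ.permMatrix ℝ) ≤ w := by
    intro τ
    have : (τ.permMatrix ℝ : Matrix _ _ ℝ) =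
        toReal (fun i j => if τ i = j then 1 else 0 : Config n) := by
      funext i j
      simp [toReal, Equiv.Perm.permMatrix, PEquiv.toMatrix_apply, eq_comm]
    rw [this, dot_toReal]
    exact_mod_cast hw _ ⟨fun i => by simp, fun j => by
      simp [← Equiv.eq_symm_apply]⟩
  have h3 : dot (toReal q) M = ∑ τ, c τ * dot (toReal q) (τ.permMatrix ℝ) := by
    rw [← hcM]
    simp only [dot, Finset.mul_sum, Matrix.sum_apply, Matrix.smul_apply, smul_eq_mul]
    rw [Finset.sum_comm]
    simp_rw [Finset.sum_comm (s := Finset.univ (α := Equiv.Perm (Fin n)))]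
    rw [Finset.sum_comm]
    refine Finset.sum_congr rfl fun j _ => Finset.sum_congr rfl fun i _ =>
      Finset.sum_congr rfl fun τ _ => ?_
    ring
  refine h1.trans (h3.trans_le ?_)
  calc ∑ τ, c τ * dot (toReal q) (τ.permMatrix ℝ) ≤ ∑ τ, c τ * w :=
        Finset.sum_le_sum fun τ _ => mul_le_mul_of_nonneg_left (h2 τ) (hc0 τ)
    _ = w := by rw [← Finset.sum_mul, hc1, one_mul]

/-! ### Orthogonal projection onto the span of the saturated ports -/

/-- The indicator of the first `m` ports. -/
def sat (m : ℕ) (i : Fin n) : ℝ := if (i : ℕ) < m then 1 else 0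

lemma sat_mul_self (m : ℕ) (i : Fin n) : sat m i * sat m i = sat m i := by
  unfold sat; split_ifs <;> simp

lemma sat_nonneg (m : ℕ) (i : Fin n) : 0 ≤ sat m i := by
  unfold sat; split_ifs <;> simp

lemma sum_sat {m : ℕ} (hm : m ≤ n) : ∑ i : Fin n, sat m i = m := by
  simp only [sat]
  rw [Finset.sum_boole, Fin.card_filter_val_lt, min_eq_right hm]

/-- Total over the saturated rows. -/
noncomputable def rowTot (n₁ : ℕ) (x : RVec n) : ℝ := ∑ i, sat n₁ i * rowSum x i

/-- Total over the saturated columns. -/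
noncomputable def colTot (n₂ : ℕ) (x : RVec n) : ℝ := ∑ j, sat n₂ j * colSum x j

/-- The orthogonal projection onto the span of the saturated rows and columns. -/
noncomputable def spanProj (n₁ n₂ : ℕ) (x : RVec n) : RVec n := fun i j =>
  sat n₁ i * ((rowSum x i - (n * colTot n₂ x - n₂ * rowTot n₁ x) / ((n : ℝ) ^ 2 - n₁ * n₂)) / n) +
    sat n₂ j *
      ((colSum x j - (n * rowTot n₁ x - n₁ * colTot n₂ x) / ((n : ℝ) ^ 2 - n₁ * n₂)) / n)

lemma rowTot_sub (n₁ : ℕ) (x y : RVec n) : rowTot n₁ (x - y) = rowTot n₁ x - rowTot n₁ y := by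
  simp [rowTot, rowSum_sub, mul_sub, Finset.sum_sub_distrib]

lemma colTot_sub (n₂ : ℕ) (x y : RVec n) : colTot n₂ (x - y) = colTot n₂ x - colTot n₂ y := by
  simp [colTot, colSum_sub, mul_sub, Finset.sum_sub_distrib]

lemma spanProj_sub (n₁ n₂ : ℕ) (x y : RVec n) :
    spanProj n₁ n₂ (x - y) = spanProj n₁ n₂ x - spanProj n₁ n₂ y := by
  funext i j
  simp only [spanProj, rowSum_sub, colSum_sub, rowTot_sub, colTot_sub, Pi.sub_apply]
  ring

lemma spanProj_neg (n₁ n₂ : ℕ) (x : RVec n) : spanProj n₁ n₂ (-x) = -spanProj n₁ n₂ x := by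
  have h0 : spanProj n₁ n₂ (0 : RVec n) = 0 := by
    have := spanProj_sub n₁ n₂ (0 : RVec n) 0
    simpa using this
  rw [← zero_sub, spanProj_sub, h0, zero_sub]

lemma spanProj_add (n₁ n₂ : ℕ) (x y : RVec n) :
    spanProj n₁ n₂ (x + y) = spanProj n₁ n₂ x + spanProj n₁ n₂ y := by
  rw [← sub_neg_eq_add, spanProj_sub, spanProj_neg, sub_neg_eq_add]

/-- `x` and `y` have the same sums over the saturated rows and columns. -/
def SameSat (n₁ n₂ : ℕ) (x y : RVec n) : Prop :=
  (∀ i : Fin n, (i : ℕ) < n₁ → rowSum x i = rowSum y i) ∧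
    ∀ j : Fin n, (j : ℕ) < n₂ → colSum x j = colSum y j

lemma SameSat.sat_row {n₁ n₂ : ℕ} {x y : RVec n} (h : SameSat n₁ n₂ x y) (i : Fin n) :
    sat n₁ i * rowSum x i = sat n₁ i * rowSum y i := by
  unfold sat
  split_ifs with hi
  · rw [h.1 i hi]
  · simp

lemma SameSat.sat_col {n₁ n₂ : ℕ} {x y : RVec n} (h : SameSat n₁ n₂ x y) (j : Fin n) :
    sat n₂ j * colSum x j = sat n₂ j * colSum y j := by
  unfold sat
  split_ifs with hi
  · rw [h.2 j hi]
  · simp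

lemma SameSat.rowTot_eq {n₁ n₂ : ℕ} {x y : RVec n} (h : SameSat n₁ n₂ x y) :
    rowTot n₁ x = rowTot n₁ y := Finset.sum_congr rfl fun i _ => h.sat_row i

lemma SameSat.colTot_eq {n₁ n₂ : ℕ} {x y : RVec n} (h : SameSat n₁ n₂ x y) :
    colTot n₂ x = colTot n₂ y := Finset.sum_congr rfl fun i _ => h.sat_col i

lemma SameSat.spanProj_eq {n₁ n₂ : ℕ} {x y : RVec n} (h : SameSat n₁ n₂ x y) :
    spanProj n₁ n₂ x = spanProj n₁ n₂ y := by
  funext i j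
  have h1 := h.sat_row i
  have h2 := h.sat_col j
  simp only [spanProj, h.rowTot_eq, h.colTot_eq]
  linear_combination (1 / (n : ℝ)) * h1 + (1 / (n : ℝ)) * h2

lemma dot_row_mul (x : RVec n) (f : Fin n → ℝ) : dot x (fun i _ => f i) = ∑ i, f i * rowSum x i := by
  simp only [dot, rowSum, Finset.mul_sum, mul_comm]

lemma dot_col_mul (x : RVec n) (f : Fin n → ℝ) : dot x (fun _ j => f j) = ∑ j, f j * colSum x j := by
  simp only [dot, colSum, Finset.mul_sum]
  rw [Finset.sum_comm]
  simp only [mul_comm]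

/-- The form depends on saturated port sums only. This exhibits its symmetry and, with `y = x`,
writes it as a combination of squares and products of linear functionals, ready for covariance
computations. -/
lemma dot_spanProj (n₁ n₂ : ℕ) (x y : RVec n) :
    dot x (spanProj n₁ n₂ y) =
      (∑ i, sat n₁ i * (rowSum x i * rowSum y i) + ∑ j, sat n₂ j * (colSum x j * colSum y j)
        - (rowTot n₁ x * (n * colTot n₂ y - n₂ * rowTot n₁ y) +
          colTot n₂ x * (n * rowTot n₁ y - n₁ * colTot n₂ y)) / ((n : ℝ) ^ 2 - n₁ * n₂)) / n := by
  have : spanProj n₁ n₂ y =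
      (fun i _ => sat n₁ i * ((rowSum y i -
        (n * colTot n₂ y - n₂ * rowTot n₁ y) / ((n : ℝ) ^ 2 - n₁ * n₂)) / n) : RVec n) +
      (fun _ j => sat n₂ j * ((colSum y j -
        (n * rowTot n₁ y - n₁ * colTot n₂ y) / ((n : ℝ) ^ 2 - n₁ * n₂)) / n) : RVec n) := rfl
  rw [this, dot_add_right, dot_row_mul, dot_col_mul]
  have e1 : ∀ c : ℝ, ∑ i, sat n₁ i * ((rowSum y i - c) / n) * rowSum x i =
      (∑ i, sat n₁ i * (rowSum x i * rowSum y i) - rowTot n₁ x * c) / n := by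
    intro c
    rw [rowTot, Finset.sum_mul, ← Finset.sum_sub_distrib, Finset.sum_div]
    refine Finset.sum_congr rfl fun i _ => ?_
    ring
  have e2 : ∀ c : ℝ, ∑ i, sat n₂ i * ((colSum y i - c) / n) * colSum x i =
      (∑ i, sat n₂ i * (colSum x i * colSum y i) - colTot n₂ x * c) / n := by
    intro c
    rw [colTot, Finset.sum_mul, ← Finset.sum_sub_distrib, Finset.sum_div]
    refine Finset.sum_congr rfl fun i _ => ?_
    ring
  rw [e1, e2]
  ring

lemma dot_spanProj_comm (n₁ n₂ : ℕ) (x y : RVec n) :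
    dot x (spanProj n₁ n₂ y) = dot (spanProj n₁ n₂ x) y := by
  rw [dot_comm (spanProj n₁ n₂ x), dot_spanProj, dot_spanProj]
  simp only [mul_comm (rowSum y _), mul_comm (colSum y _)]
  ring

lemma denom_pos {n₁ n₂ : ℕ} (hn₁ : n₁ < n) (hn₂ : n₂ < n) : 0 < (n : ℝ) ^ 2 - n₁ * n₂ := by
  have h1 : (n₁ : ℝ) < n := by exact_mod_cast hn₁
  have h2 : (n₂ : ℝ) < n := by exact_mod_cast hn₂
  have h3 : (0 : ℝ) ≤ n₁ := by positivity
  have h4 : (0 : ℝ) ≤ n₂ := by positivity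
  nlinarith

/-- This is what determines the coefficients in `spanProj`. If saturated rows carry `r i` and
saturated columns `c j`, the equations are `n r i + ∑ c = rowSum x i` and `n c j + ∑ r = colSum x
j`; summing them gives a two by two system with determinant `n² - n₁ n₂`. -/
lemma sameSat_spanProj {n₁ n₂ : ℕ} (hn₁ : n₁ < n) (hn₂ : n₂ < n) (x : RVec n) :
    SameSat n₁ n₂ (spanProj n₁ n₂ x) x := by
  have hn : (n : ℝ) ≠ 0 := by
    have : 0 < n := (Nat.zero_le _).trans_lt hn₁
    positivity
  have hd := (denom_pos hn₁ hn₂).ne'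
  have eR : ∀ c : ℝ, ∑ i, sat n₁ i * ((rowSum x i - c) / n) = (rowTot n₁ x - n₁ * c) / n := by
    intro c
    rw [rowTot, ← sum_sat (n := n) hn₁.le, Finset.sum_mul, ← Finset.sum_sub_distrib,
      Finset.sum_div]
    exact Finset.sum_congr rfl fun i _ => by ring
  have eC : ∀ c : ℝ, ∑ i, sat n₂ i * ((colSum x i - c) / n) = (colTot n₂ x - n₂ * c) / n := by
    intro c
    rw [colTot, ← sum_sat (n := n) hn₂.le, Finset.sum_mul, ← Finset.sum_sub_distrib,
      Finset.sum_div]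
    exact Finset.sum_congr rfl fun i _ => by ring
  constructor
  · intro i hi
    have hs : sat n₁ i = 1 := if_pos hi
    rw [rowSum]
    simp only [spanProj]
    rw [Finset.sum_add_distrib, eC, hs]
    simp only [Finset.sum_const, Finset.card_univ, Fintype.card_fin, nsmul_eq_mul, one_mul]
    generalize hD : (n : ℝ) ^ 2 - n₁ * n₂ = D at hd
    field_simp
    linear_combination (-colTot n₂ x) * hD
  · intro j hj
    have hs : sat n₂ j = 1 := if_pos hj
    rw [colSum]
    simp only [spanProj]
    rw [Finset.sum_add_distrib, eR, hs]
    simp only [Finset.sum_const, Finset.card_univ, Fintype.card_fin, nsmul_eq_mul, one_mul]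
    generalize hD : (n : ℝ) ^ 2 - n₁ * n₂ = D at hd
    field_simp
    linear_combination (-rowTot n₁ x) * hD

lemma spanProj_spanProj {n₁ n₂ : ℕ} (hn₁ : n₁ < n) (hn₂ : n₂ < n) (x : RVec n) :
    spanProj n₁ n₂ (spanProj n₁ n₂ x) = spanProj n₁ n₂ x :=
  (sameSat_spanProj hn₁ hn₂ x).spanProj_eq

lemma dot_spanProj_self {n₁ n₂ : ℕ} (hn₁ : n₁ < n) (hn₂ : n₂ < n) (x : RVec n) :
    dot x (spanProj n₁ n₂ x) = nrm (spanProj n₁ n₂ x) ^ 2 := by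
  rw [nrm_sq, ← dot_spanProj_comm, spanProj_spanProj hn₁ hn₂]

lemma nrm_spanProj_le {n₁ n₂ : ℕ} (hn₁ : n₁ < n) (hn₂ : n₂ < n) (x : RVec n) :
    nrm (spanProj n₁ n₂ x) ≤ nrm x := by
  have h1 := dot_spanProj_self hn₁ hn₂ x
  have h2 := dot_le x (spanProj n₁ n₂ x)
  rcases (nrm_nonneg (spanProj n₁ n₂ x)).eq_or_lt with h | h
  · rw [← h]; exact nrm_nonneg x
  · rw [h1, sq] at h2
    exact le_of_mul_le_mul_right h2 h

lemma nrm_sub_spanProj_le {n₁ n₂ : ℕ} (hn₁ : n₁ < n) (hn₂ : n₂ < n) (x : RVec n) :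
    nrm (x - spanProj n₁ n₂ x) ≤ nrm x := by
  apply Real.sqrt_le_sqrt
  have h1 := dot_spanProj_self hn₁ hn₂ x
  rw [dot_sub_left, dot_sub_right, dot_sub_right, dot_comm (spanProj n₁ n₂ x) x, ← nrm_sq (spanProj n₁ n₂ x)]
  nlinarith [nrm_nonneg (spanProj n₁ n₂ x)]

/-- The residual `z` of the projection has zero saturated sums, so it is orthogonal to `para x`;
hence `z` is orthogonal to itself. -/
lemma spanProj_para {n₁ n₂ : ℕ} (hn₁ : n₁ < n) (hn₂ : n₂ < n) (x : RVec n) :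
    spanProj n₁ n₂ (para n₁ n₂ x) = para n₁ n₂ x := by
  set z := para n₁ n₂ x - spanProj n₁ n₂ (para n₁ n₂ x) with hz
  have hs : SameSat n₁ n₂ z 0 := by
    have h := sameSat_spanProj hn₁ hn₂ (para n₁ n₂ x)
    refine ⟨fun i hi => ?_, fun i hi => ?_⟩
    · rw [hz, rowSum_sub, h.1 i hi]; simp [rowSum]
    · rw [hz, colSum_sub, h.2 i hi]; simp [colSum]
  have h1 : dot (para n₁ n₂ x) z = 0 := dot_para_eq_zero x
    (fun i hi => by rw [hs.1 i hi]; simp [rowSum]) (fun i hi => by rw [hs.2 i hi]; simp [colSum])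
  have h2 : nrm z = 0 := by
    rw [nrm, Real.sqrt_eq_zero']
    have h3 := dot_spanProj_self hn₁ hn₂ (para n₁ n₂ x)
    rw [hz] at h1 ⊢
    rw [dot_sub_right] at h1
    rw [dot_sub_left, dot_sub_right, dot_sub_right, h1, dot_comm, h3, nrm_sq]
    simp
  funext i j
  have h3 := abs_apply_le_nrm z i j
  rw [h2, abs_nonpos_iff, hz] at h3
  simp only [Pi.sub_apply] at h3
  linarith

/-- The cone sits inside the span, so collapse onto the cone also controls the distance to the span.
-/
lemma nrm_sub_spanProj_le_perpNorm {n₁ n₂ : ℕ} (hn₁ : n₁ < n) (hn₂ : n₂ < n) (x : RVec n) :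
    nrm (x - spanProj n₁ n₂ x) ≤ perpNorm n₁ n₂ x := by
  have : x - spanProj n₁ n₂ x = perp n₁ n₂ x - spanProj n₁ n₂ (perp n₁ n₂ x) := by
    conv_lhs => rw [← para_add_perp n₁ n₂ x, spanProj_add, spanProj_para hn₁ hn₂]
    abel
  rw [this]
  exact nrm_sub_spanProj_le hn₁ hn₂ _

/-! ### Unused service -/

/-- The unused service of a time slot. -/
def unused (q a s : Config n) : RVec n :=
  toReal (nextQueue q a s) - (toReal q + toReal a - toReal s)

lemma toReal_nextQueue (q a s : Config n) :
    toReal (nextQueue q a s) = toReal q + (toReal a - toReal s + unused q a s) := by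
  rw [unused]; abel

lemma feasible_le_one {s : Config n} (hs : s ∈ feasibleSchedules n) (i j : Fin n) :
    s i j ≤ 1 :=
  (Finset.single_le_sum (f := fun j => s i j) (fun _ _ => Nat.zero_le _)
    (Finset.mem_univ j)).trans (hs.1 i)

lemma maximal_subset_feasible {s : Config n} (hs : s ∈ maximalSchedules n) :
    s ∈ feasibleSchedules n := ⟨fun i => (hs.1 i).le, fun j => (hs.2 j).le⟩

/-- A schedule entry is at most `1`, so truncation acts only on an empty queue without arrivals. All
complementarity relations for unused service follow. -/
lemma unused_cases {q a s : Config n} (hs : s ∈ feasibleSchedules n) (i j : Fin n) :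
    (unused q a s i j = 0 ∨ unused q a s i j = 1 ∧ q i j = 0 ∧ a i j = 0 ∧ s i j = 1 ∧
      nextQueue q a s i j = 0) := by
  have h := feasible_le_one hs i j
  rcases le_or_gt (s i j) (q i j + a i j) with h1 | h1
  · left
    simp only [unused, toReal, nextQueue, Pi.sub_apply, Pi.add_apply]
    push_cast [Nat.cast_sub h1]
    ring
  · right
    obtain ⟨h2, h3, h4⟩ : q i j = 0 ∧ a i j = 0 ∧ s i j = 1 := by omega
    simp [unused, toReal, nextQueue, h2, h3, h4]

lemma unused_nonneg {q a s : Config n} (hs : s ∈ feasibleSchedules n) (i j : Fin n) :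
    0 ≤ unused q a s i j := by
  rcases unused_cases (q := q) (a := a) hs i j with h | h
  · rw [h]
  · rw [h.1]; norm_num

lemma unused_le_one {q a s : Config n} (hs : s ∈ feasibleSchedules n) (i j : Fin n) :
    unused q a s i j ≤ 1 := by
  rcases unused_cases (q := q) (a := a) hs i j with h | h
  · rw [h]; norm_num
  · rw [h.1]

lemma dot_unused_eq_zero {q a s : Config n} (hs : s ∈ feasibleSchedules n) :
    dot (toReal q) (unused q a s) = 0 := by
  refine Finset.sum_eq_zero fun i _ => Finset.sum_eq_zero fun j _ => ?_
  rcases unused_cases (q := q) (a := a) hs i j with h | h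
  · rw [h, mul_zero]
  · simp [toReal, h.2.1]

lemma nextQueue_mul_unused {q a s : Config n} (hs : s ∈ feasibleSchedules n) (i j : Fin n) :
    toReal (nextQueue q a s) i j * unused q a s i j = 0 := by
  rcases unused_cases (q := q) (a := a) hs i j with h | h
  · rw [h, mul_zero]
  · simp [toReal, h.2.2.2.2]

/-- Unused service is orthogonal to `q`, while its negative lies in the polar cone and so pairs
nonpositively with `para`. -/
lemma dot_perp_unused_nonpos (n₁ n₂ : ℕ) {q a s : Config n} (hs : s ∈ feasibleSchedules n) :
    dot (perp n₁ n₂ (toReal q)) (unused q a s) ≤ 0 := by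
  have h1 := dot_unused_eq_zero (q := q) (a := a) hs
  have h2 := dot_para_nonpos (n₁ := n₁) (n₂ := n₂) (toReal q) (y := -unused q a s)
    ⟨fun i _ => by
      rw [rowSum_neg, neg_nonpos]; exact Finset.sum_nonneg fun j _ => unused_nonneg hs i j,
    fun j _ => by
      rw [colSum_neg, neg_nonpos]; exact Finset.sum_nonneg fun i _ => unused_nonneg hs i j⟩
  rw [dot_neg_right] at h2
  rw [← para_add_perp n₁ n₂ (toReal q), dot_add_left] at h1
  linarith

lemma nrm_step_le {q a s : Config n} {amax : ℕ} (hs : s ∈ feasibleSchedules n)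
    (ha : ∀ i j, a i j ≤ amax) :
    nrm (toReal a - toReal s + unused q a s) ≤ n * (amax + 1) := by
  apply nrm_le_of_abs_le (by positivity)
  intro i j
  have h1 : (a i j : ℝ) ≤ amax := by exact_mod_cast ha i j
  have h2 : (s i j : ℝ) ≤ 1 := by exact_mod_cast feasible_le_one hs i j
  have h3 := unused_nonneg (q := q) (a := a) hs i j
  have h4 : (0 : ℝ) ≤ a i j := by positivity
  have h5 : (0 : ℝ) ≤ s i j := by positivity
  simp only [Pi.add_apply, Pi.sub_apply, toReal]
  rw [abs_le]
  rcases unused_cases (q := q) (a := a) hs i j with h | h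
  · rw [h]; constructor <;> linarith
  · rw [h.1]
    simp only [h.2.2.1, h.2.2.2.1]
    constructor <;> simp <;> linarith

lemma nrm_add_sq (x y : RVec n) : nrm (x + y) ^ 2 = nrm x ^ 2 + 2 * dot x y + dot y y := by
  rw [nrm_sq, nrm_sq, dot_add_left, dot_add_right, dot_add_right, dot_comm y]
  ring

/-- Increment of the squared distance to the cone in one time slot. -/
lemma perpNorm_sq_nextQueue_le (n₁ n₂ : ℕ) {q a s : Config n} {amax : ℕ}
    (hs : s ∈ feasibleSchedules n) (ha : ∀ i j, a i j ≤ amax) :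
    perpNorm n₁ n₂ (toReal (nextQueue q a s)) ^ 2 ≤ perpNorm n₁ n₂ (toReal q) ^ 2 +
      2 * dot (perp n₁ n₂ (toReal q)) (toReal a - toReal s) + (n * (amax + 1)) ^ 2 := by
  set d := toReal a - toReal s + unused q a s with hd
  have h1 : perpNorm n₁ n₂ (toReal (nextQueue q a s)) ^ 2 ≤ nrm (perp n₁ n₂ (toReal q) + d) ^ 2 := by
    rw [toReal_nextQueue]
    exact pow_le_pow_left₀ (perpNorm_nonneg _ _ _) (perpNorm_add_le _ _ _ _) 2
  have h2 : dot d d ≤ (n * (amax + 1)) ^ 2 := by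
    rw [← nrm_sq]
    exact pow_le_pow_left₀ (nrm_nonneg _) (nrm_step_le hs ha) 2
  have h3 := dot_perp_unused_nonpos n₁ n₂ (q := q) (a := a) hs
  have h4 : dot (perp n₁ n₂ (toReal q)) d = dot (perp n₁ n₂ (toReal q)) (toReal a - toReal s) +
      dot (perp n₁ n₂ (toReal q)) (unused q a s) := by rw [hd, dot_add_right]
  have h5 := nrm_add_sq (perp n₁ n₂ (toReal q)) d
  unfold perpNorm at *
  linarith

/-- Increment of the cubed distance to the cone in one time slot. -/
lemma perpNorm_cube_nextQueue_le (n₁ n₂ : ℕ) {q a s : Config n} {amax : ℕ}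
    (hs : s ∈ feasibleSchedules n) (ha : ∀ i j, a i j ≤ amax) :
    perpNorm n₁ n₂ (toReal (nextQueue q a s)) ^ 3 ≤ perpNorm n₁ n₂ (toReal q) ^ 3 +
      3 / 2 * perpNorm n₁ n₂ (toReal q) *
        (2 * dot (perp n₁ n₂ (toReal q)) (toReal a - toReal s) + (n * (amax + 1)) ^ 2) +
      (n * (amax + 1)) ^ 2 * (3 / 2 * perpNorm n₁ n₂ (toReal q) + n * (amax + 1)) := by
  have h1 := perpNorm_sq_nextQueue_le n₁ n₂ (q := q) hs ha
  have h2 := (abs_perpNorm_add_sub_le n₁ n₂ (toReal q) _).trans (nrm_step_le (q := q) hs ha)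
  rw [← toReal_nextQueue] at h2
  set y := perpNorm n₁ n₂ (toReal (nextQueue q a s))
  set x := perpNorm n₁ n₂ (toReal q) with hx
  set c : ℝ := n * (amax + 1)
  have hx0 : 0 ≤ x := perpNorm_nonneg _ _ _
  have hy0 : 0 ≤ y := perpNorm_nonneg _ _ _
  rw [abs_le] at h2
  -- This identity reduces the cube to the known drift of the square; the remainder is only linear
  -- in `x`, since `|y - x| ≤ c`.
  have h3 : y ^ 3 = x ^ 3 + 3 / 2 * x * (y ^ 2 - x ^ 2) + (y - x) ^ 2 * (y + x / 2) := by ring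
  have h4 : (y - x) ^ 2 ≤ c ^ 2 := sq_le_sq' h2.1 h2.2
  have h5 : (y - x) ^ 2 * (y + x / 2) ≤ c ^ 2 * (3 / 2 * x + c) :=
    mul_le_mul h4 (by linarith) (by positivity) (by positivity)
  have h6 : 3 / 2 * x * (y ^ 2 - x ^ 2) ≤ 3 / 2 * x *
      (2 * dot (perp n₁ n₂ (toReal q)) (toReal a - toReal s) + c ^ 2) :=
    mul_le_mul_of_nonneg_left (by linarith) (by positivity)
  linarith

/-- A MaxWeight schedule moves the queue lengths towards the cone. -/
lemma dot_perp_sub_le {n₁ n₂ : ℕ} {ν : RVec n} (hν : ν ∈ face n n₁ n₂) {δ : ℝ} (hδ : 0 < δ)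
    (hslack : ∀ y ∈ polarCone n n₁ n₂, nrm y ≤ 1 → ν + δ • y ∈ capacityRegion n)
    {q s : Config n} (hs : s ∈ maximalSchedules n)
    (hmax : ∀ s' ∈ feasibleSchedules n, weight q s' ≤ weight q s) :
    dot (perp n₁ n₂ (toReal q)) (ν - toReal s) ≤ -δ * perpNorm n₁ n₂ (toReal q) := by
  set p := perp n₁ n₂ (toReal q) with hp
  have hpn : perpNorm n₁ n₂ (toReal q) = nrm p := rfl
  rw [hpn]
  have hrow : ∀ i, rowSum (toReal s) i = 1 := fun i => by
    have := hs.1 i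
    simp only [rowSum, toReal]
    exact_mod_cast this
  have hcol : ∀ i, colSum (toReal s) i = 1 := fun i => by
    have := hs.2 i
    simp only [colSum, toReal]
    exact_mod_cast this
  -- The vectors `ν` and `s` agree on saturated ports, so `perp` may be replaced by `q`, for which
  -- the optimality of `s` is available.
  have hpar : dot (para n₁ n₂ (toReal q)) (ν - toReal s) = 0 := dot_para_eq_zero _
    (fun i hi => by rw [rowSum_sub, hν.2.1 i hi, hrow, sub_self])
    (fun i hi => by rw [colSum_sub, hν.2.2 i hi, hcol, sub_self])
  have heq : dot p (ν - toReal s) = dot (toReal q) (ν - toReal s) := by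
    conv_rhs => rw [← para_add_perp n₁ n₂ (toReal q), dot_add_left, hpar, zero_add]
  rw [heq]
  rcases (nrm_nonneg p).eq_or_lt with h | h
  · have := dot_le_of_weight_le hmax hν.1
    rw [← h, dot_sub_right, dot_toReal]
    linarith
  -- Comparing `s` with `ν` moved by `δ` along `p / ‖p‖` gains `δ ‖p‖`, because `⟨q, p⟩ = ‖p‖²`.
  · have hmem : (nrm p)⁻¹ • p ∈ polarCone n n₁ n₂ := by
      have := perp_mem n₁ n₂ (toReal q)
      refine ⟨fun i hi => ?_, fun i hi => ?_⟩
      · rw [rowSum_smul]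
        exact mul_nonpos_of_nonneg_of_nonpos (by positivity) (this.1 i hi)
      · rw [colSum_smul]
        exact mul_nonpos_of_nonneg_of_nonpos (by positivity) (this.2 i hi)
    have hle := dot_le_of_weight_le hmax (hslack _ hmem (by
      rw [nrm_smul, abs_of_pos (inv_pos.2 h), inv_mul_cancel₀ h.ne']))
    have hqp : dot (toReal q) p = nrm p ^ 2 := by
      have h0 := dot_para_perp n₁ n₂ (toReal q)
      rw [para, dot_sub_left] at h0
      rw [nrm_sq]
      linarith
    rw [dot_add_right, dot_smul_right, dot_smul_right, hqp, ← dot_toReal] at hle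
    have : δ * ((nrm p)⁻¹ * nrm p ^ 2) = δ * nrm p := by field_simp
    rw [dot_sub_right]
    linarith

/-! ### Markov chains on a countable state space -/

section MarkovChain

variable {X : Type*} [MeasurableSpace X]

lemma lintegral_invariant {K : Kernel X X} {π : Measure X} (hinv : K.Invariant π)
    {f : X → ℝ≥0∞} (hf : Measurable f) : ∫⁻ x, ∫⁻ y, f y ∂K x ∂π = ∫⁻ x, f x ∂π := by
  conv_rhs => rw [← hinv.def]
  rw [Measure.lintegral_bind K.measurable.aemeasurable hf.aemeasurable]

/-- Foster's moment bound; the Lyapunov function `f` need not be integrable. -/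
lemma lintegral_le_of_drift {K : Kernel X X} [IsMarkovKernel K] {π : Measure X}
    [IsProbabilityMeasure π] (hinv : K.Invariant π) {f g : X → ℝ≥0∞} (hf : Measurable f)
    (hg : Measurable g) (hf_fin : ∀ x, f x ≠ ∞) {C : ℝ≥0∞}
    (h : ∀ x, ∫⁻ y, f y ∂K x + g x ≤ f x + C) : ∫⁻ x, g x ∂π ≤ C := by
  have hmeas : ∀ N : ℕ, MeasurableSet {x | f x ≤ N} := fun N =>
    measurableSet_le hf measurable_const
  -- Truncating at `N` makes the Lyapunov function integrable, so invariance cancels it. Where `f ≤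
  -- N` the drift bound survives truncation; elsewhere the truncated function already has its
  -- maximal value `N`.
  have key : ∀ N : ℕ, ∫⁻ x, {x | f x ≤ N}.indicator g x ∂π ≤ C := by
    intro N
    have hfN : Measurable fun x => min (f x) N := hf.min measurable_const
    have h1 : ∀ x, ∫⁻ y, min (f y) N ∂K x + {x | f x ≤ N}.indicator g x ≤ min (f x) N + C := by
      intro x
      by_cases hx : f x ≤ N
      · rw [Set.indicator_of_mem (by exact hx), min_eq_left hx]
        refine le_trans ?_ (h x)
        gcongr with y
        exact min_le_left _ _
      · rw [Set.indicator_of_notMem (by exact hx), min_eq_right (not_le.1 hx).le, add_zero]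
        refine le_trans ?_ le_self_add
        calc ∫⁻ y, min (f y) N ∂K x ≤ ∫⁻ _, N ∂K x := lintegral_mono fun y => min_le_right _ _
          _ = N := by simp
    have h2 := lintegral_mono (μ := π) h1
    rw [lintegral_add_right _ (hg.indicator (hmeas N)), lintegral_add_right _ measurable_const,
      lintegral_invariant hinv hfN, lintegral_const, measure_univ, mul_one] at h2
    have hfin : ∫⁻ x, min (f x) N ∂π ≠ ∞ := by
      refine ne_top_of_le_ne_top (ENNReal.natCast_ne_top N) ?_
      calc ∫⁻ y, min (f y) N ∂π ≤ ∫⁻ _, N ∂π := lintegral_mono fun y => min_le_right _ _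
          _ = N := by simp
    exact (ENNReal.add_le_add_iff_left hfin).1 h2
  have hsup : ∀ x, g x = ⨆ N : ℕ, {x | f x ≤ N}.indicator g x := by
    intro x
    apply le_antisymm
    · obtain ⟨N, hN⟩ := ENNReal.exists_nat_gt (hf_fin x)
      refine le_iSup_of_le N ?_
      rw [Set.indicator_of_mem (by exact hN.le)]
    · exact iSup_le fun N => Set.indicator_le_self _ _ _
  simp_rw [hsup]
  rw [lintegral_iSup fun N => hg.indicator (hmeas N)]
  · exact iSup_le key
  · intro N M hNM x
    apply Set.indicator_le_indicator_of_subset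
    · intro y hy
      have hy' : f y ≤ N := hy
      have hNM' : (N : ℝ≥0∞) ≤ M := by exact_mod_cast hNM
      exact hy'.trans hNM'
    · simp

lemma bind_univ (K : Kernel X X) [IsMarkovKernel K] (μ : Measure X) :
    μ.bind K Set.univ = μ Set.univ := by
  rw [Measure.bind_apply MeasurableSet.univ K.measurable.aemeasurable]
  simp

variable [Countable X] [MeasurableSingletonClass X]

lemma measure_eq_tsum_indicator (μ : Measure X) (S : Set X) :
    μ S = ∑' x, S.indicator 1 x * μ {x} := by
  rw [← lintegral_countable', lintegral_indicator_one S.to_countable.measurableSet]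

lemma measure_le_of_singleton_le {μ ν : Measure X} (h : ∀ x, μ {x} ≤ ν {x}) : μ ≤ ν := by
  intro S
  rw [measure_eq_tsum_indicator μ, measure_eq_tsum_indicator ν]
  exact ENNReal.tsum_le_tsum fun x => mul_le_mul_right (h x) _

lemma bind_singleton (K : Kernel X X) (μ : Measure X) (y : X) :
    μ.bind K {y} = ∑' x, K x {y} * μ {x} := by
  rw [Measure.bind_apply (measurableSet_singleton y) K.measurable.aemeasurable,
    lintegral_countable']

lemma bind_mono (K : Kernel X X) {μ ν : Measure X} (h : μ ≤ ν) : μ.bind K ≤ ν.bind K := by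
  refine measure_le_of_singleton_le fun y => ?_
  rw [bind_singleton, bind_singleton]
  exact ENNReal.tsum_le_tsum fun x => mul_le_mul_right (h {x}) _

lemma bind_add (K : Kernel X X) (μ ν : Measure X) :
    (μ + ν).bind K = μ.bind K + ν.bind K := by
  refine Measure.ext_of_singleton fun y => ?_
  rw [Measure.add_apply, bind_singleton, bind_singleton, bind_singleton, ← ENNReal.tsum_add]
  simp [mul_add]

/-- Uniqueness of the stationary distribution, if every invariant measure charges a given
state. -/
lemma invariant_unique (K : Kernel X X) [IsMarkovKernel K] (x₀ : X)
    (hx₀ : ∀ ρ : Measure X, IsFiniteMeasure ρ → K.Invariant ρ → ρ ≠ 0 → ρ {x₀} ≠ 0)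
    {π₁ π₂ : Measure X} [IsProbabilityMeasure π₁] [IsProbabilityMeasure π₂]
    (h₁ : K.Invariant π₁) (h₂ : K.Invariant π₂) : π₁ = π₂ := by
  set m := π₁ ⊓ π₂ with hm
  have hm1 : m ≤ π₁ := inf_le_left
  have hm2 : m ≤ π₂ := inf_le_right
  have : IsFiniteMeasure m := isFiniteMeasure_of_le _ hm1
  -- The image of `m` lies below both invariant measures, hence below `m`, and has the same mass. So
  -- `m` is invariant, and so are the remainders `π₁ - m` and `π₂ - m`.
  have hle : m.bind K ≤ m := le_inf
    ((bind_mono K hm1).trans_eq h₁.def) ((bind_mono K hm2).trans_eq h₂.def)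
  have : IsFiniteMeasure (m.bind K) := isFiniteMeasure_of_le _ hle
  have hinv : m.bind K = m := Measure.eq_of_le_of_measure_univ_eq hle (bind_univ K m)
  have hsub : ∀ π : Measure X, K.Invariant π → m ≤ π → K.Invariant (π - m) := by
    intro π hπ hmπ
    have e1 : (π - m) + m = π := Measure.sub_add_cancel_of_le hmπ
    have e2 : (π - m).bind K + m = (π - m) + m := by
      nth_rewrite 2 [← hinv]
      rw [← bind_add, e1]
      exact hπ.def
    refine Measure.ext_of_singleton fun y => ?_
    have := congrArg (fun μ : Measure X => μ {y}) e2
    simp only [Measure.add_apply] at this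
    exact (ENNReal.add_left_inj (measure_ne_top m _)).1 this
  have hs1 := hsub π₁ h₁ hm1
  have hs2 := hsub π₂ h₂ hm2
  have e1 : (π₁ - m) + m = π₁ := Measure.sub_add_cancel_of_le hm1
  have e2 : (π₂ - m) + m = π₂ := Measure.sub_add_cancel_of_le hm2
  by_cases hc : m Set.univ = 1
  · have a1 : m = π₁ := Measure.eq_of_le_of_measure_univ_eq hm1 (by simp [hc])
    have a2 : m = π₂ := Measure.eq_of_le_of_measure_univ_eq hm2 (by simp [hc])
    rw [← a1, ← a2]
  exfalso
  have hne : ∀ π : Measure X, π Set.univ = 1 → (π - m) + m = π → π - m ≠ 0 := by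
    intro π hπ e h0
    rw [h0, zero_add] at e
    exact hc (e ▸ hπ)
  have p1 := hx₀ _ inferInstance hs1 (hne π₁ measure_univ e1)
  have p2 := hx₀ _ inferInstance hs2 (hne π₂ measure_univ e2)
  -- Both nonzero remainders charge `x₀`, so `m` plus `c` times the Dirac mass still lies below both
  -- measures. This contradicts the maximality of `m`.
  set c := min ((π₁ - m) {x₀}) ((π₂ - m) {x₀}) with hcdef
  have hc0 : c ≠ 0 := (lt_min (pos_iff_ne_zero.2 p1) (pos_iff_ne_zero.2 p2)).ne'
  have hadd : ∀ π : Measure X, (π - m) + m = π → c ≤ (π - m) {x₀} →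
      c • Measure.dirac x₀ + m ≤ π := by
    intro π e hcle
    refine le_trans ?_ e.le
    refine measure_le_of_singleton_le fun y => ?_
    simp only [Measure.add_apply, Measure.smul_apply, smul_eq_mul]
    gcongr
    rw [Measure.dirac_apply]
    by_cases hy : x₀ = y
    · subst hy; simpa using hcle
    · simp [hy]
  have hfin := le_inf (hadd π₁ e1 (min_le_left _ _)) (hadd π₂ e2 (min_le_right _ _))
  rw [← hm] at hfin
  have := hfin {x₀}
  simp only [Measure.add_apply, Measure.smul_apply, smul_eq_mul, Measure.dirac_apply,
    Set.mem_singleton_iff, Set.indicator_of_mem, Pi.one_apply, mul_one] at this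
  have h3 : c + m {x₀} ≤ 0 + m {x₀} := by simpa using this
  exact hc0 (nonpos_iff_eq_zero.1 ((ENNReal.add_le_add_iff_right (measure_ne_top m _)).1 h3))

/-- Foster's criterion for the existence of a stationary distribution. -/
lemma exists_invariant_of_drift (K : Kernel X X) [IsMarkovKernel K] (x₀ : X)
    {f g : X → ℝ≥0∞} (hf_fin : ∀ x, f x ≠ ∞) {C : ℝ≥0∞} (hC : C ≠ ∞)
    (hg : ∀ R : ℕ, {x | g x ≤ R}.Finite)
    (h : ∀ x, ∫⁻ y, f y ∂K x + g x ≤ f x + C) :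
    ∃ π : Measure X, IsProbabilityMeasure π ∧ K.Invariant π := by
  have hmeas : ∀ F : X → ℝ≥0∞, Measurable F := fun F => measurable_of_countable F
  let μ : ℕ → Measure X := fun t => Nat.rec (Measure.dirac x₀) (fun _ m => m.bind K) t
  have hμ0 : μ 0 = Measure.dirac x₀ := rfl
  have hμs : ∀ t, μ (t + 1) = (μ t).bind K := fun t => rfl
  have hμp : ∀ t, μ t Set.univ = 1 := by
    intro t
    induction t with
    | zero => simp [hμ0]
    | succ t ih => rw [hμs, bind_univ, ih]
  have hsum : ∀ t, ∫⁻ x, f x ∂μ t + ∑ r ∈ Finset.range t, ∫⁻ x, g x ∂μ r ≤ f x₀ + t * C := by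
    intro t
    induction t with
    | zero => simp [hμ0]
    | succ t ih =>
      have h1 := lintegral_mono (μ := μ t) h
      rw [lintegral_add_right _ (hmeas g), lintegral_add_right _ measurable_const,
        lintegral_const, hμp, mul_one,
        ← Measure.lintegral_bind K.measurable.aemeasurable (hmeas f).aemeasurable, ← hμs] at h1
      rw [Finset.sum_range_succ]
      calc _ = (∫⁻ x, f x ∂μ (t + 1) + ∫⁻ x, g x ∂μ t) + ∑ r ∈ Finset.range t, ∫⁻ x, g x ∂μ r := by
            ring
        _ ≤ (∫⁻ x, f x ∂μ t + C) + ∑ r ∈ Finset.range t, ∫⁻ x, g x ∂μ r := by gcongr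
        _ = (∫⁻ x, f x ∂μ t + ∑ r ∈ Finset.range t, ∫⁻ x, g x ∂μ r) + C := by ring
        _ ≤ (f x₀ + t * C) + C := by gcongr
        _ = _ := by push_cast; ring
  -- Krylov–Bogoliubov: time averages of the chain started at `x₀` are invariant up to `1 / (N +
  -- 1)`, and the summed drift bound controls their integrals of `g`.
  let m : ℕ → X → ℝ≥0∞ := fun N x => ((N + 1 : ℕ) : ℝ≥0∞)⁻¹ * ∑ t ∈ Finset.range (N + 1), μ t {x}
  let M : ℕ → Measure X := fun N => ((N + 1 : ℕ) : ℝ≥0∞)⁻¹ • ∑ t ∈ Finset.range (N + 1), μ t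
  have hMm : ∀ N x, M N {x} = m N x := by
    intro N x
    simp [M, m, Measure.finsetSum_apply]
  have hinv1 : ∀ N : ℕ, ((N + 1 : ℕ) : ℝ≥0∞)⁻¹ * ((N + 1 : ℕ) : ℝ≥0∞) = 1 := fun N =>
    ENNReal.inv_mul_cancel (by simp) (ENNReal.natCast_ne_top _)
  have hMuniv : ∀ N, M N Set.univ = 1 := by
    intro N
    simp only [M, Measure.smul_apply, Measure.finsetSum_apply, smul_eq_mul, hμp,
      Finset.sum_const, Finset.card_range, nsmul_eq_mul, mul_one]
    exact hinv1 N
  set B := f x₀ + C with hB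
  have hBfin : B ≠ ∞ := ENNReal.add_ne_top.2 ⟨hf_fin x₀, hC⟩
  have hMg : ∀ N, ∫⁻ x, g x ∂M N ≤ B := by
    intro N
    rw [lintegral_smul_measure, lintegral_finsetSum_measure]
    calc _ ≤ ((N + 1 : ℕ) : ℝ≥0∞)⁻¹ * (f x₀ + (N + 1 : ℕ) * C) := by
          rw [smul_eq_mul]
          gcongr
          exact le_trans le_add_self (hsum (N + 1))
      _ = ((N + 1 : ℕ) : ℝ≥0∞)⁻¹ * f x₀ + C := by
          rw [mul_add, ← mul_assoc, hinv1, one_mul]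
      _ ≤ B := by
          refine add_le_add_left (mul_le_of_le_one_left zero_le ?_) C
          rw [ENNReal.inv_le_one]
          simp
  have hMsub : ∀ N y, ∑' x, K x {y} * m N x ≤ m N y + ((N + 1 : ℕ) : ℝ≥0∞)⁻¹ := by
    intro N y
    have e : ∑' x, K x {y} * m N x =
        ((N + 1 : ℕ) : ℝ≥0∞)⁻¹ * ∑ t ∈ Finset.range (N + 1), μ (t + 1) {y} := by
      simp only [hμs, bind_singleton, m]
      rw [← Summable.tsum_finsetSum (fun _ _ => ENNReal.summable), ← ENNReal.tsum_mul_left]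
      congr 1
      funext x
      rw [Finset.mul_sum, Finset.mul_sum, Finset.mul_sum]
      exact Finset.sum_congr rfl fun t _ => by ring
    rw [e, ← mul_add_one]
    gcongr
    rw [Finset.sum_range_succ, Finset.sum_range_succ']
    gcongr
    · exact le_self_add
    · rw [← hμp (N + 1)]; exact measure_mono (Set.subset_univ _)
  -- Along an ultrafilter all point masses converge simultaneously, in place of a diagonal
  -- subsequence.
  let U : Ultrafilter ℕ := hyperfilter ℕ
  have hU : (U : Filter ℕ) ≤ atTop := Nat.hyperfilter_le_atTop
  let p : X → ℝ≥0∞ := fun x => (U.map fun N => m N x).lim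
  have hp : ∀ x, Tendsto (fun N => m N x) U (𝓝 (p x)) := fun x =>
    (U.map fun N => m N x).le_nhds_lim
  have hinv0 : Tendsto (fun N : ℕ => ((N + 1 : ℕ) : ℝ≥0∞)⁻¹) U (𝓝 0) :=
    ((tendsto_add_atTop_iff_nat 1).2 ENNReal.tendsto_inv_nat_nhds_zero).mono_left hU
  have hle1 : ∑' x, p x ≤ 1 := by
    rw [ENNReal.tsum_eq_iSup_sum]
    refine iSup_le fun F => le_of_tendsto' (tendsto_finsetSum F fun x _ => hp x) fun N => ?_
    simp_rw [← hMm]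
    rw [sum_measure_singleton, ← hMuniv N]
    exact measure_mono (Set.subset_univ _)
  have hge1 : 1 ≤ ∑' x, p x := by
    -- Tightness: by Markov's inequality at most `B / (R + 1)` of the mass lies outside a finite
    -- sublevel set of `g`, so no mass escapes in the limit.
    have hR : ∀ R : ℕ, 1 ≤ ∑' x, p x + B * ((R + 1 : ℕ) : ℝ≥0∞)⁻¹ := by
      intro R
      set F := (hg (R + 1)).toFinset with hF
      have h1 : ∀ N, 1 ≤ ∑ x ∈ F, m N x + B * ((R + 1 : ℕ) : ℝ≥0∞)⁻¹ := by
        intro N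
        rw [← hMuniv N]
        simp_rw [← hMm]
        rw [sum_measure_singleton]
        have hsub : (Set.univ : Set X) ⊆ (F : Set X) ∪ {x | ((R + 1 : ℕ) : ℝ≥0∞) ≤ g x} := by
          intro x _
          rcases le_total (g x) ((R + 1 : ℕ) : ℝ≥0∞) with hx | hx
          · left; simpa [hF] using hx
          · right; exact hx
        refine (measure_mono hsub).trans ((measure_union_le _ _).trans ?_)
        gcongr
        rw [← div_eq_mul_inv]
        refine (meas_ge_le_lintegral_div (hmeas g).aemeasurable (by simp)
          (ENNReal.natCast_ne_top _)).trans ?_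
        gcongr
        exact hMg N
      have h2 : 1 ≤ ∑ x ∈ F, p x + B * ((R + 1 : ℕ) : ℝ≥0∞)⁻¹ :=
        ge_of_tendsto' ((tendsto_finsetSum F fun x _ => hp x).add_const _) h1
      refine h2.trans ?_
      gcongr
      exact ENNReal.sum_le_tsum F
    have hlim : Tendsto (fun R : ℕ => ∑' x, p x + B * ((R + 1 : ℕ) : ℝ≥0∞)⁻¹) U
        (𝓝 (∑' x, p x + B * 0)) :=
      (ENNReal.Tendsto.const_mul hinv0 (Or.inr hBfin)).const_add _
    rw [mul_zero, add_zero] at hlim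
    exact ge_of_tendsto' hlim hR
  let π : Measure X := Measure.sum fun x => p x • Measure.dirac x
  have hπs : ∀ x, π {x} = p x := by
    intro x
    simp only [π, Measure.sum_apply _ (measurableSet_singleton x), Measure.smul_apply,
      smul_eq_mul]
    rw [tsum_eq_single x]
    · simp
    · intro y hy
      simp [hy]
  have hπp : IsProbabilityMeasure π := by
    constructor
    rw [measure_eq_tsum_indicator]
    simp only [Set.indicator_univ, Pi.one_apply, one_mul, hπs]
    exact le_antisymm hle1 hge1
  refine ⟨π, hπp, ?_⟩
  -- Only finite partial sums of the balance equation pass to the limit, which yields an inequality;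
  -- equality of total masses upgrades it.
  have hle : π.bind K ≤ π := by
    refine measure_le_of_singleton_le fun y => ?_
    rw [bind_singleton, hπs, ENNReal.tsum_eq_iSup_sum]
    refine iSup_le fun F => ?_
    simp_rw [hπs]
    have hl : Tendsto (fun N => ∑ x ∈ F, K x {y} * m N x) U (𝓝 (∑ x ∈ F, K x {y} * p x)) :=
      tendsto_finsetSum F fun x _ =>
        ENNReal.Tendsto.const_mul (hp x) (Or.inr (measure_ne_top _ _))
    have hr : Tendsto (fun N => m N y + ((N + 1 : ℕ) : ℝ≥0∞)⁻¹) U (𝓝 (p y + 0)) :=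
      (hp y).add hinv0
    rw [add_zero] at hr
    exact le_of_tendsto_of_tendsto' hl hr fun N => (ENNReal.sum_le_tsum F).trans (hMsub N y)
  have : IsFiniteMeasure (π.bind K) := isFiniteMeasure_of_le _ hle
  exact Measure.eq_of_le_of_measure_univ_eq hle (bind_univ K π)

end MarkovChain

/-! ### The arrivals of one time slot -/

instance (A : Fin n → Fin n → PMF ℕ) : IsProbabilityMeasure (arrivalLaw A) := by
  unfold arrivalLaw; infer_instance

lemma measurePreserving_arrival (A : Fin n → Fin n → PMF ℕ) (i j : Fin n) :
    MeasurePreserving (fun a : Config n => a i j) (arrivalLaw A) (A i j).toMeasure :=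
  (measurePreserving_eval (fun j => (A i j).toMeasure) j).comp
    (measurePreserving_eval (fun i => Measure.pi fun j => (A i j).toMeasure) i)

lemma ae_mem_support (p : PMF (Config n)) : ∀ᵐ s ∂p.toMeasure, s ∈ p.support := by
  rw [ae_iff]
  change p.toMeasure {s | s ∉ p.support} = 0
  rw [PMF.toMeasure_apply_eq_zero_iff _ (Set.to_countable _).measurableSet]
  exact Set.disjoint_left.2 fun x hx hx' => hx' hx

lemma ae_arrival_le {A : Fin n → Fin n → PMF ℕ} {amax : ℕ}
    (hA : ∀ i j, ∀ m, amax < m → A i j m = 0) :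
    ∀ᵐ a ∂arrivalLaw A, ∀ i j, a i j ≤ amax := by
  rw [ae_all_iff]; intro i
  rw [ae_all_iff]; intro j
  have h : ∀ᵐ m ∂(A i j).toMeasure, m ≤ amax := by
    rw [ae_iff, PMF.toMeasure_apply_eq_zero_iff _ (Set.to_countable _).measurableSet]
    refine Set.disjoint_left.2 fun m hm hm' => ?_
    rw [PMF.mem_support_iff] at hm
    exact hm (hA i j m (not_le.1 hm'))
  exact (measurePreserving_arrival A i j).quasiMeasurePreserving.ae h

lemma integrable_of_ae_mem_finite {X : Type*} [MeasurableSpace X] [Countable X]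
    [MeasurableSingletonClass X] {μ : Measure X} [IsFiniteMeasure μ] {S : Set X}
    (hS : S.Finite) (h : ∀ᵐ x ∂μ, x ∈ S) (F : X → ℝ) : Integrable F μ := by
  obtain ⟨C, hC⟩ := (hS.image fun x => ‖F x‖).bddAbove
  refine Integrable.of_bound (measurable_of_countable F).aestronglyMeasurable C ?_
  filter_upwards [h] with x hx using hC ⟨x, hx, rfl⟩

lemma finite_le_config (B : ℕ) : {q : Config n | ∀ i j, q i j ≤ B}.Finite := by
  refine (Set.finite_Icc (0 : Config n) (fun _ _ => B)).subset fun q hq => ?_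
  exact ⟨fun i j => Nat.zero_le _, fun i j => hq i j⟩

lemma integrable_arrival {A : Fin n → Fin n → PMF ℕ} {amax : ℕ}
    (hA : ∀ i j, ∀ m, amax < m → A i j m = 0) (F : Config n → ℝ) :
    Integrable F (arrivalLaw A) :=
  integrable_of_ae_mem_finite (finite_le_config amax) (ae_arrival_le hA) F

/-- The mean of the arrivals. -/
noncomputable def arrivalMean (A : Fin n → Fin n → PMF ℕ) : RVec n :=
  fun i j => ∫ m : ℕ, (m : ℝ) ∂(A i j).toMeasure

/-- The variance of the arrivals. -/
noncomputable def arrivalVar (A : Fin n → Fin n → PMF ℕ) : RVec n :=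
  fun i j => variance (fun m : ℕ => (m : ℝ)) (A i j).toMeasure

lemma integral_arrival (A : Fin n → Fin n → PMF ℕ) (i j : Fin n) :
    ∫ a, (a i j : ℝ) ∂arrivalLaw A = arrivalMean A i j := by
  have h := measurePreserving_arrival A i j
  rw [arrivalMean, ← h.map_eq, integral_map h.aemeasurable
    (measurable_of_countable _).aestronglyMeasurable]

lemma integral_dot_arrival {A : Fin n → Fin n → PMF ℕ} {amax : ℕ}
    (hA : ∀ i j, ∀ m, amax < m → A i j m = 0) (β : RVec n) :
    ∫ a, dot β (toReal a) ∂arrivalLaw A = dot β (arrivalMean A) := by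
  simp only [dot]
  rw [integral_finsetSum _ fun i _ => integrable_arrival hA _]
  refine Finset.sum_congr rfl fun i _ => ?_
  rw [integral_finsetSum _ fun i _ => integrable_arrival hA _]
  refine Finset.sum_congr rfl fun j _ => ?_
  rw [integral_const_mul]
  simp only [toReal, integral_arrival]

/-- The arrival law is a product of products: two entries of one row are independent by the inner
product, entries of different rows by the outer one. -/
lemma indepFun_arrival (A : Fin n → Fin n → PMF ℕ) {i j i' j' : Fin n}
    (h : (i, j) ≠ (i', j')) :
    ∫ a, ((a i j : ℝ) - arrivalMean A i j) * (a i' j' - arrivalMean A i' j') ∂arrivalLaw A =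
      (∫ a, ((a i j : ℝ) - arrivalMean A i j) ∂arrivalLaw A) *
        ∫ a, ((a i' j' : ℝ) - arrivalMean A i' j') ∂arrivalLaw A := by
  have hms : ∀ {Y : Type} [MeasurableSpace Y] [Countable Y] [MeasurableSingletonClass Y]
      (μ : Measure Y) (f : Y → ℝ), AEStronglyMeasurable f μ := fun μ f =>
    (measurable_of_countable f).aestronglyMeasurable
  by_cases hi : i = i'
  · subst hi
    have hj : j ≠ j' := fun hj => h (by rw [hj])
    have hrow := measurePreserving_eval (fun i => Measure.pi fun j => (A i j).toMeasure) i
    have hI : iIndepFun (fun j (ω : Fin n → ℕ) => (ω j : ℝ) - arrivalMean A i j)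
        (Measure.pi fun j => (A i j).toMeasure) :=
      iIndepFun_pi (X := fun j (m : ℕ) => (m : ℝ) - arrivalMean A i j)
        fun j => (measurable_of_countable _).aemeasurable
    have := (hI.indepFun hj).integral_fun_mul_eq_mul_integral (hms _ _) (hms _ _)
    rw [← hrow.map_eq] at this
    rw [integral_map hrow.aemeasurable (hms _ _), integral_map hrow.aemeasurable (hms _ _),
      integral_map hrow.aemeasurable (hms _ _)] at this
    exact this
  · have hI : iIndepFun (fun i (ω : Config n) => ω i) (arrivalLaw A) :=
      iIndepFun_pi (X := fun i (m : Fin n → ℕ) => m) fun j => aemeasurable_id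
    have hI2 := (hI.indepFun hi).comp
      (φ := fun r : Fin n → ℕ => (r j : ℝ) - arrivalMean A i j)
      (ψ := fun r : Fin n → ℕ => (r j' : ℝ) - arrivalMean A i' j')
      (measurable_of_countable _) (measurable_of_countable _)
    exact hI2.integral_fun_mul_eq_mul_integral (hms _ _) (hms _ _)

lemma integral_arrival_sub {A : Fin n → Fin n → PMF ℕ} {amax : ℕ}
    (hA : ∀ i j, ∀ m, amax < m → A i j m = 0) (i j : Fin n) :
    ∫ a, ((a i j : ℝ) - arrivalMean A i j) ∂arrivalLaw A = 0 := by
  rw [integral_sub (integrable_arrival hA _) (integrable_const _), integral_arrival]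
  simp

lemma integral_centered_mul {A : Fin n → Fin n → PMF ℕ} {amax : ℕ}
    (hA : ∀ i j, ∀ m, amax < m → A i j m = 0) (p r : Fin n × Fin n) :
    ∫ a, ((a p.1 p.2 : ℝ) - arrivalMean A p.1 p.2) *
      (a r.1 r.2 - arrivalMean A r.1 r.2) ∂arrivalLaw A =
      if p = r then arrivalVar A p.1 p.2 else 0 := by
  split_ifs with h
  · subst h
    have h := measurePreserving_arrival A p.1 p.2
    rw [arrivalVar, variance_eq_integral (measurable_of_countable _).aemeasurable]
    rw [← h.map_eq, integral_map h.aemeasurable (measurable_of_countable _).aestronglyMeasurable,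
      h.map_eq]
    simp only [sq]
    rfl
  · rw [indepFun_arrival A h, integral_arrival_sub hA, zero_mul]

/-- Covariance of two linear functionals of the arrivals. -/
lemma integral_dot_mul_dot {A : Fin n → Fin n → PMF ℕ} {amax : ℕ}
    (hA : ∀ i j, ∀ m, amax < m → A i j m = 0) (α β : RVec n) :
    ∫ a, dot α (toReal a - arrivalMean A) * dot β (toReal a - arrivalMean A) ∂arrivalLaw A =
      ∑ i, ∑ j, α i j * β i j * arrivalVar A i j := by
  simp only [dot_eq_sum_prod, Finset.sum_mul_sum]
  rw [integral_finsetSum _ fun i _ => integrable_arrival hA _, Fintype.sum_prod_type' (f := fun i j => α i j * β i j * arrivalVar A i j) |>.symm]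
  refine Finset.sum_congr rfl fun p _ => ?_
  rw [integral_finsetSum _ fun i _ => integrable_arrival hA _, Finset.sum_eq_single p]
  · have := integral_centered_mul hA p p
    rw [if_pos rfl] at this
    rw [← this, ← integral_const_mul]
    congr 1
    funext a
    simp only [Pi.sub_apply, toReal]
    ring
  · intro r _ hr
    have := integral_centered_mul hA p r
    rw [if_neg hr.symm] at this
    rw [← mul_zero (α p.1 p.2 * β r.1 r.2), ← this, ← integral_const_mul]
    congr 1
    funext a
    simp only [Pi.sub_apply, toReal]
    ring
  · simp

/-! ### The queue length chain -/

variable {A : Fin n → Fin n → PMF ℕ} {pol : Policy n} {amax : ℕ}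

instance (A : Fin n → Fin n → PMF ℕ) (pol : Policy n) : IsMarkovKernel (queueKernel A pol) := by
  refine ⟨fun q => ?_⟩
  change IsProbabilityMeasure
    (((pol q).toMeasure.prod (arrivalLaw A)).map fun p => nextQueue q p.2 p.1)
  exact Measure.isProbabilityMeasure_map (measurable_of_countable _).aemeasurable

lemma lintegral_queueKernel (A : Fin n → Fin n → PMF ℕ) (pol : Policy n) (q : Config n)
    (f : Config n → ℝ≥0∞) :
    ∫⁻ y, f y ∂queueKernel A pol q =
      ∫⁻ s, ∫⁻ a, f (nextQueue q a s) ∂arrivalLaw A ∂(pol q).toMeasure := by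
  change ∫⁻ y, f y ∂(((pol q).toMeasure.prod (arrivalLaw A)).map fun p => nextQueue q p.2 p.1) = _
  rw [lintegral_map (measurable_of_countable _) (measurable_of_countable _),
    lintegral_prod _ (measurable_of_countable _).aemeasurable]

/-- The majorant is affine in the arrivals, so only their mean enters. The conclusion `0 ≤ c` is
needed later to split `ENNReal.ofReal` over a difference. -/
lemma lintegral_queueKernel_le (hA : ∀ i j, ∀ m, amax < m → A i j m = 0) {q : Config n}
    {F : Config n → ℝ} (hF : ∀ x, 0 ≤ F x) {α : Config n → ℝ} {β : RVec n} {c : ℝ}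
    (h₁ : ∀ s ∈ (pol q).support, ∀ a : Config n, (∀ i j, a i j ≤ amax) →
      F (nextQueue q a s) ≤ α s + dot β (toReal a))
    (h₂ : ∀ s ∈ (pol q).support, α s + dot β (arrivalMean A) ≤ c) :
    0 ≤ c ∧ ∫⁻ y, ENNReal.ofReal (F y) ∂queueKernel A pol q ≤ ENNReal.ofReal c := by
  rw [lintegral_queueKernel]
  have hmean : ∀ s, ∫ a, (α s + dot β (toReal a)) ∂arrivalLaw A =
      α s + dot β (arrivalMean A) := fun s => by
    rw [integral_add (integrable_const _) (integrable_arrival hA _), integral_dot_arrival hA]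
    simp
  have hc : 0 ≤ c := by
    obtain ⟨s, hs⟩ := (pol q).support_nonempty
    refine le_trans ?_ (h₂ s hs)
    rw [← hmean]
    refine integral_nonneg_of_ae ?_
    filter_upwards [ae_arrival_le hA] with a ha using (hF _).trans (h₁ s hs a ha)
  refine ⟨hc, ?_⟩
  have key : ∀ᵐ s ∂(pol q).toMeasure,
      ∫⁻ a, ENNReal.ofReal (F (nextQueue q a s)) ∂arrivalLaw A ≤ ENNReal.ofReal c := by
    filter_upwards [ae_mem_support (pol q)] with s hs
    have hint : Integrable (fun a => α s + dot β (toReal a)) (arrivalLaw A) :=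
      integrable_arrival hA _
    have hpt : ∀ᵐ a ∂arrivalLaw A, F (nextQueue q a s) ≤ α s + dot β (toReal a) := by
      filter_upwards [ae_arrival_le hA] with a ha using h₁ s hs a ha
    calc ∫⁻ a, ENNReal.ofReal (F (nextQueue q a s)) ∂arrivalLaw A
        ≤ ∫⁻ a, ENNReal.ofReal (α s + dot β (toReal a)) ∂arrivalLaw A := by
          refine lintegral_mono_ae ?_
          filter_upwards [hpt] with a ha using ENNReal.ofReal_le_ofReal ha
      _ = ENNReal.ofReal (∫ a, (α s + dot β (toReal a)) ∂arrivalLaw A) := by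
          rw [ofReal_integral_eq_lintegral_ofReal hint]
          filter_upwards [hpt] with a ha using (hF _).trans ha
      _ ≤ ENNReal.ofReal c := by
          rw [hmean]
          exact ENNReal.ofReal_le_ofReal (h₂ s hs)
  calc _ ≤ ∫⁻ _, ENNReal.ofReal c ∂(pol q).toMeasure := lintegral_mono_ae key
    _ = ENNReal.ofReal c := by simp

/-- The constant in the drift of the cubed distance to the cone. -/
noncomputable def driftConst (c η : ℝ) : ℝ := 9 * c ^ 4 / (4 * η) + c ^ 3

/-- The schedules chosen by `pol` have drift at least `η` towards the cone. -/
def HasConeDrift (n₁ n₂ : ℕ) (pol : Policy n) (lam : RVec n) (η : ℝ) : Prop :=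
  ∀ q, ∀ s ∈ (pol q).support, s ∈ feasibleSchedules n ∧
    dot (perp n₁ n₂ (toReal q)) (lam - toReal s) ≤ -η * perpNorm n₁ n₂ (toReal q)

/-- A cubic Lyapunov function has quadratically negative drift, which is what a second moment bound
requires. -/
lemma cube_drift (hA : ∀ i j, ∀ m, amax < m → A i j m = 0) {n₁ n₂ : ℕ} {η : ℝ} (hη : 0 < η)
    (hd : HasConeDrift n₁ n₂ pol (arrivalMean A) η) (q : Config n) :
    ∫⁻ y, ENNReal.ofReal (perpNorm n₁ n₂ (toReal y) ^ 3) ∂queueKernel A pol q +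
      ENNReal.ofReal (2 * η * perpNorm n₁ n₂ (toReal q) ^ 2) ≤
      ENNReal.ofReal (perpNorm n₁ n₂ (toReal q) ^ 3) +
        ENNReal.ofReal (driftConst (n * (amax + 1)) η) := by
  set x := perpNorm n₁ n₂ (toReal q) with hx
  set p := perp n₁ n₂ (toReal q) with hp
  set c : ℝ := n * (amax + 1) with hc
  have hc0 : 0 ≤ c := by positivity
  have hx0 : 0 ≤ x := perpNorm_nonneg _ _ _
  have h := lintegral_queueKernel_le (pol := pol) hA (q := q)
    (F := fun y => perpNorm n₁ n₂ (toReal y) ^ 3)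
    (fun y => pow_nonneg (perpNorm_nonneg _ _ _) 3)
    (α := fun s => x ^ 3 + 3 / 2 * x * (2 * -dot p (toReal s) + c ^ 2) +
      c ^ 2 * (3 / 2 * x + c)) (β := (3 * x) • p)
    (c := x ^ 3 + 3 / 2 * x * (2 * (-η * x) + c ^ 2) + c ^ 2 * (3 / 2 * x + c)) ?_ ?_
  · have hle : x ^ 3 + 3 / 2 * x * (2 * (-η * x) + c ^ 2) + c ^ 2 * (3 / 2 * x + c) ≤
        x ^ 3 + driftConst c η - 2 * η * x ^ 2 := by
      -- Of the drift `-3 η x² + 3 c² x + c³`, the part `-2 η x²` is kept and the rest is bounded by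
      -- completing the square; this is the origin of `driftConst`.
      have : driftConst c η - (3 * c ^ 2 * x - η * x ^ 2 + c ^ 3) =
          (η * x - 3 * c ^ 2 / 2) ^ 2 / η := by
        rw [driftConst]; field_simp; ring
      have h2 : 0 ≤ (η * x - 3 * c ^ 2 / 2) ^ 2 / η := by positivity
      linarith
    have hdc : 0 ≤ driftConst c η := by rw [driftConst]; positivity
    rw [← ENNReal.ofReal_add (by positivity) hdc]
    calc _ ≤ ENNReal.ofReal (x ^ 3 + driftConst c η - 2 * η * x ^ 2) +
          ENNReal.ofReal (2 * η * x ^ 2) := by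
          gcongr; exact h.2.trans (ENNReal.ofReal_le_ofReal hle)
      _ = _ := by
          rw [← ENNReal.ofReal_add (h.1.trans hle) (by positivity)]; congr 1; ring
  · intro s hs a ha
    refine (perpNorm_cube_nextQueue_le n₁ n₂ (hd q s hs).1 ha).trans (le_of_eq ?_)
    rw [dot_sub_right, dot_smul_left]
    ring
  · intro s hs
    have h1 := (hd q s hs).2
    rw [dot_sub_right] at h1
    rw [dot_smul_left]
    have : 3 / 2 * x * (2 * (dot p (arrivalMean A) - dot p (toReal s)) + c ^ 2) ≤
        3 / 2 * x * (2 * (-η * x) + c ^ 2) := by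
      apply mul_le_mul_of_nonneg_left _ (by positivity)
      linarith
    linarith

/-- Uniform bound for the second moment of the distance to the cone in steady state. -/
lemma lintegral_perpNorm_sq_le (hA : ∀ i j, ∀ m, amax < m → A i j m = 0) {n₁ n₂ : ℕ} {η : ℝ}
    (hη : 0 < η) (hd : HasConeDrift n₁ n₂ pol (arrivalMean A) η) {π : Measure (Config n)}
    (hπ : IsSteadyState (queueKernel A pol) π) :
    ∫⁻ q, ENNReal.ofReal (perpNorm n₁ n₂ (toReal q) ^ 2) ∂π ≤
      ENNReal.ofReal (driftConst (n * (amax + 1)) η / (2 * η)) := by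
  have := hπ.1
  have h := lintegral_le_of_drift hπ.2 (measurable_of_countable _) (measurable_of_countable _)
    (fun _ => ENNReal.ofReal_ne_top) (cube_drift hA hη hd)
  simp_rw [ENNReal.ofReal_mul (show 0 ≤ 2 * η by positivity)] at h
  rw [lintegral_const_mul _ (measurable_of_countable _)] at h
  rw [ENNReal.ofReal_div_of_pos (by positivity)]
  rw [ENNReal.le_div_iff_mul_le (Or.inl (ENNReal.ofReal_pos.2 (by positivity)).ne')
    (Or.inl ENNReal.ofReal_ne_top), mul_comm]
  exact h

/-- A chain whose total drift is negative has a stationary distribution. -/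
lemma exists_steadyState (hA : ∀ i j, ∀ m, amax < m → A i j m = 0) {η : ℝ} (hη : 0 < η)
    (hd : HasConeDrift 0 0 pol (arrivalMean A) η) :
    ∃ π, IsSteadyState (queueKernel A pol) π := by
  refine exists_invariant_of_drift (queueKernel A pol) 0 (fun _ => ENNReal.ofReal_ne_top)
    ENNReal.ofReal_ne_top (fun R => ?_) (cube_drift hA hη hd)
  obtain ⟨B, hB⟩ := exists_nat_ge (1 + R / (2 * η))
  refine (finite_le_config B).subset fun q hq i j => ?_
  have h1 : ENNReal.ofReal (2 * η * perpNorm 0 0 (toReal q) ^ 2) ≤ R := hq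
  rw [ENNReal.ofReal_le_iff_le_toReal (ENNReal.natCast_ne_top _), ENNReal.toReal_natCast,
    perpNorm, perp_zero_zero] at h1
  have h2 := abs_apply_le_nrm (toReal q) i j
  have h3 : (q i j : ℝ) ≤ nrm (toReal q) := (le_abs_self _).trans h2
  have h4 : nrm (toReal q) ^ 2 ≤ R / (2 * η) := by
    rw [le_div_iff₀ (by positivity)]; linarith
  have h5 : nrm (toReal q) ≤ 1 + nrm (toReal q) ^ 2 := by
    nlinarith [sq_nonneg (nrm (toReal q) - 1 / 2)]
  have h6 : (q i j : ℝ) ≤ B := by linarith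
  exact_mod_cast h6

/-! ### Uniqueness of the stationary distribution under MaxWeight -/

/-- Serving one nonempty queue is feasible and has positive weight, so a MaxWeight schedule has
positive weight and serves some nonempty queue. -/
lemma exists_lt_of_isMaxWeight (hpol : pol.IsMaxWeight) {q s : Config n} (hq : q ≠ 0)
    (hs : s ∈ (pol q).support) :
    ∑ i, ∑ j, nextQueue q 0 s i j < ∑ i, ∑ j, q i j := by
  obtain ⟨i₀, j₀, h0⟩ : ∃ i j, q i j ≠ 0 := by
    by_contra! h
    exact hq (funext fun i => funext fun j => h i j)
  let e : Config n := fun i j => if i = i₀ ∧ j = j₀ then 1 else 0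
  have he : e ∈ feasibleSchedules n := by
    constructor
    · intro i
      by_cases hi : i = i₀ <;> simp [e, hi]
    · intro j
      by_cases hj : j = j₀ <;> simp [e, hj]
  have hw : weight q e ≤ weight q s := (hpol q s hs).2 e he
  have hwe : weight q e = q i₀ j₀ := by
    simp only [weight, e, mul_ite, mul_one, mul_zero, ite_and]
    simp
  have hpos : weight q s ≠ 0 := by omega
  obtain ⟨i, hi⟩ : ∃ i, ∑ j, q i j * s i j ≠ 0 := by
    by_contra! h
    exact hpos (Finset.sum_eq_zero fun i _ => h i)
  obtain ⟨j, hj⟩ : ∃ j, q i j * s i j ≠ 0 := by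
    by_contra! h
    exact hi (Finset.sum_eq_zero fun j _ => h j)
  have hle : ∀ i j, nextQueue q 0 s i j ≤ q i j := fun i j => by
    simp only [nextQueue, Pi.zero_apply]; omega
  have hlt : nextQueue q 0 s i j < q i j := by
    have h1 : q i j ≠ 0 := left_ne_zero_of_mul hj
    have h2 : s i j ≠ 0 := right_ne_zero_of_mul hj
    simp only [nextQueue, Pi.zero_apply]; omega
  exact Finset.sum_lt_sum (fun i _ => Finset.sum_le_sum fun j _ => hle i j)
    ⟨i, Finset.mem_univ _, Finset.sum_lt_sum (fun j _ => hle i j) ⟨j, Finset.mem_univ _, hlt⟩⟩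

lemma arrival_zero_ne_zero (hA : ∀ i j, ∀ m, amax < m → A i j m = 0) {i j : Fin n}
    (h : arrivalMean A i j < 1) : A i j 0 ≠ 0 := by
  intro h0
  have hint : Integrable (fun a : Config n => (a i j : ℝ)) (arrivalLaw A) :=
    integrable_arrival hA _
  have hae : ∀ᵐ m ∂(A i j).toMeasure, 1 ≤ m := by
    rw [ae_iff, PMF.toMeasure_apply_eq_zero_iff _ (Set.to_countable _).measurableSet]
    refine Set.disjoint_left.2 fun m hm hm' => ?_
    rw [PMF.mem_support_iff] at hm
    have : m = 0 := by
      have : ¬ 1 ≤ m := hm'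
      omega
    exact hm (this ▸ h0)
  have hae2 := (measurePreserving_arrival A i j).quasiMeasurePreserving.ae hae
  rw [← integral_arrival] at h
  have : (1 : ℝ) ≤ ∫ a, (a i j : ℝ) ∂arrivalLaw A := by
    calc (1 : ℝ) = ∫ _, (1 : ℝ) ∂arrivalLaw A := by simp
      _ ≤ _ := by
        refine integral_mono_ae (integrable_const _) hint ?_
        filter_upwards [hae2] with a ha
        exact_mod_cast ha
  linarith

lemma queueKernel_singleton_ne_zero (hA : ∀ i j, A i j 0 ≠ 0) {q s : Config n}
    (hs : s ∈ (pol q).support) : queueKernel A pol q {nextQueue q 0 s} ≠ 0 := by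
  change (((pol q).toMeasure.prod (arrivalLaw A)).map fun p => nextQueue q p.2 p.1)
    {nextQueue q 0 s} ≠ 0
  rw [Measure.map_apply (measurable_of_countable _) (measurableSet_singleton _)]
  have hsub : ({s} : Set (Config n)) ×ˢ ({0} : Set (Config n)) ⊆
      (fun p : Config n × Config n => nextQueue q p.2 p.1) ⁻¹' {nextQueue q 0 s} := by
    rintro ⟨x, y⟩ ⟨hx, hy⟩
    simp only [Set.mem_singleton_iff] at hx hy
    simp [hx, hy]
  refine ne_of_gt (lt_of_lt_of_le ?_ (measure_mono hsub))
  rw [Measure.prod_prod, PMF.toMeasure_apply_singleton _ _ (measurableSet_singleton _)]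
  refine ENNReal.mul_pos ((pol q).mem_support_iff s |>.1 hs) ?_
  have : arrivalLaw A {(0 : Config n)} = ∏ i, ∏ j, A i j 0 := by
    rw [arrivalLaw, Measure.pi_singleton]
    refine Finset.prod_congr rfl fun i _ => ?_
    rw [Measure.pi_singleton]
    refine Finset.prod_congr rfl fun j _ => ?_
    rw [PMF.toMeasure_apply_singleton _ _ (measurableSet_singleton _)]
    rfl
  rw [this]
  exact Finset.prod_ne_zero_iff.2 fun i _ => Finset.prod_ne_zero_iff.2 fun j _ => hA i j

/-- A slot without arrivals has positive probability, and a run of such slots empties the switch.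
Hence every nonzero finite invariant measure charges the empty state. -/
lemma steadyState_unique (hA : ∀ i j, A i j 0 ≠ 0) (hpol : pol.IsMaxWeight)
    {π₁ π₂ : Measure (Config n)} (h₁ : IsSteadyState (queueKernel A pol) π₁)
    (h₂ : IsSteadyState (queueKernel A pol) π₂) : π₁ = π₂ := by
  have := h₁.1
  have := h₂.1
  refine invariant_unique (queueKernel A pol) 0 (fun ρ _ hρ hne => ?_) h₁.2 h₂.2
  have key : ∀ N : ℕ, ∀ q : Config n, ∑ i, ∑ j, q i j ≤ N → ρ {q} ≠ 0 → ρ {0} ≠ 0 := by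
    intro N
    induction N with
    | zero =>
      intro q hq h
      have : q = 0 := by
        funext i j
        have h1 := Finset.sum_eq_zero_iff.1 (Nat.le_zero.1 hq) i (Finset.mem_univ _)
        exact Finset.sum_eq_zero_iff.1 h1 j (Finset.mem_univ _)
      rwa [this] at h
    | succ N ih =>
      intro q hq h
      by_cases hq0 : q = 0
      · rwa [hq0] at h
      obtain ⟨s, hs⟩ := (pol q).support_nonempty
      have hlt := exists_lt_of_isMaxWeight hpol hq0 hs
      refine ih (nextQueue q 0 s) (by omega) ?_
      rw [← hρ.def, bind_singleton]
      refine ne_of_gt (lt_of_lt_of_le ?_ (ENNReal.le_tsum q))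
      exact ENNReal.mul_pos (queueKernel_singleton_ne_zero hA hs) h
  obtain ⟨q, hq⟩ : ∃ q, ρ {q} ≠ 0 := by
    by_contra! h
    exact hne (Measure.ext_of_singleton fun q => by simp [h q])
  exact key _ q le_rfl hq

/-! ### A time slot in steady state -/

/-- Queue lengths `q`, schedule `s` and arrivals `a` of one time slot, with queue lengths
distributed according to `π` before and after the slot. -/
structure SteadySlot {Ω : Type*} [MeasurableSpace Ω] (P : Measure Ω)
    (A : Fin n → Fin n → PMF ℕ) (π : Measure (Config n)) (q s a : Ω → Config n) : Prop where
  meas_q : Measurable q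
  meas_s : Measurable s
  meas_a : Measurable a
  law_q : P.map q = π
  law_next : P.map (fun ω => nextQueue (q ω) (a ω) (s ω)) = π
  law_a : P.map a = arrivalLaw A
  indep : IndepFun q a P
  sched : ∀ᵐ ω ∂P, s ω ∈ maximalSchedules n

/-- A scheduling rule as a kernel. -/
noncomputable def policyKernel (pol : Policy n) : Kernel (Config n) (Config n) :=
  Kernel.ofFunOfCountable fun q => (pol q).toMeasure

instance (pol : Policy n) : IsMarkovKernel (policyKernel pol) :=
  ⟨fun q => inferInstanceAs (IsProbabilityMeasure (pol q).toMeasure)⟩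

lemma steadySlot_of_isSteadyState {A : Fin n → Fin n → PMF ℕ} {pol : Policy n}
    {π : Measure (Config n)} (hπ : IsSteadyState (queueKernel A pol) π)
    (hpol : ∀ q, ∀ s ∈ (pol q).support, s ∈ maximalSchedules n) :
    SteadySlot ((π ⊗ₘ policyKernel pol).prod (arrivalLaw A)) A π
      (fun ω => ω.1.1) (fun ω => ω.1.2) (fun ω => ω.2) := by
  have := hπ.1
  refine ⟨measurable_of_countable _, measurable_of_countable _, measurable_of_countable _,
    ?_, ?_, ?_, ?_, ?_⟩
  · have h := Measure.fst_compProd π (policyKernel pol)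
    rw [← Measure.fst_prod (μ := π ⊗ₘ policyKernel pol) (ν := arrivalLaw A), Measure.fst,
      Measure.fst, Measure.map_map measurable_fst measurable_fst] at h
    exact h
  · refine Measure.ext_of_lintegral _ fun f hf => ?_
    rw [lintegral_map hf (measurable_of_countable _),
      lintegral_prod _ (measurable_of_countable _).aemeasurable,
      Measure.lintegral_compProd (measurable_of_countable _), ← lintegral_invariant hπ.2 hf]
    refine lintegral_congr fun q => ?_
    rw [lintegral_queueKernel]
    rfl
  · exact Measure.snd_prod
  · exact indepFun_prod (X := fun x : Config n × Config n => x.1) (Y := id)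
      measurable_fst measurable_id
  · have h : ∀ᵐ x ∂(π ⊗ₘ policyKernel pol), x.2 ∈ maximalSchedules n := by
      refine Measure.ae_compProd_of_ae_ae (Set.to_countable _).measurableSet ?_
      refine ae_of_all _ fun q => ?_
      filter_upwards [ae_mem_support (pol q)] with s hs using hpol q s hs
    exact Measure.quasiMeasurePreserving_fst.ae h

/-- The combined indicator of the saturated rows and columns. -/
def satWeight (n₁ n₂ : ℕ) : RVec n := fun i j => sat n₁ i + sat n₂ j

lemma satWeight_nonneg (n₁ n₂ : ℕ) (i j : Fin n) : 0 ≤ satWeight n₁ n₂ i j :=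
  add_nonneg (sat_nonneg _ _) (sat_nonneg _ _)

lemma sat_le_one (m : ℕ) (i : Fin n) : sat m i ≤ 1 := by
  unfold sat; split_ifs <;> norm_num

lemma dot_satWeight (n₁ n₂ : ℕ) (x : RVec n) :
    dot (satWeight n₁ n₂) x = rowTot n₁ x + colTot n₂ x := by
  have : satWeight n₁ n₂ = (fun i _ => sat n₁ i : RVec n) + (fun _ j => sat n₂ j : RVec n) := rfl
  rw [dot_comm, this, dot_add_right, dot_row_mul, dot_col_mul, rowTot, colTot]

lemma rowTot_eq_dot (n₁ : ℕ) (x : RVec n) : rowTot n₁ x = dot (fun i _ => sat n₁ i : RVec n) x := by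
  rw [dot_comm, dot_row_mul, rowTot]

lemma colTot_eq_dot (n₂ : ℕ) (x : RVec n) : colTot n₂ x = dot (fun _ j => sat n₂ j : RVec n) x := by
  rw [dot_comm, dot_col_mul, colTot]

lemma spanProj_apply_eq_zero {n₁ n₂ : ℕ} (x : RVec n) {i j : Fin n}
    (h : satWeight n₁ n₂ i j = 0) : spanProj n₁ n₂ x i j = 0 := by
  have h1 := sat_nonneg n₁ i
  have h2 := sat_nonneg n₂ j
  unfold satWeight at h
  have h3 : sat n₁ i = 0 := by linarith
  have h4 : sat n₂ j = 0 := by linarith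
  simp [spanProj, h3, h4]

lemma one_le_satWeight {n₁ n₂ : ℕ} {i j : Fin n} (h : satWeight n₁ n₂ i j ≠ 0) :
    1 ≤ satWeight n₁ n₂ i j := by
  unfold satWeight sat at *
  split_ifs at * <;> norm_num at *

lemma abs_dot_le_of_forall {x u w : RVec n} {c : ℝ} (h : ∀ i j, |x i j * u i j| ≤ c * (w i j * u i j)) :
    |dot x u| ≤ c * dot w u := by
  rw [dot, dot, Finset.mul_sum]
  refine (Finset.abs_sum_le_sum_abs _ _).trans (Finset.sum_le_sum fun i _ => ?_)
  rw [Finset.mul_sum]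
  exact (Finset.abs_sum_le_sum_abs _ _).trans (Finset.sum_le_sum fun j _ => h i j)

lemma nrm_unused_le {q a s : Config n} (hs : s ∈ feasibleSchedules n) :
    nrm (unused q a s) ≤ n := by
  have := nrm_le_of_abs_le (x := unused q a s) zero_le_one fun i j => by
    rw [abs_of_nonneg (unused_nonneg hs i j)]; exact unused_le_one hs i j
  simpa using this

/-- Where service is unused the next queue is empty, so there the projection equals minus its
residual, which is bounded by `perpNorm`. Outside the saturated ports the projection vanishes. -/
lemma abs_dot_spanProj_next_le {n₁ n₂ : ℕ} (hn₁ : n₁ < n) (hn₂ : n₂ < n) {q a s : Config n}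
    (hs : s ∈ feasibleSchedules n) :
    |dot (spanProj n₁ n₂ (toReal (nextQueue q a s))) (unused q a s)| ≤
      perpNorm n₁ n₂ (toReal (nextQueue q a s)) * dot (satWeight n₁ n₂) (unused q a s) := by
  apply abs_dot_le_of_forall
  intro i j
  have hu := unused_nonneg (q := q) (a := a) hs i j
  by_cases h : satWeight n₁ n₂ i j = 0
  · rw [spanProj_apply_eq_zero _ h, h]; simp
  · have h1 := one_le_satWeight h
    have h2 := nextQueue_mul_unused (q := q) (a := a) hs i j
    set x := toReal (nextQueue q a s) with hx
    have h3 : spanProj n₁ n₂ x i j * unused q a s i j =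
        -((x - spanProj n₁ n₂ x) i j * unused q a s i j) := by
      simp only [Pi.sub_apply]; linear_combination h2
    rw [h3, abs_neg, abs_mul, abs_of_nonneg hu]
    have h4 := (abs_apply_le_nrm (x - spanProj n₁ n₂ x) i j).trans
      (nrm_sub_spanProj_le_perpNorm hn₁ hn₂ x)
    calc _ ≤ perpNorm n₁ n₂ x * unused q a s i j := by gcongr
      _ ≤ perpNorm n₁ n₂ x * (satWeight n₁ n₂ i j * unused q a s i j) := by
        gcongr
        · exact perpNorm_nonneg _ _ _
        · exact le_mul_of_one_le_left hu h1

lemma abs_dot_spanProj_unused_le {n₁ n₂ : ℕ} (hn₁ : n₁ < n) (hn₂ : n₂ < n) {q a s : Config n}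
    (hs : s ∈ feasibleSchedules n) :
    |dot (unused q a s) (spanProj n₁ n₂ (unused q a s))| ≤
      n * dot (satWeight n₁ n₂) (unused q a s) := by
  rw [dot_comm]
  apply abs_dot_le_of_forall
  intro i j
  have hu := unused_nonneg (q := q) (a := a) hs i j
  by_cases h : satWeight n₁ n₂ i j = 0
  · rw [spanProj_apply_eq_zero _ h, h]; simp
  · have h1 := one_le_satWeight h
    rw [abs_mul, abs_of_nonneg hu]
    have h4 := ((abs_apply_le_nrm (spanProj n₁ n₂ (unused q a s)) i j).trans
      (nrm_spanProj_le hn₁ hn₂ _)).trans (nrm_unused_le (q := q) (a := a) hs)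
    calc _ ≤ n * unused q a s i j := by gcongr
      _ ≤ n * (satWeight n₁ n₂ i j * unused q a s i j) := by
        gcongr
        exact le_mul_of_one_le_left hu h1

lemma dot_satWeight_unused_nonneg (n₁ n₂ : ℕ) {q a s : Config n} (hs : s ∈ feasibleSchedules n) :
    0 ≤ dot (satWeight n₁ n₂) (unused q a s) :=
  Finset.sum_nonneg fun i _ => Finset.sum_nonneg fun j _ =>
    mul_nonneg (satWeight_nonneg _ _ _ _) (unused_nonneg hs i j)

lemma dot_satWeight_unused_le (n₁ n₂ : ℕ) {q a s : Config n} (hs : s ∈ feasibleSchedules n) :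
    dot (satWeight n₁ n₂) (unused q a s) ≤ 2 * n ^ 2 := by
  calc dot (satWeight n₁ n₂) (unused q a s) ≤ ∑ _i : Fin n, ∑ _j : Fin n, (2 : ℝ) := by
        refine Finset.sum_le_sum fun i _ => Finset.sum_le_sum fun j _ => ?_
        have h1 : satWeight n₁ n₂ i j ≤ 2 := by
          have := sat_le_one n₁ i
          have := sat_le_one n₂ j
          unfold satWeight; linarith
        have h2 := unused_nonneg (q := q) (a := a) hs i j
        have h3 := unused_le_one (q := q) (a := a) hs i j
        have h4 := satWeight_nonneg n₁ n₂ i j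
        nlinarith
    _ = 2 * n ^ 2 := by simp; ring

/-- The contribution of the unused service to the drift of the quadratic form of `spanProj`. -/
lemma abs_unused_terms_le {n₁ n₂ : ℕ} (hn₁ : n₁ < n) (hn₂ : n₂ < n) {q a s : Config n}
    (hs : s ∈ feasibleSchedules n) {θ : ℝ} (hθ : 0 < θ) :
    |2 * dot (spanProj n₁ n₂ (toReal (nextQueue q a s))) (unused q a s) -
      dot (unused q a s) (spanProj n₁ n₂ (unused q a s))| ≤
      θ * perpNorm n₁ n₂ (toReal (nextQueue q a s)) ^ 2 +
        (2 * n ^ 2 / θ + n) * dot (satWeight n₁ n₂) (unused q a s) := by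
  have h1 := abs_dot_spanProj_next_le hn₁ hn₂ (q := q) (a := a) hs
  have h2 := abs_dot_spanProj_unused_le hn₁ hn₂ (q := q) (a := a) hs
  have h3 := dot_satWeight_unused_nonneg n₁ n₂ (q := q) (a := a) hs
  have h4 := dot_satWeight_unused_le n₁ n₂ (q := q) (a := a) hs
  set U := dot (satWeight n₁ n₂) (unused q a s)
  set h := perpNorm n₁ n₂ (toReal (nextQueue q a s))
  -- Weighted arithmetic–geometric mean; then `U ^ 2 ≤ 2 n² U` makes the bound linear in `U`, whose
  -- mean is of order `ε`.
  have h5 : 2 * (h * U) ≤ θ * h ^ 2 + 2 * n ^ 2 / θ * U := by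
    have e : θ * h ^ 2 + U ^ 2 / θ - 2 * (h * U) = (θ * h - U) ^ 2 / θ := by field_simp; ring
    have e2 : 0 ≤ (θ * h - U) ^ 2 / θ := by positivity
    have e3 : U ^ 2 / θ ≤ 2 * n ^ 2 / θ * U := by
      rw [div_mul_eq_mul_div]; gcongr; nlinarith
    linarith
  calc _ ≤ |2 * dot (spanProj n₁ n₂ (toReal (nextQueue q a s))) (unused q a s)| +
        |dot (unused q a s) (spanProj n₁ n₂ (unused q a s))| := abs_sub _ _
    _ ≤ 2 * (h * U) + n * U := by rw [abs_mul, abs_two]; gcongr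
    _ ≤ _ := by linarith

lemma rowSum_toReal_maximal {s : Config n} (hs : s ∈ maximalSchedules n) (i : Fin n) :
    rowSum (toReal s) i = 1 := by
  have := hs.1 i
  simp only [rowSum, toReal]
  exact_mod_cast this

lemma colSum_toReal_maximal {s : Config n} (hs : s ∈ maximalSchedules n) (i : Fin n) :
    colSum (toReal s) i = 1 := by
  have := hs.2 i
  simp only [colSum, toReal]
  exact_mod_cast this

lemma sameSat_maximal {n₁ n₂ : ℕ} {ν : RVec n} (hν : ν ∈ face n n₁ n₂) {s : Config n}
    (hs : s ∈ maximalSchedules n) : SameSat n₁ n₂ (toReal s) ν :=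
  ⟨fun i hi => by rw [rowSum_toReal_maximal hs, hν.2.1 i hi],
    fun i hi => by rw [colSum_toReal_maximal hs, hν.2.2 i hi]⟩

/-- Pointwise increment of the quadratic form of `spanProj`. -/
lemma quad_increment {n₁ n₂ : ℕ} {ν : RVec n} (hν : ν ∈ face n n₁ n₂)
    {q a s : Config n} (hs : s ∈ maximalSchedules n) {lam d : RVec n} (hd : lam = ν - d) :
    dot (toReal (nextQueue q a s)) (spanProj n₁ n₂ (toReal (nextQueue q a s))) -
        dot (toReal q) (spanProj n₁ n₂ (toReal q)) =
      2 * dot (spanProj n₁ n₂ (toReal q)) (toReal a - lam) -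
        2 * dot (spanProj n₁ n₂ (toReal q)) d +
        dot (toReal a - lam) (spanProj n₁ n₂ (toReal a - lam)) -
        2 * dot (spanProj n₁ n₂ d) (toReal a - lam) + dot d (spanProj n₁ n₂ d) +
        (2 * dot (spanProj n₁ n₂ (toReal (nextQueue q a s))) (unused q a s) -
          dot (unused q a s) (spanProj n₁ n₂ (unused q a s))) := by
  have hsat := (sameSat_maximal hν hs).spanProj_eq
  -- The projection sees only saturated sums, where `s` and `ν` agree; here the schedule disappears
  -- from the computation.
  have hB : spanProj n₁ n₂ (toReal a - toReal s) =
      spanProj n₁ n₂ (toReal a - lam) - spanProj n₁ n₂ d := by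
    rw [spanProj_sub, hsat, ← spanProj_sub, ← spanProj_sub, hd]
    congr 1
    abel
  rw [toReal_nextQueue]
  generalize unused q a s = u
  generalize toReal q = x at *
  have hc := fun y z : RVec n => dot_spanProj_comm n₁ n₂ y z
  set b := toReal a - toReal s with hb
  set g := toReal a - lam with hg
  have e1 : dot x (spanProj n₁ n₂ b) = dot (spanProj n₁ n₂ x) g - dot (spanProj n₁ n₂ x) d := by
    rw [hB, dot_sub_right, hc, hc]
  have e2 : dot b (spanProj n₁ n₂ b) = dot g (spanProj n₁ n₂ g) - 2 * dot (spanProj n₁ n₂ d) g +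
      dot d (spanProj n₁ n₂ d) := by
    conv_lhs => rw [hB, dot_sub_right, hc, hc, hB]
    simp only [dot_sub_left]
    rw [← hc g g, dot_comm (spanProj n₁ n₂ g) d, ← hc d d, hc d g]
    ring
  have hcc : ∀ y z : RVec n, dot y (spanProj n₁ n₂ z) = dot z (spanProj n₁ n₂ y) := fun y z => by
    rw [hc, dot_comm]
  simp only [spanProj_add, dot_add_left, dot_add_right]
  have f1 := hcc b x
  have f2 := hcc u x
  have f3 := hcc u b
  have f4 : dot (spanProj n₁ n₂ x) u = dot x (spanProj n₁ n₂ u) := (hc x u).symm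
  have f5 : dot (spanProj n₁ n₂ b) u = dot b (spanProj n₁ n₂ u) := (hc b u).symm
  have f6 : dot (spanProj n₁ n₂ u) u = dot u (spanProj n₁ n₂ u) := (hc u u).symm
  linarith

/-- The mean of the quadratic form of `spanProj` at the centered arrivals. -/
lemma integral_quad_arrival {A : Fin n → Fin n → PMF ℕ} {amax : ℕ}
    (hA : ∀ i j, ∀ m, amax < m → A i j m = 0) (n₁ n₂ : ℕ) :
    ∫ a, dot (toReal a - arrivalMean A) (spanProj n₁ n₂ (toReal a - arrivalMean A))
      ∂arrivalLaw A = dot (arrivalVar A) (zeta n n₁ n₂) / n := by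
  set g : Config n → RVec n := fun a => toReal a - arrivalMean A with hg
  let v := arrivalVar A
  set R : RVec n := fun i _ => sat n₁ i with hR
  set C : RVec n := fun _ j => sat n₂ j with hC
  set D : ℝ := (n : ℝ) ^ 2 - n₁ * n₂ with hD
  let er : Fin n → RVec n := fun i i' _ => if i' = i then 1 else 0
  let ec : Fin n → RVec n := fun j _ j' => if j' = j then 1 else 0
  have her : ∀ x i, rowSum x i = dot (er i) x := fun x i => by simp [dot, er, rowSum]
  have hec : ∀ x i, colSum x i = dot (ec i) x := fun x i => by simp [dot, ec, colSum]
  have hcov := fun α β : RVec n => integral_dot_mul_dot hA α β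
  have hint : ∀ F : Config n → ℝ, Integrable F (arrivalLaw A) := integrable_arrival hA
  have hpt : ∀ a, dot (g a) (spanProj n₁ n₂ (g a)) =
      (∑ i, sat n₁ i * (dot (er i) (g a) * dot (er i) (g a)) +
        ∑ j, sat n₂ j * (dot (ec j) (g a) * dot (ec j) (g a)) -
        (2 * n * (dot R (g a) * dot C (g a)) - n₂ * (dot R (g a) * dot R (g a)) -
          n₁ * (dot C (g a) * dot C (g a))) / D) / n := by
    intro a
    rw [dot_spanProj]
    simp only [her, hec, rowTot_eq_dot, colTot_eq_dot]
    ring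
  change ∫ a, dot (g a) (spanProj n₁ n₂ (g a)) ∂arrivalLaw A = _
  simp_rw [hpt]
  rw [integral_div, integral_sub (hint _) (hint _), integral_add (hint _) (hint _),
    integral_finsetSum _ fun i _ => hint _, integral_finsetSum _ fun i _ => hint _,
    integral_div, integral_sub (hint _) (hint _), integral_sub (hint _) (hint _)]
  simp only [integral_const_mul]
  simp only [hg, hcov]
  change _ = dot v _ / _
  congr 1
  have e1 : ∀ i, ∑ i', ∑ j, er i i' j * er i i' j * arrivalVar A i' j = ∑ j, v i j := fun i => by simp [er, v]
  have e2 : ∀ j, ∑ i, ∑ j', ec j i j' * ec j i j' * arrivalVar A i j' = ∑ i, v i j := fun j => by simp [ec, v]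
  simp only [e1, e2, hR, hC, sat_mul_self]
  have e3 : ∑ j, sat n₂ j * ∑ i, v i j = ∑ i, ∑ j, sat n₂ j * v i j := by
    simp only [Finset.mul_sum]; rw [Finset.sum_comm]
  rw [e3]
  simp only [Finset.mul_sum, ← Finset.sum_sub_distrib, ← Finset.sum_add_distrib, Finset.sum_div,
    dot]
  -- The variance of a single entry is multiplied by `sat n₁ i + sat n₂ j - (2 n sat n₁ i sat n₂ j -
  -- n₂ sat n₁ i - n₁ sat n₂ j) / D`, which is `ζ` in each of the four blocks.
  refine Finset.sum_congr rfl fun i _ => Finset.sum_congr rfl fun j _ => ?_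
  simp only [zeta, sat, ← hD, v]
  split_ifs <;> ring

lemma perpNorm_le_nrm (n₁ n₂ : ℕ) (x : RVec n) : perpNorm n₁ n₂ x ≤ nrm x := by
  have h0 := dot_para_perp n₁ n₂ x
  rw [para, dot_sub_left, ← nrm_sq, sub_eq_zero] at h0
  have h1 := dot_le x (perp n₁ n₂ x)
  rw [h0, sq] at h1
  rcases (nrm_nonneg (perp n₁ n₂ x)).eq_or_lt with h | h
  · rw [perpNorm, ← h]; exact nrm_nonneg _
  · exact le_of_mul_le_mul_right h1 h

lemma integral_sub_sub_add {Ω : Type*} [MeasurableSpace Ω] {P : Measure Ω} {f₁ f₂ f₃ f₄ : Ω → ℝ}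
    (h₁ : Integrable f₁ P) (h₂ : Integrable f₂ P) (h₃ : Integrable f₃ P) (h₄ : Integrable f₄ P) :
    ∫ ω, (f₁ ω - f₂ ω - f₃ ω + f₄ ω) ∂P =
      ∫ ω, f₁ ω ∂P - ∫ ω, f₂ ω ∂P - ∫ ω, f₃ ω ∂P + ∫ ω, f₄ ω ∂P := by
  rw [integral_add (by fun_prop) h₄, integral_sub (by fun_prop) h₃, integral_sub h₁ h₂]

lemma integral_seven_terms {Ω : Type*} [MeasurableSpace Ω] {P : Measure Ω}
    {f₁ f₂ f₃ f₄ f₅ f₆ f₇ : Ω → ℝ} (h₁ : Integrable f₁ P) (h₂ : Integrable f₂ P)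
    (h₃ : Integrable f₃ P) (h₄ : Integrable f₄ P) (h₅ : Integrable f₅ P) (h₆ : Integrable f₆ P)
    (h₇ : Integrable f₇ P) :
    ∫ ω, (f₁ ω - f₂ ω - f₃ ω + f₄ ω - f₅ ω + f₆ ω - f₇ ω) ∂P =
      ∫ ω, f₁ ω ∂P - ∫ ω, f₂ ω ∂P - ∫ ω, f₃ ω ∂P + ∫ ω, f₄ ω ∂P - ∫ ω, f₅ ω ∂P +
        ∫ ω, f₆ ω ∂P - ∫ ω, f₇ ω ∂P := by
  rw [integral_sub (by fun_prop) h₇, integral_add (by fun_prop) h₆,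
    integral_sub (by fun_prop) h₅, integral_sub_sub_add h₁ h₂ h₃ h₄]

/-! ### Stationary drift of the quadratic form -/

section SteadySlot

variable {Ω : Type*} [MeasurableSpace Ω] {P : Measure Ω} [IsProbabilityMeasure P]
  {A : Fin n → Fin n → PMF ℕ} {amax : ℕ} {π : Measure (Config n)} {q s a : Ω → Config n}

lemma integrable_of_le_sq (hsq : Integrable (fun x => nrm (toReal x) ^ 2) π)
    [IsProbabilityMeasure π] {F : Config n → ℝ} (c : ℝ)
    (h : ∀ x, |F x| ≤ c * (1 + nrm (toReal x) ^ 2)) : Integrable F π :=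
  (((integrable_const 1).add hsq).const_mul c).mono'
    (measurable_of_countable F).aestronglyMeasurable (ae_of_all _ h)

omit [IsProbabilityMeasure P] in
lemma SteadySlot.integral_q (h : SteadySlot P A π q s a) (F : Config n → ℝ) :
    ∫ ω, F (q ω) ∂P = ∫ x, F x ∂π := by
  rw [← h.law_q, integral_map h.meas_q.aemeasurable
    (measurable_of_countable _).aestronglyMeasurable]

omit [IsProbabilityMeasure P] in
lemma SteadySlot.measurable_next (h : SteadySlot P A π q s a) :
    Measurable fun ω => nextQueue (q ω) (a ω) (s ω) :=
  (measurable_of_countable (fun x : Config n × Config n × Config n =>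
    nextQueue x.1 x.2.1 x.2.2)).comp (h.meas_q.prodMk (h.meas_a.prodMk h.meas_s))

omit [IsProbabilityMeasure P] in
lemma SteadySlot.integral_next (h : SteadySlot P A π q s a) (F : Config n → ℝ) :
    ∫ ω, F (nextQueue (q ω) (a ω) (s ω)) ∂P = ∫ x, F x ∂π := by
  conv_rhs => rw [← h.law_next, integral_map h.measurable_next.aemeasurable
    (measurable_of_countable _).aestronglyMeasurable]

omit [IsProbabilityMeasure P] in
lemma SteadySlot.integral_a (h : SteadySlot P A π q s a) (F : Config n → ℝ) :
    ∫ ω, F (a ω) ∂P = ∫ x, F x ∂arrivalLaw A := by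
  rw [← h.law_a, integral_map h.meas_a.aemeasurable
    (measurable_of_countable _).aestronglyMeasurable]

omit [IsProbabilityMeasure P] in
lemma SteadySlot.integrable_q (h : SteadySlot P A π q s a) {F : Config n → ℝ}
    (hF : Integrable F π) : Integrable (fun ω => F (q ω)) P := by
  rw [← h.law_q] at hF
  exact hF.comp_measurable h.meas_q

omit [IsProbabilityMeasure P] in
lemma SteadySlot.integrable_next (h : SteadySlot P A π q s a) {F : Config n → ℝ}
    (hF : Integrable F π) : Integrable (fun ω => F (nextQueue (q ω) (a ω) (s ω))) P := by
  rw [← h.law_next] at hF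
  exact hF.comp_measurable h.measurable_next

omit [IsProbabilityMeasure P] in
lemma SteadySlot.integrable_a (h : SteadySlot P A π q s a)
    (hA : ∀ i j, ∀ m, amax < m → A i j m = 0) (F : Config n → ℝ) :
    Integrable (fun ω => F (a ω)) P := by
  have hF := integrable_arrival hA F
  rw [← h.law_a] at hF
  exact hF.comp_measurable h.meas_a

/-- The heavy traffic identity of the quadratic form of `spanProj`, up to the terms caused by the
unused service. -/
lemma SteadySlot.abs_quad_le (h : SteadySlot P A π q s a) [IsProbabilityMeasure π]
    (hA : ∀ i j, ∀ m, amax < m → A i j m = 0) {n₁ n₂ : ℕ} (hn₁ : n₁ < n) (hn₂ : n₂ < n)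
    {ν : RVec n} (hν : ν ∈ face n n₁ n₂) {k : RVec n} (hk_nonneg : ∀ i j, 0 ≤ k i j)
    (hk_norm : ∑ i, ∑ j, k i j = (n : ℝ)) {ε : ℝ} (hε : 0 ≤ ε)
    (hmean : arrivalMean A = ν - ε • k)
    (hsq : Integrable (fun x => nrm (toReal x) ^ 2) π) {M : ℝ}
    (hM : ∫ x, perpNorm n₁ n₂ (toReal x) ^ 2 ∂π ≤ M) {θ : ℝ} (hθ : 0 < θ) :
    |2 * ε * ∫ x, dot (spanProj n₁ n₂ (toReal x)) k ∂π -
      dot (arrivalVar A) (zeta n n₁ n₂) / n| ≤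
      ε ^ 2 * dot k (spanProj n₁ n₂ k) + θ * M + (2 * n ^ 2 / θ + n) * (ε * (2 * n)) := by
  set d := ε • k with hd
  set w := satWeight (n := n) n₁ n₂ with hw
  let T : Config n → ℝ := fun x => dot (toReal x) (spanProj n₁ n₂ (toReal x))
  have hlin : ∀ x : RVec n, nrm x ≤ 1 + nrm x ^ 2 := fun x => by
    nlinarith [sq_nonneg (nrm x - 1 / 2)]
  have hT : Integrable T π := integrable_of_le_sq hsq 1 fun x => by
    simp only [T]
    rw [dot_spanProj_self hn₁ hn₂, abs_of_nonneg (by positivity)]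
    have := pow_le_pow_left₀ (nrm_nonneg _) (nrm_spanProj_le hn₁ hn₂ (toReal x)) 2
    linarith
  have hLin : ∀ β : RVec n, Integrable (fun x : Config n => dot β (toReal x)) π := fun β =>
    integrable_of_le_sq hsq (nrm β) fun x =>
      (abs_dot_le _ _).trans (mul_le_mul_of_nonneg_left (hlin _) (nrm_nonneg _))
  have hL2 : ∀ β : RVec n, Integrable (fun x : Config n => dot (spanProj n₁ n₂ (toReal x)) β) π :=
    fun β => integrable_of_le_sq hsq (nrm β) fun x =>
      (abs_dot_le _ _).trans (by
        rw [mul_comm]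
        exact mul_le_mul_of_nonneg_left ((nrm_spanProj_le hn₁ hn₂ _).trans (hlin _)) (nrm_nonneg _))
  have hL3 : ∀ i j, Integrable (fun x : Config n => spanProj n₁ n₂ (toReal x) i j) π :=
    fun i j => integrable_of_le_sq hsq 1 fun x => by
      rw [one_mul]
      exact ((abs_apply_le_nrm _ i j).trans (nrm_spanProj_le hn₁ hn₂ _)).trans (hlin _)
  have hH : Integrable (fun x : Config n => perpNorm n₁ n₂ (toReal x) ^ 2) π :=
    integrable_of_le_sq hsq 1 fun x => by
      rw [abs_of_nonneg (by positivity)]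
      have := pow_le_pow_left₀ (perpNorm_nonneg _ _ _) (perpNorm_le_nrm n₁ n₂ (toReal x)) 2
      linarith
  -- the centered arrivals
  have hg0 : ∀ β : RVec n, ∫ ω, dot β (toReal (a ω) - arrivalMean A) ∂P = 0 := fun β => by
    rw [h.integral_a fun x => dot β (toReal x - arrivalMean A)]
    simp_rw [dot_sub_right]
    rw [integral_sub (integrable_arrival hA _) (integrable_const _), integral_dot_arrival hA]
    simp
  -- Queue lengths and arrivals of the slot are independent, so the cross term with centred arrivals
  -- has mean zero.
  have hprod_int : ∀ i j, Integrable (fun ω => spanProj n₁ n₂ (toReal (q ω)) i j *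
      (toReal (a ω) - arrivalMean A) i j) P := fun i j => by
    have hI := h.indep.comp (φ := fun x => spanProj n₁ n₂ (toReal x) i j)
      (ψ := fun x => (toReal x - arrivalMean A) i j) (measurable_of_countable _)
      (measurable_of_countable _)
    exact hI.integrable_mul (h.integrable_q (hL3 i j))
      (h.integrable_a hA fun x => (toReal x - arrivalMean A) i j)
  have hprod_zero : ∀ i j, ∫ ω, spanProj n₁ n₂ (toReal (q ω)) i j *
      (toReal (a ω) - arrivalMean A) i j ∂P = 0 := fun i j => by
    rw [h.indep.integral_fun_comp_mul_comp (f := fun x => spanProj n₁ n₂ (toReal x) i j)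
      (g := fun x => (toReal x - arrivalMean A) i j) h.meas_q.aemeasurable
      h.meas_a.aemeasurable (measurable_of_countable _).aestronglyMeasurable
      (measurable_of_countable _).aestronglyMeasurable]
    rw [h.integral_a fun x => (toReal x - arrivalMean A) i j]
    simp only [Pi.sub_apply, toReal]
    rw [integral_arrival_sub hA, mul_zero]
  have hX_int : Integrable (fun ω => dot (spanProj n₁ n₂ (toReal (q ω)))
      (toReal (a ω) - arrivalMean A)) P :=
    integrable_finsetSum _ fun i _ => integrable_finsetSum _ fun j _ => hprod_int i j
  have hX_zero : ∫ ω, dot (spanProj n₁ n₂ (toReal (q ω))) (toReal (a ω) - arrivalMean A) ∂P = 0 := by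
    simp only [dot]
    rw [integral_finsetSum _ fun i _ => integrable_finsetSum _ fun j _ => hprod_int i j]
    refine Finset.sum_eq_zero fun i _ => ?_
    rw [integral_finsetSum _ fun j _ => hprod_int i j]
    exact Finset.sum_eq_zero fun j _ => hprod_zero i j
  -- the unused service
  set U : Ω → ℝ := fun ω => dot w (unused (q ω) (a ω) (s ω)) with hU
  have hU_eq : U =ᵐ[P] fun ω => dot w (toReal (nextQueue (q ω) (a ω) (s ω))) - dot w (toReal (q ω)) -
      dot w (toReal (a ω) - arrivalMean A) + ε * dot w k := by
    filter_upwards [h.sched] with ω hs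
    have e1 : dot w (toReal (s ω)) = dot w ν := by
      rw [hw, dot_satWeight, dot_satWeight, (sameSat_maximal hν hs).rowTot_eq,
        (sameSat_maximal hν hs).colTot_eq]
    have e2 : dot w (arrivalMean A) = dot w ν - ε * dot w k := by
      rw [hmean, dot_sub_right, hd, dot_smul_right]
    simp only [hU, unused, dot_sub_right, dot_add_right, e1, e2]
    ring
  have i1 := h.integrable_next (hLin w)
  have i2 := h.integrable_q (hLin w)
  have i3 := fun β => h.integrable_a hA fun x => dot β (toReal x - arrivalMean A)
  have hU_int : Integrable U P :=
    (((i1.sub i2).sub (i3 w)).add (integrable_const _)).congr hU_eq.symm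
  -- Stationarity cancels the two queue terms and leaves the capacity gap `ε * dot w k`; the weights
  -- are at most `2` and the entries of `k` sum to `n`.
  have hU_mean : ∫ ω, U ω ∂P ≤ ε * (2 * n) := by
    rw [integral_congr_ae hU_eq, integral_sub_sub_add i1 i2 (i3 w) (integrable_const _), hg0,
      h.integral_next fun x => dot w (toReal x), h.integral_q fun x => dot w (toReal x)]
    simp only [integral_const, probReal_univ, smul_eq_mul, one_mul, sub_self, zero_add]
    refine mul_le_mul_of_nonneg_left ?_ hε
    rw [← hk_norm, dot, Finset.mul_sum]
    refine Finset.sum_le_sum fun i _ => ?_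
    rw [Finset.mul_sum]
    refine Finset.sum_le_sum fun j _ => mul_le_mul_of_nonneg_right ?_ (hk_nonneg i j)
    have := sat_le_one n₁ i
    have := sat_le_one n₂ j
    rw [hw]; unfold satWeight; linarith
  -- the remainder
  set V : Ω → ℝ := fun ω =>
    2 * dot (spanProj n₁ n₂ (toReal (nextQueue (q ω) (a ω) (s ω)))) (unused (q ω) (a ω) (s ω)) -
      dot (unused (q ω) (a ω) (s ω)) (spanProj n₁ n₂ (unused (q ω) (a ω) (s ω))) with hV
  have hV_le : ∀ᵐ ω ∂P, |V ω| ≤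
      θ * perpNorm n₁ n₂ (toReal (nextQueue (q ω) (a ω) (s ω))) ^ 2 +
        (2 * n ^ 2 / θ + n) * U ω := by
    filter_upwards [h.sched] with ω hs
    exact abs_unused_terms_le hn₁ hn₂ (maximal_subset_feasible hs) hθ
  -- Solving the pointwise increment for the unused service terms leaves summands with explicit
  -- means; those of `T` cancel because `T` is integrable under the stationary law.
  have hV_eq : V =ᵐ[P] fun ω => T (nextQueue (q ω) (a ω) (s ω)) - T (q ω) -
      2 * dot (spanProj n₁ n₂ (toReal (q ω))) (toReal (a ω) - arrivalMean A) +
      2 * dot (spanProj n₁ n₂ (toReal (q ω))) d -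
      dot (toReal (a ω) - arrivalMean A) (spanProj n₁ n₂ (toReal (a ω) - arrivalMean A)) +
      2 * dot (spanProj n₁ n₂ d) (toReal (a ω) - arrivalMean A) - dot d (spanProj n₁ n₂ d) := by
    filter_upwards [h.sched] with ω hs
    have := quad_increment hν (q := q ω) (a := a ω) hs hmean
    simp only [T, hV]
    linarith
  have j1 := h.integrable_next hT
  have j2 := h.integrable_q hT
  have j3 := hX_int.const_mul 2
  have j4 := (h.integrable_q (hL2 d)).const_mul 2
  have j5 := h.integrable_a hA fun x =>
    dot (toReal x - arrivalMean A) (spanProj n₁ n₂ (toReal x - arrivalMean A))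
  have j6 := (i3 (spanProj n₁ n₂ d)).const_mul 2
  have j7 : Integrable (fun _ : Ω => dot d (spanProj n₁ n₂ d)) P := integrable_const _
  have hV_mean : ∫ ω, V ω ∂P = 2 * ε * ∫ x, dot (spanProj n₁ n₂ (toReal x)) k ∂π -
      dot (arrivalVar A) (zeta n n₁ n₂) / n - ε ^ 2 * dot k (spanProj n₁ n₂ k) := by
    rw [integral_congr_ae hV_eq,
      integral_seven_terms j1 j2 j3 j4 j5 j6 j7, h.integral_next T, h.integral_q T, integral_const_mul,
      integral_const_mul, integral_const_mul, hX_zero, hg0,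
      h.integral_q fun x => dot (spanProj n₁ n₂ (toReal x)) d,
      h.integral_a fun x =>
        dot (toReal x - arrivalMean A) (spanProj n₁ n₂ (toReal x - arrivalMean A)),
      integral_quad_arrival hA n₁ n₂]
    have e1 : ∀ x : Config n, dot (spanProj n₁ n₂ (toReal x)) d =
        ε * dot (spanProj n₁ n₂ (toReal x)) k := fun x => by rw [hd, dot_smul_right]
    have e2 : dot d (spanProj n₁ n₂ d) = ε ^ 2 * dot k (spanProj n₁ n₂ k) := by
      rw [hd, dot_smul_left, dot_spanProj_comm, dot_smul_right, ← dot_spanProj_comm]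
      ring
    simp only [e1, e2, integral_const_mul, integral_const, probReal_univ, smul_eq_mul]
    ring
  have hk1 := h.integrable_next hH
  have hV_abs : |∫ ω, V ω ∂P| ≤ θ * M + (2 * n ^ 2 / θ + n) * (ε * (2 * n)) := by
    calc |∫ ω, V ω ∂P| ≤ ∫ ω, |V ω| ∂P := abs_integral_le_integral_abs
      _ ≤ ∫ ω, (θ * perpNorm n₁ n₂ (toReal (nextQueue (q ω) (a ω) (s ω))) ^ 2 +
          (2 * n ^ 2 / θ + n) * U ω) ∂P :=
        integral_mono_of_nonneg (ae_of_all _ fun _ => abs_nonneg _)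
          ((hk1.const_mul θ).add (hU_int.const_mul _)) hV_le
      _ = θ * ∫ x, perpNorm n₁ n₂ (toReal x) ^ 2 ∂π + (2 * n ^ 2 / θ + n) * ∫ ω, U ω ∂P := by
        rw [integral_add (hk1.const_mul θ) (hU_int.const_mul _), integral_const_mul,
          integral_const_mul, h.integral_next fun x => perpNorm n₁ n₂ (toReal x) ^ 2]
      _ ≤ _ := by gcongr
  rw [hV_mean] at hV_abs
  have hkk : 0 ≤ ε ^ 2 * dot k (spanProj n₁ n₂ k) := by
    rw [dot_spanProj_self hn₁ hn₂]; positivity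
  rw [abs_le] at hV_abs ⊢
  constructor <;> linarith

end SteadySlot

/-! ### Heavy traffic bounds under MaxWeight -/

/-- Replacing `ν` by `ν - ε k` costs at most `ε ‖k‖` of the rate `δ`. Half of `δ` remains, uniformly
in small `ε`. -/
lemma hasConeDrift_of_isMaxWeight {n₁ n₂ : ℕ} {pol : Policy n} (hpol : pol.IsMaxWeight)
    {ν : RVec n} (hν : ν ∈ face n n₁ n₂) {δ : ℝ} (hδ : 0 < δ)
    (hslack : ∀ y ∈ polarCone n n₁ n₂, nrm y ≤ 1 → ν + δ • y ∈ capacityRegion n)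
    {k : RVec n} {ε : ℝ} (hε : 0 ≤ ε) (hεk : ε * nrm k ≤ δ / 2) :
    HasConeDrift n₁ n₂ pol (ν - ε • k) (δ / 2) := by
  intro q s hs
  obtain ⟨hsm, hmax⟩ := hpol q s hs
  refine ⟨maximal_subset_feasible hsm, ?_⟩
  have h1 := dot_perp_sub_le hν hδ hslack hsm hmax
  have h2 := (abs_le.1 (abs_dot_le (perp n₁ n₂ (toReal q)) k)).1
  have h3 : ν - ε • k - toReal s = (ν - toReal s) - ε • k := by abel
  have h4 := perpNorm_nonneg n₁ n₂ (toReal q)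
  rw [h3, dot_sub_right, dot_smul_right]
  change -(perpNorm n₁ n₂ (toReal q) * nrm k) ≤ _ at h2
  nlinarith [mul_le_mul_of_nonneg_left h2 hε, mul_le_mul_of_nonneg_left hεk h4]

/-- The case of no saturated port, for one fixed load. The rate may degenerate as `ε` tends to `0`,
so it serves only for existence and finiteness, not for uniform bounds. -/
lemma hasConeDrift_zero {pol : Policy n} (hpol : pol.IsMaxWeight) {lam : RVec n}
    (hpos : ∀ i j, 0 < lam i j) (hrow : ∀ i, rowSum lam i < 1) (hcol : ∀ j, colSum lam j < 1) :
    ∃ η > 0, HasConeDrift 0 0 pol lam η := by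
  have hcap : lam ∈ capacityRegion n :=
    ⟨fun i j => (hpos i j).le, fun i => (hrow i).le, fun j => (hcol j).le⟩
  obtain ⟨δ, hδ, hslack⟩ := exists_slack (n₁ := 0) (n₂ := 0) hpos hcap
    (fun i _ => hrow i) (fun j _ => hcol j)
  have h := hasConeDrift_of_isMaxWeight hpol (n₁ := 0) (n₂ := 0) ⟨hcap, by simp, by simp⟩ hδ
    hslack (k := 0) (ε := 0) le_rfl (by rw [zero_mul]; positivity)
  rw [smul_zero, sub_zero] at h
  exact ⟨δ / 2, by positivity, h⟩

lemma subcritical {n₁ n₂ : ℕ} {ν k : RVec n} (hν : ν ∈ face n n₁ n₂)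
    (hrow : ∀ i : Fin n, ¬ (i : ℕ) < n₁ → rowSum ν i < 1)
    (hcol : ∀ j : Fin n, ¬ (j : ℕ) < n₂ → colSum ν j < 1)
    (hk_nonneg : ∀ i j, 0 ≤ k i j)
    (hk_row : ∀ i : Fin n, (i : ℕ) < n₁ → 0 < rowSum k i)
    (hk_col : ∀ j : Fin n, (j : ℕ) < n₂ → 0 < colSum k j) {ε : ℝ} (hε : 0 < ε) :
    (∀ i, rowSum (ν - ε • k) i < 1) ∧ ∀ j, colSum (ν - ε • k) j < 1 := by
  constructor
  · intro i
    rw [rowSum_sub, rowSum_smul]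
    by_cases hi : (i : ℕ) < n₁
    · rw [hν.2.1 i hi]
      have := mul_pos hε (hk_row i hi)
      linarith
    · have h1 : 0 ≤ rowSum k i := Finset.sum_nonneg fun j _ => hk_nonneg i j
      have := hrow i hi
      nlinarith
  · intro i
    rw [colSum_sub, colSum_smul]
    by_cases hi : (i : ℕ) < n₂
    · rw [hν.2.2 i hi]
      have := mul_pos hε (hk_col i hi)
      linarith
    · have h1 : 0 ≤ colSum k i := Finset.sum_nonneg fun j _ => hk_nonneg j i
      have := hcol i hi
      nlinarith

lemma integrable_perpNorm_sq {π : Measure (Config n)} {n₁ n₂ : ℕ} {M : ℝ} (hM : 0 ≤ M)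
    (h : ∫⁻ q, ENNReal.ofReal (perpNorm n₁ n₂ (toReal q) ^ 2) ∂π ≤ ENNReal.ofReal M) :
    Integrable (fun q => perpNorm n₁ n₂ (toReal q) ^ 2) π ∧
      ∫ q, perpNorm n₁ n₂ (toReal q) ^ 2 ∂π ≤ M := by
  have hms : AEStronglyMeasurable (fun q : Config n => perpNorm n₁ n₂ (toReal q) ^ 2) π :=
    (measurable_of_countable _).aestronglyMeasurable
  have hnn : 0 ≤ᵐ[π] fun q : Config n => perpNorm n₁ n₂ (toReal q) ^ 2 :=
    ae_of_all _ fun q => sq_nonneg _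
  refine ⟨⟨hms, ?_⟩, ?_⟩
  · rw [hasFiniteIntegral_iff_ofReal hnn]
    exact h.trans_lt ENNReal.ofReal_lt_top
  · rw [integral_eq_lintegral_of_nonneg_ae hnn hms]
    exact ENNReal.toReal_le_of_le_ofReal hM h

lemma driftConst_nonneg {c η : ℝ} (hc : 0 ≤ c) (hη : 0 < η) : 0 ≤ driftConst c η := by
  rw [driftConst]; positivity

lemma dot_ones_toReal (q : Config n) :
    dot (ones n) (toReal q) = ((∑ i, ∑ j, q i j : ℕ) : ℝ) := by
  simp [dot, ones, toReal]

lemma meanTotal_eq {π : Measure (Config n)}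
    (h : Integrable (fun q : Config n => dot (ones n) (toReal q)) π) :
    meanTotal π = ENNReal.ofReal (∫ q, dot (ones n) (toReal q) ∂π) := by
  rw [ofReal_integral_eq_lintegral_ofReal h
    (ae_of_all _ fun q => (Nat.cast_nonneg _).trans_eq (dot_ones_toReal q).symm), meanTotal]
  refine lintegral_congr fun q => ?_
  rw [dot_ones_toReal, ENNReal.ofReal_natCast]

/-- Comparison of the total queue length with its projection, weighted by the rates. -/
lemma abs_para_terms_le {n₁ n₂ : ℕ} (hn₁ : n₁ < n) (hn₂ : n₂ < n) (x k : RVec n) {κ : ℝ}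
    (hκ : 0 ≤ κ) :
    |(κ * dot (ones n) x - n * dot (spanProj n₁ n₂ x) k) -
      dot (para n₁ n₂ x) (κ • ones n - (n : ℝ) • k)| ≤ n * (κ + nrm k) * perpNorm n₁ n₂ x := by
  have e1 : dot (ones n) x = dot (para n₁ n₂ x) (ones n) + dot (perp n₁ n₂ x) (ones n) := by
    rw [dot_comm, ← dot_add_left, para_add_perp]
  have e2 : dot (spanProj n₁ n₂ x) k =
      dot (para n₁ n₂ x) k + dot (spanProj n₁ n₂ (perp n₁ n₂ x)) k := by
    rw [← dot_add_left]
    conv_lhs => rw [← para_add_perp n₁ n₂ x, spanProj_add, spanProj_para hn₁ hn₂]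
  have h1 := abs_dot_le (perp n₁ n₂ x) (ones n)
  have h2 := (abs_dot_le (spanProj n₁ n₂ (perp n₁ n₂ x)) k).trans
    (mul_le_mul_of_nonneg_right (nrm_spanProj_le hn₁ hn₂ _) (nrm_nonneg k))
  change _ ≤ perpNorm n₁ n₂ x * _ at h1
  change _ ≤ perpNorm n₁ n₂ x * _ at h2
  rw [nrm_ones] at h1
  rw [dot_sub_right, dot_smul_right, dot_smul_right, e1, e2]
  have e3 : κ * (dot (para n₁ n₂ x) (ones n) + dot (perp n₁ n₂ x) (ones n)) -
      n * (dot (para n₁ n₂ x) k + dot (spanProj n₁ n₂ (perp n₁ n₂ x)) k) -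
      (κ * dot (para n₁ n₂ x) (ones n) - n * dot (para n₁ n₂ x) k) =
      κ * dot (perp n₁ n₂ x) (ones n) - n * dot (spanProj n₁ n₂ (perp n₁ n₂ x)) k := by ring
  rw [e3]
  refine (abs_sub _ _).trans ?_
  rw [abs_mul, abs_mul, abs_of_nonneg hκ, Nat.abs_cast]
  nlinarith [mul_le_mul_of_nonneg_left h1 hκ,
    mul_le_mul_of_nonneg_left h2 (Nat.cast_nonneg (α := ℝ) n)]

/-- The error in the heavy traffic identity. -/
noncomputable def heavyTrafficError (n₁ n₂ : ℕ) (k : RVec n) (M ε : ℝ) : ℝ :=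
  ε ^ 2 * dot k (spanProj n₁ n₂ k) + √ε * M + (4 * n ^ 3 * √ε + 2 * n ^ 2 * ε)

lemma tendsto_heavyTrafficError (n₁ n₂ : ℕ) (k : RVec n) (M : ℝ) :
    Tendsto (heavyTrafficError n₁ n₂ k M) (𝓝[>] 0) (𝓝 0) := by
  have h : Continuous (heavyTrafficError n₁ n₂ k M) := by
    unfold heavyTrafficError; fun_prop
  have h0 : heavyTrafficError n₁ n₂ k M 0 = 0 := by simp [heavyTrafficError]
  have := h.tendsto 0
  rw [h0] at this
  exact this.mono_left nhdsWithin_le_nhds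

/-! ### From the quadratic identity to the total queue length -/

section Bounds

variable {A : Fin n → Fin n → PMF ℕ} {amax : ℕ} {pol : Policy n} {π : Measure (Config n)}
  {n₁ n₂ : ℕ} {ν k : RVec n} {ε M : ℝ}

lemma integrable_nrm_sq_of_isSteadyState (hA : ∀ i j, ∀ m, amax < m → A i j m = 0)
    (hpol : pol.IsMaxWeight) (hπ : IsSteadyState (queueKernel A pol) π)
    (hpos : ∀ i j, 0 < arrivalMean A i j) (hrow : ∀ i, rowSum (arrivalMean A) i < 1)
    (hcol : ∀ j, colSum (arrivalMean A) j < 1) :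
    Integrable (fun q => nrm (toReal q) ^ 2) π := by
  obtain ⟨η, hη, hd⟩ := hasConeDrift_zero hpol hpos hrow hcol
  have h := lintegral_perpNorm_sq_le hA hη hd hπ
  have h2 := (integrable_perpNorm_sq
    (div_nonneg (driftConst_nonneg (by positivity) hη) (by positivity)) h).1
  simpa only [perpNorm, perp_zero_zero] using h2

lemma existsUnique_isSteadyState (hA : ∀ i j, ∀ m, amax < m → A i j m = 0)
    (hpol : pol.IsMaxWeight)
    (hpos : ∀ i j, 0 < arrivalMean A i j) (hrow : ∀ i, rowSum (arrivalMean A) i < 1)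
    (hcol : ∀ j, colSum (arrivalMean A) j < 1) :
    ∃! π, IsSteadyState (queueKernel A pol) π := by
  obtain ⟨η, hη, hd⟩ := hasConeDrift_zero hpol hpos hrow hcol
  obtain ⟨π, hπ⟩ := exists_steadyState hA hη hd
  refine ⟨π, hπ, fun π' hπ' => steadyState_unique (fun i j => arrival_zero_ne_zero hA ?_) hpol
    hπ' hπ⟩
  exact (Finset.single_le_sum (f := fun j => arrivalMean A i j) (fun j _ => (hpos i j).le)
    (Finset.mem_univ j)).trans_lt (hrow i)

lemma integrable_dot_toReal [IsProbabilityMeasure π]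
    (hsq : Integrable (fun q => nrm (toReal q) ^ 2) π) (β : RVec n) :
    Integrable (fun q : Config n => dot β (toReal q)) π :=
  integrable_of_le_sq hsq (nrm β) fun x =>
    (abs_dot_le _ _).trans (mul_le_mul_of_nonneg_left
      (by nlinarith [sq_nonneg (nrm (toReal x) - 1 / 2)]) (nrm_nonneg _))

lemma integral_perpNorm_le [IsProbabilityMeasure π]
    (hM : Integrable (fun q => perpNorm n₁ n₂ (toReal q) ^ 2) π ∧
      ∫ q, perpNorm n₁ n₂ (toReal q) ^ 2 ∂π ≤ M) :
    Integrable (fun q : Config n => perpNorm n₁ n₂ (toReal q)) π ∧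
      ∫ q, perpNorm n₁ n₂ (toReal q) ∂π ≤ 1 + M := by
  have hle : ∀ q : Config n, perpNorm n₁ n₂ (toReal q) ≤ 1 + perpNorm n₁ n₂ (toReal q) ^ 2 :=
    fun q => by nlinarith [sq_nonneg (perpNorm n₁ n₂ (toReal q) - 1 / 2)]
  have hi : Integrable (fun q : Config n => 1 + perpNorm n₁ n₂ (toReal q) ^ 2) π :=
    (integrable_const _).add hM.1
  have hi2 : Integrable (fun q : Config n => perpNorm n₁ n₂ (toReal q)) π :=
    hi.mono' (measurable_of_countable _).aestronglyMeasurable (ae_of_all _ fun q => by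
      rw [Real.norm_of_nonneg (perpNorm_nonneg _ _ _)]; exact hle q)
  refine ⟨hi2, (integral_mono hi2 hi hle).trans ?_⟩
  rw [integral_add (integrable_const _) hM.1]
  simpa using hM.2

/-- The vector `κ • ones - n • k` has port sums `n (κ - κ i)`, so it or its negative lies in the
polar cone when `κ` bounds the saturated rates from one side. That fixes the sign of its pairing
with `para`; the rest is of order `perpNorm`. -/
lemma abs_rate_terms_le [IsProbabilityMeasure π] (hn₁ : n₁ < n) (hn₂ : n₂ < n)
    (hsq : Integrable (fun q => nrm (toReal q) ^ 2) π)
    (hM : Integrable (fun q => perpNorm n₁ n₂ (toReal q) ^ 2) π ∧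
      ∫ q, perpNorm n₁ n₂ (toReal q) ^ 2 ∂π ≤ M) {κ : ℝ} (hκ : 0 ≤ κ) :
    ((∀ i : Fin n, (i : ℕ) < n₁ → κ ≤ rowSum k i) → (∀ j : Fin n, (j : ℕ) < n₂ → κ ≤ colSum k j) →
      κ * ∫ q, dot (ones n) (toReal q) ∂π ≤
        n * ∫ q, dot (spanProj n₁ n₂ (toReal q)) k ∂π + n * (κ + nrm k) * (1 + M)) ∧
    ((∀ i : Fin n, (i : ℕ) < n₁ → rowSum k i ≤ κ) → (∀ j : Fin n, (j : ℕ) < n₂ → colSum k j ≤ κ) →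
      n * ∫ q, dot (spanProj n₁ n₂ (toReal q)) k ∂π ≤
        κ * ∫ q, dot (ones n) (toReal q) ∂π + n * (κ + nrm k) * (1 + M)) := by
  have i1 := (integrable_dot_toReal hsq (ones n)).const_mul κ
  have i2' : Integrable (fun q : Config n => dot (spanProj n₁ n₂ (toReal q)) k) π := by
    simp_rw [← dot_spanProj_comm, dot_comm _ (spanProj n₁ n₂ k)]
    exact integrable_dot_toReal hsq _
  have i2 := i2'.const_mul (n : ℝ)
  obtain ⟨i3', hle⟩ := integral_perpNorm_le hM
  have i3 := i3'.const_mul (n * (κ + nrm k))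
  have hfin : n * (κ + nrm k) * ∫ q, perpNorm n₁ n₂ (toReal q) ∂π ≤ n * (κ + nrm k) * (1 + M) :=
    mul_le_mul_of_nonneg_left hle (by have := nrm_nonneg k; positivity)
  constructor
  · intro hr hc
    have hpt : ∀ q : Config n, κ * dot (ones n) (toReal q) ≤
        n * dot (spanProj n₁ n₂ (toReal q)) k + n * (κ + nrm k) * perpNorm n₁ n₂ (toReal q) := by
      intro q
      have h1 := (abs_le.1 (abs_para_terms_le hn₁ hn₂ (toReal q) k hκ)).2
      have h2 := dot_para_nonpos (n₁ := n₁) (n₂ := n₂) (toReal q)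
        (y := κ • ones n - (n : ℝ) • k)
        ⟨fun i hi => by
          rw [rowSum_sub, rowSum_smul, rowSum_smul, rowSum_ones]
          nlinarith [hr i hi, Nat.cast_nonneg (α := ℝ) n],
        fun i hi => by
          rw [colSum_sub, colSum_smul, colSum_smul, colSum_ones]
          nlinarith [hc i hi, Nat.cast_nonneg (α := ℝ) n]⟩
      linarith
    have := integral_mono i1 (i2.add i3) hpt
    simp only [Pi.add_apply] at this
    rw [integral_add i2 i3, integral_const_mul, integral_const_mul, integral_const_mul] at this
    linarith
  · intro hr hc
    have hpt : ∀ q : Config n, n * dot (spanProj n₁ n₂ (toReal q)) k ≤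
        κ * dot (ones n) (toReal q) + n * (κ + nrm k) * perpNorm n₁ n₂ (toReal q) := by
      intro q
      have h1 := (abs_le.1 (abs_para_terms_le hn₁ hn₂ (toReal q) k hκ)).1
      have h2 := dot_para_nonpos (n₁ := n₁) (n₂ := n₂) (toReal q)
        (y := -(κ • ones n - (n : ℝ) • k))
        ⟨fun i hi => by
          rw [rowSum_neg, rowSum_sub, rowSum_smul, rowSum_smul, rowSum_ones]
          nlinarith [hr i hi, Nat.cast_nonneg (α := ℝ) n],
        fun i hi => by
          rw [colSum_neg, colSum_sub, colSum_smul, colSum_smul, colSum_ones]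
          nlinarith [hc i hi, Nat.cast_nonneg (α := ℝ) n]⟩
      rw [dot_neg_right] at h2
      linarith
    have := integral_mono i2 (i1.add i3) hpt
    simp only [Pi.add_apply] at this
    rw [integral_add i1 i3, integral_const_mul, integral_const_mul, integral_const_mul] at this
    linarith

lemma abs_heavyTraffic_le (hA : ∀ i j, ∀ m, amax < m → A i j m = 0) (hn₁ : n₁ < n) (hn₂ : n₂ < n)
    (hpol : pol.IsMaxWeight) (hπ : IsSteadyState (queueKernel A pol) π)
    (hν : ν ∈ face n n₁ n₂) (hk_nonneg : ∀ i j, 0 ≤ k i j)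
    (hk_norm : ∑ i, ∑ j, k i j = (n : ℝ)) (hε : 0 < ε) (hmean : arrivalMean A = ν - ε • k)
    (hsq : Integrable (fun q => nrm (toReal q) ^ 2) π)
    (hM : ∫ q, perpNorm n₁ n₂ (toReal q) ^ 2 ∂π ≤ M) :
    |n * (ε * ∫ q, dot (spanProj n₁ n₂ (toReal q)) k ∂π) -
      dot (arrivalVar A) (zeta n n₁ n₂) / 2| ≤ n / 2 * heavyTrafficError n₁ n₂ k M ε := by
  have := hπ.1
  have hn : (0 : ℝ) < n := by exact_mod_cast (Nat.zero_le _).trans_lt hn₁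
  -- The choice `θ = √ε` makes both `θ M` and the term of order `ε / θ` vanish.
  have h := (steadySlot_of_isSteadyState hπ fun q s hs => (hpol q s hs).1).abs_quad_le hA hn₁ hn₂
    hν hk_nonneg hk_norm hε.le hmean hsq hM (Real.sqrt_pos.2 hε)
  have e : (2 * n ^ 2 / √ε + n) * (ε * (2 * n)) = 4 * n ^ 3 * √ε + 2 * n ^ 2 * ε := by
    have h1 : ε = √ε * √ε := (Real.mul_self_sqrt hε.le).symm
    have h2 : √ε ≠ 0 := (Real.sqrt_pos.2 hε).ne'
    have h3 : (2 * n ^ 2 / √ε) * (ε * (2 * n)) = 4 * n ^ 3 * √ε := by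
      rw [div_mul_eq_mul_div, div_eq_iff h2]
      linear_combination (4 * (n : ℝ) ^ 3) * h1
    linear_combination h3
  rw [e] at h
  change _ ≤ heavyTrafficError n₁ n₂ k M ε at h
  have e2 : n * (ε * ∫ q, dot (spanProj n₁ n₂ (toReal q)) k ∂π) -
      dot (arrivalVar A) (zeta n n₁ n₂) / 2 =
      n / 2 * (2 * ε * ∫ x, dot (spanProj n₁ n₂ (toReal x)) k ∂π -
        dot (arrivalVar A) (zeta n n₁ n₂) / n) := by field_simp
  rw [e2, abs_mul, abs_of_pos (by positivity)]
  gcongr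

end Bounds

lemma saturationRates_finite (n₁ n₂ : ℕ) (k : RVec n) : (saturationRates n₁ n₂ k).Finite := by
  refine ((Set.finite_range (rowSum k)).union (Set.finite_range (colSum k))).subset ?_
  rintro x (⟨i, _, rfl⟩ | ⟨i, _, rfl⟩)
  · exact Or.inl ⟨i, rfl⟩
  · exact Or.inr ⟨i, rfl⟩

lemma zeta_zero_zero (n : ℕ) : zeta n 0 0 = 0 := by
  funext i j; simp [zeta]

/-- The heavy traffic bounds for the stationary queue lengths under MaxWeight. -/
theorem maxWeight_heavyTraffic {n₁ n₂ : ℕ} (hn₁ : n₁ < n) (hn₂ : n₂ < n)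
    {ν : RVec n} (hν : ν ∈ intrinsicInterior ℝ (face n n₁ n₂)) (hν_pos : ∀ i j, 0 < ν i j)
    {k : RVec n} (hk_nonneg : ∀ i j, 0 ≤ k i j) (hk_norm : ∑ i, ∑ j, k i j = (n : ℝ))
    (hk_row : ∀ i : Fin n, (i : ℕ) < n₁ → 0 < rowSum k i)
    (hk_col : ∀ j : Fin n, (j : ℕ) < n₂ → 0 < colSum k j) {ε₀ : ℝ} (hε₀ : 0 < ε₀)
    {A : ℝ → Fin n → Fin n → PMF ℕ} {amax : ℕ}
    (hA : ∀ ε ∈ Set.Ioo 0 ε₀, ∀ i j, ∀ m, amax < m → A ε i j m = 0)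
    (hmean : ∀ ε ∈ Set.Ioo 0 ε₀, arrivalMean (A ε) = ν - ε • k)
    {σ : RVec n}
    (hvar : ∀ i j, Tendsto (fun ε => arrivalVar (A ε) i j) (𝓝[>] 0) (𝓝 (σ i j ^ 2)))
    {pol : ℝ → Policy n} (hpol : ∀ ε ∈ Set.Ioo 0 ε₀, (pol ε).IsMaxWeight) :
    (∀ ε ∈ Set.Ioo 0 ε₀, ∃! π : Measure (Config n),
        IsSteadyState (queueKernel (A ε) (pol ε)) π) ∧
      ∀ π : ℝ → Measure (Config n),
        (∀ ε ∈ Set.Ioo 0 ε₀, IsSteadyState (queueKernel (A ε) (pol ε)) (π ε)) →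
        ENNReal.ofReal (dot (fun i j => σ i j ^ 2) (zeta n n₁ n₂) / (2 * kappaMax n₁ n₂ k))
            ≤ liminf (fun ε => ENNReal.ofReal ε * meanTotal (π ε)) (𝓝[>] 0) ∧
          limsup (fun ε => ENNReal.ofReal ε * meanTotal (π ε)) (𝓝[>] 0)
            ≤ ENNReal.ofReal
              (dot (fun i j => σ i j ^ 2) (zeta n n₁ n₂) / (2 * kappaMin n₁ n₂ k)) := by
  obtain ⟨hνf, hνr, hνc⟩ := intrinsicInterior_face_lt hn₁ hn₂ hν
  -- Means of arrivals are nonnegative also at the larger parameter `(ε + ε₀) / 2`. Since `ν` is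
  -- positive and the mean is affine in the parameter, it is strictly positive at `ε`.
  have hpos : ∀ ε ∈ Set.Ioo 0 ε₀, ∀ i j, 0 < arrivalMean (A ε) i j := by
    intro ε hε i j
    have hε' : (ε + ε₀) / 2 ∈ Set.Ioo 0 ε₀ := ⟨by linarith [hε.1], by linarith [hε.2]⟩
    have h1 : 0 ≤ arrivalMean (A ((ε + ε₀) / 2)) i j :=
      integral_nonneg fun m => Nat.cast_nonneg m
    rw [hmean _ hε'] at h1
    rw [hmean ε hε]
    simp only [Pi.sub_apply, Pi.smul_apply, smul_eq_mul] at h1 ⊢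
    rcases (hk_nonneg i j).eq_or_lt with h | h
    · rw [← h, mul_zero, sub_zero]; exact hν_pos i j
    · have : ε * k i j < (ε + ε₀) / 2 * k i j := by gcongr; linarith [hε.2]
      linarith
  have hsub : ∀ ε ∈ Set.Ioo 0 ε₀, (∀ i, rowSum (arrivalMean (A ε)) i < 1) ∧
      ∀ j, colSum (arrivalMean (A ε)) j < 1 := fun ε hε => by
    rw [hmean ε hε]
    exact subcritical hνf hνr hνc hk_nonneg hk_row hk_col hε.1
  refine ⟨fun ε hε => existsUnique_isSteadyState (hA ε hε) (hpol ε hε) (hpos ε hε)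
    (hsub ε hε).1 (hsub ε hε).2, fun π hπ => ?_⟩
  obtain ⟨δ, hδ, hslack⟩ := exists_slack hν_pos hνf.1 hνr hνc
  -- The collapse bound does not involve `ε`.
  set M : ℝ := driftConst (n * (amax + 1)) (δ / 2) / (2 * (δ / 2)) with hMdef
  have hM0 : 0 ≤ M := div_nonneg (driftConst_nonneg (by positivity) (by positivity))
    (by positivity)
  have hev : ∀ᶠ ε in 𝓝[>] (0 : ℝ), ε ∈ Set.Ioo 0 ε₀ ∧ ε * nrm k ≤ δ / 2 := by
    have hI : ∀ᶠ ε in 𝓝[>] (0 : ℝ), ε ∈ Set.Ioo 0 ε₀ := Ioo_mem_nhdsGT hε₀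
    refine hI.and (Filter.Eventually.filter_mono nhdsWithin_le_nhds ?_)
    have : Tendsto (fun ε : ℝ => ε * nrm k) (𝓝 0) (𝓝 (0 * nrm k)) :=
      tendsto_id.mul_const _
    rw [zero_mul] at this
    exact this.eventually_le_const (by positivity)
  have hsq : ∀ ε ∈ Set.Ioo 0 ε₀, Integrable (fun q => nrm (toReal q) ^ 2) (π ε) := fun ε hε =>
    integrable_nrm_sq_of_isSteadyState (hA ε hε) (hpol ε hε) (hπ ε hε) (hpos ε hε)
      (hsub ε hε).1 (hsub ε hε).2
  have hMε : ∀ ε ∈ Set.Ioo 0 ε₀, ε * nrm k ≤ δ / 2 →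
      Integrable (fun q => perpNorm n₁ n₂ (toReal q) ^ 2) (π ε) ∧
        ∫ q, perpNorm n₁ n₂ (toReal q) ^ 2 ∂π ε ≤ M := fun ε hε hεk => by
    refine integrable_perpNorm_sq hM0 (lintegral_perpNorm_sq_le (hA ε hε) (by positivity) ?_
      (hπ ε hε))
    rw [hmean ε hε]
    exact hasConeDrift_of_isMaxWeight (hpol ε hε) hνf hδ hslack hε.1.le hεk
  set S : ℝ → ℝ := fun ε => ∫ q, dot (ones n) (toReal q) ∂π ε with hS
  have hmt : ∀ ε ∈ Set.Ioo 0 ε₀,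
      ENNReal.ofReal ε * meanTotal (π ε) = ENNReal.ofReal (ε * S ε) := fun ε hε => by
    have := (hπ ε hε).1
    rw [meanTotal_eq (integrable_dot_toReal (hsq ε hε) _), ENNReal.ofReal_mul hε.1.le]
  have hζ : Tendsto (fun ε => dot (arrivalVar (A ε)) (zeta n n₁ n₂)) (𝓝[>] 0)
      (𝓝 (dot (fun i j => σ i j ^ 2) (zeta n n₁ n₂))) :=
    tendsto_finsetSum _ fun i _ => tendsto_finsetSum _ fun j _ => (hvar i j).mul_const _
  have hid : Tendsto (fun ε : ℝ => ε) (𝓝[>] 0) (𝓝 0) := tendsto_id.mono_left nhdsWithin_le_nhds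
  have herr := tendsto_heavyTrafficError n₁ n₂ k M
  have hbdd := saturationRates_finite n₁ n₂ k
  have hrates_pos : ∀ x ∈ saturationRates n₁ n₂ k, 0 < x := by
    rintro x (⟨i, hi, rfl⟩ | ⟨j, hj, rfl⟩)
    exacts [hk_row i hi, hk_col j hj]
  have hht : ∀ ε, ε ∈ Set.Ioo 0 ε₀ → ε * nrm k ≤ δ / 2 →
      |n * (ε * ∫ q, dot (spanProj n₁ n₂ (toReal q)) k ∂π ε) -
        dot (arrivalVar (A ε)) (zeta n n₁ n₂) / 2| ≤ n / 2 * heavyTrafficError n₁ n₂ k M ε :=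
    fun ε hε hεk => abs_heavyTraffic_le (hA ε hε) hn₁ hn₂ (hpol ε hε) (hπ ε hε) hνf hk_nonneg
      hk_norm hε.1 (hmean ε hε) (hsq ε hε) (hMε ε hε hεk).2
  -- With no saturated port `ζ = 0`, so both bounds are `0` whatever the rates, and `perp` is the
  -- identity: the collapse bound itself keeps the mean total queue bounded.
  rcases (saturationRates n₁ n₂ k).eq_empty_or_nonempty with hemp | hne
  · have hn0 : 0 < n := (Nat.zero_le _).trans_lt hn₁
    have h1 : n₁ = 0 := by
      by_contra h
      have : rowSum k ⟨0, hn0⟩ ∈ saturationRates n₁ n₂ k :=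
        Or.inl ⟨⟨0, hn0⟩, Nat.pos_of_ne_zero h, rfl⟩
      rw [hemp] at this
      exact this
    have h2 : n₂ = 0 := by
      by_contra h
      have : colSum k ⟨0, hn0⟩ ∈ saturationRates n₁ n₂ k :=
        Or.inr ⟨⟨0, hn0⟩, Nat.pos_of_ne_zero h, rfl⟩
      rw [hemp] at this
      exact this
    subst h1 h2
    have hz : dot (fun i j => σ i j ^ 2) (zeta n 0 0) = 0 := by
      rw [zeta_zero_zero]; simp [dot]
    rw [hz, zero_div, zero_div, ENNReal.ofReal_zero]
    refine ⟨zero_le, ?_⟩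
    have hub : ∀ᶠ ε in 𝓝[>] (0 : ℝ), ENNReal.ofReal ε * meanTotal (π ε) ≤
        ENNReal.ofReal (ε * (n * (1 + M))) := by
      filter_upwards [hev] with ε ⟨hε, hεk⟩
      have := (hπ ε hε).1
      rw [hmt ε hε]
      refine ENNReal.ofReal_le_ofReal (mul_le_mul_of_nonneg_left ?_ hε.1.le)
      obtain ⟨hi, hle⟩ := integral_perpNorm_le (hMε ε hε hεk)
      calc S ε ≤ ∫ q, n * perpNorm 0 0 (toReal q) ∂π ε := by
            refine integral_mono (integrable_dot_toReal (hsq ε hε) _) (hi.const_mul _) fun q => ?_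
            have := dot_le (ones n) (toReal q)
            rw [nrm_ones] at this
            rwa [perpNorm, perp_zero_zero]
        _ = n * ∫ q, perpNorm 0 0 (toReal q) ∂π ε := integral_const_mul _ _
        _ ≤ _ := by gcongr
    refine (limsup_le_limsup hub).trans_eq ?_
    have hl : Tendsto (fun ε : ℝ => ENNReal.ofReal (ε * (n * (1 + M)))) (𝓝[>] 0)
        (𝓝 (ENNReal.ofReal (0 * (n * (1 + M))))) := ENNReal.tendsto_ofReal (hid.mul_const _)
    rw [hl.limsup_eq]
    simp
  · constructor
    · have hmem : kappaMax n₁ n₂ k ∈ saturationRates n₁ n₂ k := hne.csSup_mem hbdd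
      set κ := kappaMax n₁ n₂ k with hκdef
      have hκ : 0 < κ := hrates_pos κ hmem
      have hle : ∀ x ∈ saturationRates n₁ n₂ k, x ≤ κ := fun x hx => le_csSup hbdd.bddAbove hx
      set lb : ℝ → ℝ := fun ε => (dot (arrivalVar (A ε)) (zeta n n₁ n₂) / 2 -
        n / 2 * heavyTrafficError n₁ n₂ k M ε - ε * (n * (κ + nrm k) * (1 + M))) / κ with hlb
      have hl : Tendsto (fun ε => ENNReal.ofReal (lb ε)) (𝓝[>] 0) (𝓝 (ENNReal.ofReal
          (dot (fun i j => σ i j ^ 2) (zeta n n₁ n₂) / (2 * κ)))) := by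
        apply ENNReal.tendsto_ofReal
        have := ((((hζ.div_const 2).sub (herr.const_mul ((n : ℝ) / 2))).sub
          (hid.mul_const (n * (κ + nrm k) * (1 + M)))).div_const κ)
        convert this using 2
        field_simp
        ring
      rw [← hl.liminf_eq]
      refine liminf_le_liminf ?_
      filter_upwards [hev] with ε ⟨hε, hεk⟩
      have := (hπ ε hε).1
      rw [hmt ε hε]
      refine ENNReal.ofReal_le_ofReal ?_
      have h1 := (abs_rate_terms_le (k := k) hn₁ hn₂ (hsq ε hε) (hMε ε hε hεk) hκ.le).2
        (fun i hi => hle _ (Or.inl ⟨i, hi, rfl⟩)) (fun j hj => hle _ (Or.inr ⟨j, hj, rfl⟩))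
      have h2 := (abs_le.1 (hht ε hε hεk)).1
      rw [hlb, div_le_iff₀ hκ]
      have h3 := mul_le_mul_of_nonneg_left h1 hε.1.le
      simp only [hS]
      linarith
    · have hmem : kappaMin n₁ n₂ k ∈ saturationRates n₁ n₂ k := hne.csInf_mem hbdd
      set κ := kappaMin n₁ n₂ k with hκdef
      have hκ : 0 < κ := hrates_pos κ hmem
      have hle : ∀ x ∈ saturationRates n₁ n₂ k, κ ≤ x := fun x hx => csInf_le hbdd.bddBelow hx
      set ub : ℝ → ℝ := fun ε => (dot (arrivalVar (A ε)) (zeta n n₁ n₂) / 2 +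
        n / 2 * heavyTrafficError n₁ n₂ k M ε + ε * (n * (κ + nrm k) * (1 + M))) / κ with hub
      have hl : Tendsto (fun ε => ENNReal.ofReal (ub ε)) (𝓝[>] 0) (𝓝 (ENNReal.ofReal
          (dot (fun i j => σ i j ^ 2) (zeta n n₁ n₂) / (2 * κ)))) := by
        apply ENNReal.tendsto_ofReal
        have := ((((hζ.div_const 2).add (herr.const_mul ((n : ℝ) / 2))).add
          (hid.mul_const (n * (κ + nrm k) * (1 + M)))).div_const κ)
        convert this using 2
        field_simp
        ring
      rw [← hl.limsup_eq]
      refine limsup_le_limsup ?_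
      filter_upwards [hev] with ε ⟨hε, hεk⟩
      have := (hπ ε hε).1
      rw [hmt ε hε]
      refine ENNReal.ofReal_le_ofReal ?_
      have h1 := (abs_rate_terms_le (k := k) hn₁ hn₂ (hsq ε hε) (hMε ε hε hεk) hκ.le).1
        (fun i hi => hle _ (Or.inl ⟨i, hi, rfl⟩)) (fun j hj => hle _ (Or.inr ⟨j, hj, rfl⟩))
      have h2 := (abs_le.1 (hht ε hε hεk)).2
      rw [hub, le_div_iff₀ hκ]
      have h3 := mul_le_mul_of_nonneg_left h1 hε.1.le
      simp only [hS]
      linarith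

/-! ### A single port under an arbitrary stable policy -/

/-- The number of packets of `x` weighted by `c`. -/
def portLoad (c x : Config n) : ℕ := ∑ i, ∑ j, c i j * x i j

/-- Lindley's recursion as a lower bound: the port loses at most one packet, and truncated
subtraction supplies the positive part. -/
lemma portLoad_nextQueue_ge {c : Config n}
    (hc : ∀ s ∈ feasibleSchedules n, portLoad c s ≤ 1) {q a s : Config n}
    (hs : s ∈ feasibleSchedules n) :
    portLoad c q + portLoad c a - 1 ≤ portLoad c (nextQueue q a s) := by
  have h1 := hc s hs
  have h2 : portLoad c q + portLoad c a ≤ portLoad c (nextQueue q a s) + portLoad c s := by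
    simp only [portLoad, ← Finset.sum_add_distrib, ← mul_add]
    refine Finset.sum_le_sum fun i _ => Finset.sum_le_sum fun j _ => Nat.mul_le_mul_left _ ?_
    simp only [nextQueue]
    omega
  omega

lemma cast_portLoad (c x : Config n) : (portLoad c x : ℝ) = dot (toReal c) (toReal x) := by
  simp [portLoad, dot, toReal]

/-- The law `π` dominates the law of the single server queue of the port `c`, one time slot
later. -/
def PortDominated (A : Fin n → Fin n → PMF ℕ) (π : Measure (Config n)) (c : Config n) : Prop :=
  ∀ f : ℕ → NNReal, Monotone f →
    ∫⁻ p, f (portLoad c p.1 + portLoad c p.2 - 1) ∂π.prod (arrivalLaw A) ≤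
      ∫⁻ x, f (portLoad c x) ∂π

/-- The state space is discrete, so every bounded function is a continuous test function. -/
lemma tendsto_lintegral_of_tendstoInDistribution {Ω : Type*} [MeasurableSpace Ω] {P : Measure Ω}
    [IsProbabilityMeasure P] {q : ℕ → Ω → Config n} {π : Measure (Config n)}
    [IsProbabilityMeasure π] (h : TendstoInDistribution q atTop id (fun _ => P) π)
    {F : Config n → NNReal} {B : NNReal} (hF : ∀ x, F x ≤ B) :
    Tendsto (fun t => ∫⁻ ω, F (q t ω) ∂P) atTop (𝓝 (∫⁻ x, F x ∂π)) := by
  have h1 := (ProbabilityMeasure.tendsto_iff_forall_lintegral_tendsto (Ω := Config n)).1 h.tendsto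
  let G : BoundedContinuousFunction (Config n) NNReal :=
    BoundedContinuousFunction.mkOfBound ⟨F, continuous_of_discreteTopology⟩ B fun x y => by
      rw [NNReal.dist_eq]
      have e1 : (F x : ℝ) ≤ B := by exact_mod_cast hF x
      have e2 : (F y : ℝ) ≤ B := by exact_mod_cast hF y
      have e3 : (0 : ℝ) ≤ F x := NNReal.coe_nonneg _
      have e4 : (0 : ℝ) ≤ F y := NNReal.coe_nonneg _
      change |(F x : ℝ) - F y| ≤ B
      rw [abs_le]
      constructor <;> linarith
  have h2 := h1 G
  have hG : ∀ x, G x = F x := fun x => rfl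
  simp only [ProbabilityMeasure.coe_mk, Measure.map_id, hG] at h2
  convert h2 using 2 with t
  rw [lintegral_map' (measurable_of_countable _).aemeasurable (h.forall_aemeasurable t)]

/-- At each time `q t` and `a t` are independent, so the port inequality has the product form; it
survives the limit `t → ∞` for bounded test functions and extends to the others by monotone
convergence. -/
lemma portDominated_of_process {Ω : Type*} [mΩ : MeasurableSpace Ω] {P : Measure Ω}
    [IsProbabilityMeasure P] {A : Fin n → Fin n → PMF ℕ} {ℱ : Filtration ℕ mΩ}
    {a s q : ℕ → Ω → Config n} (hproc : IsSwitchProcess P A ℱ a s q)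
    {π : Measure (Config n)} [IsProbabilityMeasure π]
    (hlim : TendstoInDistribution q atTop id (fun _ => P) π) {c : Config n}
    (hc : ∀ s ∈ feasibleSchedules n, portLoad c s ≤ 1) : PortDominated A π c := by
  have hqm : ∀ t, Measurable (q t) := fun t => (hproc.queue_meas t).mono (ℱ.le t) le_rfl
  have ham : ∀ t, Measurable (a t) := fun t =>
    (hproc.arrivals_meas t).mono (ℱ.le (t + 1)) le_rfl
  have hlaw : ∀ t, P.map (fun ω => (q t ω, a t ω)) = (P.map (q t)).prod (arrivalLaw A) := by
    intro t
    have hI : IndepFun (q t) (a t) P := by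
      rw [IndepFun_iff_Indep]
      exact (indep_of_indep_of_le_right (hproc.arrivals_indep t)
        (hproc.queue_meas t).comap_le).symm
    rw [(indepFun_iff_map_prod_eq_prod_map_map (hqm t).aemeasurable (ham t).aemeasurable).1 hI,
      hproc.arrivals_law]
  have hbdd : ∀ f : ℕ → NNReal, Monotone f → ∀ B : NNReal, (∀ m, f m ≤ B) →
      ∫⁻ p, f (portLoad c p.1 + portLoad c p.2 - 1) ∂π.prod (arrivalLaw A) ≤
        ∫⁻ x, f (portLoad c x) ∂π := by
    intro f hf B hB
    -- Integrating out the arrivals leaves a bounded function of the queue alone, to which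
    -- convergence in distribution applies.
    set G : Config n → ℝ≥0∞ := fun x =>
      ∫⁻ y, f (portLoad c x + portLoad c y - 1) ∂arrivalLaw A with hG
    have hGB : ∀ x, G x ≤ B := fun x => by
      calc G x ≤ ∫⁻ _, (B : ℝ≥0∞) ∂arrivalLaw A :=
            lintegral_mono fun y => ENNReal.coe_le_coe.2 (hB _)
        _ = B := by simp
    have hGcoe : ∀ x, ((G x).toNNReal : ℝ≥0∞) = G x := fun x =>
      ENNReal.coe_toNNReal (ne_top_of_le_ne_top ENNReal.coe_ne_top (hGB x))
    have hGB' : ∀ x, (G x).toNNReal ≤ B := fun x => by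
      rw [← ENNReal.coe_le_coe, hGcoe]; exact hGB x
    have l1 := tendsto_lintegral_of_tendstoInDistribution hlim (F := fun x => (G x).toNNReal) hGB'
    have l2 := (tendsto_lintegral_of_tendstoInDistribution hlim (F := fun x => f (portLoad c x))
      (fun x => hB _)).comp (tendsto_add_atTop_nat 1)
    simp only [hGcoe] at l1
    rw [lintegral_prod _ (measurable_of_countable _).aemeasurable]
    refine le_of_tendsto_of_tendsto' l1 l2 fun t => ?_
    calc ∫⁻ ω, G (q t ω) ∂P = ∫⁻ x, G x ∂P.map (q t) :=
          (lintegral_map (measurable_of_countable _) (hqm t)).symm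
      _ = ∫⁻ p, f (portLoad c p.1 + portLoad c p.2 - 1)
          ∂(P.map (q t)).prod (arrivalLaw A) := by
          rw [lintegral_prod _ (measurable_of_countable _).aemeasurable]
      _ = ∫⁻ ω, f (portLoad c (q t ω) + portLoad c (a t ω) - 1) ∂P := by
          rw [← hlaw, lintegral_map (measurable_of_countable _) ((hqm t).prodMk (ham t))]
      _ ≤ ∫⁻ ω, f (portLoad c (q (t + 1) ω)) ∂P := by
          refine lintegral_mono fun ω => ?_
          rw [hproc.evolve]
          exact ENNReal.coe_le_coe.2 (hf (portLoad_nextQueue_ge hc (hproc.schedule_mem t ω)))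
  intro f hf
  have hmono : ∀ N : ℕ, Monotone fun m => min (f m) N := fun N x y hxy =>
    min_le_min_right _ (hf hxy)
  have hsup : ∀ m, (f m : ℝ≥0∞) = ⨆ N : ℕ, ((min (f m) N : NNReal) : ℝ≥0∞) := by
    intro m
    apply le_antisymm
    · obtain ⟨N, hN⟩ := exists_nat_ge (f m)
      refine le_iSup_of_le N ?_
      rw [min_eq_left hN]
    · exact iSup_le fun N => by exact_mod_cast min_le_left _ _
  simp_rw [hsup]
  rw [lintegral_iSup (fun N => measurable_of_countable _)]
  · refine iSup_le fun N => (hbdd _ (hmono N) N fun m => min_le_right _ _).trans ?_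
    exact lintegral_mono fun x => le_iSup (fun N : ℕ => ((min (f (portLoad c x)) N : NNReal) : ℝ≥0∞)) N
  · intro N N' hN p
    simp only [ENNReal.coe_le_coe]
    exact min_le_min_left _ (by exact_mod_cast hN)

/-- The square, continued linearly above `N`. -/
noncomputable def truncSq (N m : ℕ) : ℝ := if m ≤ N then (m : ℝ) ^ 2 else 2 * N * m - N ^ 2

lemma truncSq_nonneg (N m : ℕ) : 0 ≤ truncSq N m := by
  unfold truncSq
  split_ifs with h
  · positivity
  · have h1 : (N : ℝ) ≤ m := by exact_mod_cast (not_le.1 h).le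
    nlinarith [Nat.cast_nonneg (α := ℝ) N]

lemma truncSq_le (N m : ℕ) : truncSq N m ≤ 2 * N * m := by
  unfold truncSq
  split_ifs with h
  · have h1 : (m : ℝ) ≤ N := by exact_mod_cast h
    nlinarith [Nat.cast_nonneg (α := ℝ) m]
  · nlinarith [Nat.cast_nonneg (α := ℝ) N]

/-- Tangent line inequality with slope `2 * min x N`, keeping the exact second order term where the
function is quadratic. Linear growth makes the function integrable when only the first moment is
finite. -/
lemma truncSq_convex (N x y : ℕ) :
    2 * (min x N : ℕ) * ((y : ℝ) - x) + (if x ≤ N ∧ y ≤ N then ((y : ℝ) - x) ^ 2 else 0) ≤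
      truncSq N y - truncSq N x := by
  unfold truncSq
  by_cases hx : x ≤ N <;> by_cases hy : y ≤ N
  · simp only [hx, hy, and_self, if_true, min_eq_left]
    nlinarith
  · have h1 : (x : ℝ) ≤ N := by exact_mod_cast hx
    have h2 : (N : ℝ) ≤ y := by exact_mod_cast (not_le.1 hy).le
    simp only [hx, hy, and_false, if_true, if_false, min_eq_left]
    nlinarith [mul_nonneg (sub_nonneg.2 h1) (sub_nonneg.2 h2), sq_nonneg ((N : ℝ) - x)]
  · have h1 : (N : ℝ) ≤ x := by exact_mod_cast (not_le.1 hx).le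
    have h2 : (y : ℝ) ≤ N := by exact_mod_cast hy
    simp only [hx, hy, false_and, if_true, if_false, min_eq_right (not_le.1 hx).le]
    nlinarith [sq_nonneg ((N : ℝ) - y)]
  · simp only [hx, hy, and_self, if_false, min_eq_right (not_le.1 hx).le]
    linarith

lemma truncSq_mono (N : ℕ) : Monotone (truncSq N) := by
  intro x y hxy
  have h := truncSq_convex N x y
  have h1 : (x : ℝ) ≤ y := by exact_mod_cast hxy
  have h2 : 0 ≤ 2 * ((min x N : ℕ) : ℝ) * ((y : ℝ) - x) :=
    mul_nonneg (by positivity) (sub_nonneg.2 h1)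
  have h3 : (0 : ℝ) ≤ if x ≤ N ∧ y ≤ N then ((y : ℝ) - x) ^ 2 else 0 := by
    split_ifs <;> positivity
  linarith

lemma integral_add_sub {Ω : Type*} [MeasurableSpace Ω] {P : Measure Ω} {f₁ f₂ f₃ : Ω → ℝ}
    (h₁ : Integrable f₁ P) (h₂ : Integrable f₂ P) (h₃ : Integrable f₃ P) :
    ∫ ω, (f₁ ω + f₂ ω - f₃ ω) ∂P = ∫ ω, f₁ ω ∂P + ∫ ω, f₂ ω ∂P - ∫ ω, f₃ ω ∂P := by
  rw [integral_sub (by fun_prop) h₃, integral_add h₁ h₂]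

lemma integral_add_sub_add {Ω : Type*} [MeasurableSpace Ω] {P : Measure Ω} {f₁ f₂ f₃ f₄ : Ω → ℝ}
    (h₁ : Integrable f₁ P) (h₂ : Integrable f₂ P) (h₃ : Integrable f₃ P) (h₄ : Integrable f₄ P) :
    ∫ ω, (f₁ ω + f₂ ω - f₃ ω + f₄ ω) ∂P =
      ∫ ω, f₁ ω ∂P + ∫ ω, f₂ ω ∂P - ∫ ω, f₃ ω ∂P + ∫ ω, f₄ ω ∂P := by
  rw [integral_add (by fun_prop) h₄, integral_add_sub h₁ h₂ h₃]

/-- Lower bound for the mean load of a port. -/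
lemma PortDominated.var_le {A : Fin n → Fin n → PMF ℕ} {π : Measure (Config n)}
    [IsProbabilityMeasure π] {c : Config n} (h : PortDominated A π c) {amax : ℕ}
    (hA : ∀ i j, ∀ m, amax < m → A i j m = 0) {κ : ℝ}
    (hκ : 0 ≤ κ) (hmean : dot (toReal c) (arrivalMean A) = 1 - κ)
    (hint : Integrable (fun x => (portLoad c x : ℝ)) π) :
    ∑ i, ∑ j, (c i j : ℝ) * c i j * arrivalVar A i j ≤
      2 * κ * ∫ x, (portLoad c x : ℝ) ∂π + κ := by
  set ρ := π.prod (arrivalLaw A) with hρ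
  have hms : ∀ F : Config n × Config n → ℝ, AEStronglyMeasurable F ρ := fun F =>
    (measurable_of_countable F).aestronglyMeasurable
  set X : Config n × Config n → ℕ := fun p => portLoad c p.1 with hX
  set Y : Config n × Config n → ℕ := fun p => portLoad c p.2 with hY
  set Z : Config n × Config n → ℕ := fun p => X p + Y p - 1 with hZ
  -- The idle slots of the single server: `u` corrects the truncated subtraction in `Z`, and it
  -- vanishes unless `X = 0`.
  set u : Config n × Config n → ℝ := fun p => if X p = 0 ∧ Y p = 0 then 1 else 0 with hu
  have hZu : ∀ p, (Z p : ℝ) = X p + Y p - 1 + u p := by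
    intro p
    simp only [hZ, hu]
    by_cases h0 : X p = 0 ∧ Y p = 0
    · simp [h0.1, h0.2]
    · rw [if_neg h0, Nat.cast_sub (by omega)]; push_cast; ring
  have hminu : ∀ N p, ((min (X p) N : ℕ) : ℝ) * u p = 0 := fun N p => by
    simp only [hu]; split_ifs with h0
    · simp [h0.1]
    · simp
  have hXi : Integrable (fun p => (X p : ℝ)) ρ := hint.comp_fst _
  have hF2 : ∀ F : Config n → ℝ, Integrable (fun p : Config n × Config n => F p.2) ρ := fun F =>
    (integrable_arrival hA F).comp_snd _
  have hF2' : ∀ F : Config n → ℝ, ∫ p : Config n × Config n, F p.2 ∂ρ = ∫ a, F a ∂arrivalLaw A :=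
    fun F => by
      rw [← Measure.snd_prod (μ := π) (ν := arrivalLaw A), Measure.snd,
        integral_map measurable_snd.aemeasurable (measurable_of_countable _).aestronglyMeasurable]
  have hui : Integrable u ρ := Integrable.of_bound (hms u) 1 (ae_of_all _ fun p => by
    simp only [hu]; split_ifs <;> simp)
  have hu0 : ∀ p, 0 ≤ u p := fun p => by simp only [hu]; split_ifs <;> simp
  have hYi : Integrable (fun p => (Y p : ℝ)) ρ := hF2 fun a => (portLoad c a : ℝ)
  have hZi : Integrable (fun p => (Z p : ℝ)) ρ := by
    simp_rw [hZu]
    exact ((hXi.add hYi).sub (integrable_const 1)).add hui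
  have hYm : ∫ p, (Y p : ℝ) ∂ρ = 1 - κ := by
    rw [hF2' fun a => (portLoad c a : ℝ)]
    simp_rw [cast_portLoad]
    rw [integral_dot_arrival hA, hmean]
  have hdom : ∀ f : ℕ → ℝ, Monotone f → (∀ m, 0 ≤ f m) → Integrable (fun p => f (X p)) ρ →
      Integrable (fun p => f (Z p)) ρ → ∫ p, f (Z p) ∂ρ ≤ ∫ p, f (X p) ∂ρ := by
    intro f hf hf0 hi1 hi2
    have h1 := h (fun m => (f m).toNNReal) fun x y hxy => Real.toNNReal_mono (hf hxy)
    rw [integral_eq_lintegral_of_nonneg_ae (ae_of_all _ fun _ => hf0 _) (hms _),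
      integral_eq_lintegral_of_nonneg_ae (ae_of_all _ fun _ => hf0 _) (hms _)]
    refine ENNReal.toReal_mono ?_ ?_
    · have := hi1.lintegral_lt_top.ne
      exact this
    · refine h1.trans_eq ?_
      rw [lintegral_prod _ (measurable_of_countable _).aemeasurable]
      simp [ENNReal.ofReal, hX]
  -- Domination with the identity as test function: the mean load cannot grow, so the idle
  -- probability is at most the capacity gap.
  have hU : ∫ p, u p ∂ρ ≤ κ := by
    have h1 := hdom (fun m => (m : ℝ)) Nat.mono_cast (fun m => Nat.cast_nonneg m) hXi hZi
    simp_rw [hZu] at h1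
    rw [integral_add_sub_add hXi hYi (integrable_const 1) hui, hYm] at h1
    simp only [integral_const, probReal_univ, smul_eq_mul, mul_one] at h1
    linarith
  -- the arrivals are bounded
  obtain ⟨B, hB⟩ : ∃ B : ℕ, ∀ᵐ p ∂ρ, Y p ≤ B := by
    refine ⟨∑ i, ∑ j, c i j * amax, ?_⟩
    have h2 : ∀ᵐ p ∂ρ, ∀ i j, p.2 i j ≤ amax :=
      Measure.quasiMeasurePreserving_snd.ae (ae_arrival_le hA)
    filter_upwards [h2] with p hp
    exact Finset.sum_le_sum fun i _ => Finset.sum_le_sum fun j _ => Nat.mul_le_mul_left _ (hp i j)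
  set E := ∫ a, ((portLoad c a : ℝ) - 1) ^ 2 ∂arrivalLaw A with hE
  -- Domination is tested with `truncSq N`. On the event shown, bounded arrivals keep both `X` and
  -- `Z` at most `N`, so the full second order term is available there.
  have key : ∀ N : ℕ, E * π.real {x | portLoad c x + B ≤ N} ≤
      2 * κ * ∫ x, (portLoad c x : ℝ) ∂π + κ := by
    intro N
    set I : Config n → ℝ := {x | portLoad c x + B ≤ N}.indicator 1 with hI
    have hIi : Integrable I π := (integrable_const 1).indicator (Set.to_countable _).measurableSet
    have hfi : ∀ W : Config n × Config n → ℕ, Integrable (fun p => (W p : ℝ)) ρ →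
        Integrable (fun p => truncSq N (W p)) ρ := fun W hW =>
      (hW.const_mul (2 * N)).mono' (hms _) (ae_of_all _ fun p => by
        rw [Real.norm_of_nonneg (truncSq_nonneg _ _)]; exact truncSq_le _ _)
    have h1 := hdom (truncSq N) (truncSq_mono N) (truncSq_nonneg N) (hfi X hXi) (hfi Z hZi)
    have hmi : Integrable (fun x => ((min (portLoad c x) N : ℕ) : ℝ)) π :=
      hint.mono' (measurable_of_countable _).aestronglyMeasurable (ae_of_all _ fun x => by
        rw [Real.norm_of_nonneg (Nat.cast_nonneg _)]; exact_mod_cast min_le_left _ _)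
    have hprod1 : Integrable (fun p : Config n × Config n =>
        ((min (portLoad c p.1) N : ℕ) : ℝ) * ((portLoad c p.2 : ℝ) - 1)) ρ :=
      hmi.mul_prod (integrable_arrival hA fun a => (portLoad c a : ℝ) - 1)
    have hprod2 : Integrable (fun p : Config n × Config n =>
        I p.1 * ((portLoad c p.2 : ℝ) - 1) ^ 2) ρ :=
      hIi.mul_prod (integrable_arrival hA fun a => ((portLoad c a : ℝ) - 1) ^ 2)
    have hpt : ∀ᵐ p ∂ρ, 2 * (((min (portLoad c p.1) N : ℕ) : ℝ) * ((portLoad c p.2 : ℝ) - 1)) +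
        I p.1 * ((portLoad c p.2 : ℝ) - 1) ^ 2 - u p ≤ truncSq N (Z p) - truncSq N (X p) := by
      filter_upwards [hB] with p hp
      refine le_trans ?_ (truncSq_convex N (X p) (Z p))
      have e1 : (Z p : ℝ) - X p = (Y p : ℝ) - 1 + u p := by rw [hZu]; ring
      have e2 := hminu N p
      have e3 : ((Y p : ℝ) - 1 + u p) ^ 2 = ((Y p : ℝ) - 1) ^ 2 - u p := by
        simp only [hu]; split_ifs with h0
        · rw [h0.2]; norm_num
        · ring
      rw [e1, e3]
      have e4 : I p.1 * ((portLoad c p.2 : ℝ) - 1) ^ 2 - u p ≤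
          if X p ≤ N ∧ Z p ≤ N then ((Y p : ℝ) - 1) ^ 2 - u p else 0 := by
        by_cases hin : portLoad c p.1 + B ≤ N
        · have c1 : X p ≤ N := by simp only [hX]; omega
          have c2 : Z p ≤ N := by simp only [hZ, hX] at *; omega
          rw [if_pos ⟨c1, c2⟩, hI, Set.indicator_of_mem (by exact hin)]
          simp [hY]
        · rw [hI, Set.indicator_of_notMem (by exact hin), zero_mul]
          split_ifs
          · nlinarith [hu0 p, sq_nonneg ((Y p : ℝ) - 1)]
          · linarith [hu0 p]
      have e5 : 2 * ((min (X p) N : ℕ) : ℝ) * ((Y p : ℝ) - 1 + u p) =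
          2 * (((min (portLoad c p.1) N : ℕ) : ℝ) * ((portLoad c p.2 : ℝ) - 1)) := by
        simp only [hX, hY] at e2 ⊢
        linear_combination 2 * e2
      linarith
    have h2 := integral_mono_ae (((hprod1.const_mul 2).add hprod2).sub hui)
      ((hfi Z hZi).sub (hfi X hXi)) hpt
    simp only [Pi.sub_apply, Pi.add_apply] at h2
    rw [integral_sub (hfi Z hZi) (hfi X hXi),
      integral_add_sub (hprod1.const_mul 2) hprod2 hui, integral_const_mul] at h2
    have m1 : ∫ p, ((min (portLoad c p.1) N : ℕ) : ℝ) * ((portLoad c p.2 : ℝ) - 1) ∂ρ =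
        (∫ x, ((min (portLoad c x) N : ℕ) : ℝ) ∂π) * -κ := by
      rw [hρ, integral_prod_mul (fun x => ((min (portLoad c x) N : ℕ) : ℝ))
        (fun a => (portLoad c a : ℝ) - 1)]
      congr 1
      rw [integral_sub (integrable_arrival hA _) (integrable_const _),
        ← hF2' fun a => (portLoad c a : ℝ), hYm]
      simp
    have m2 : ∫ p, I p.1 * ((portLoad c p.2 : ℝ) - 1) ^ 2 ∂ρ =
        π.real {x | portLoad c x + B ≤ N} * E := by
      rw [hρ, integral_prod_mul I (fun a => ((portLoad c a : ℝ) - 1) ^ 2), hI,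
        integral_indicator_one (Set.to_countable _).measurableSet]
    rw [m1, m2] at h2
    have h3 : ∫ x, ((min (portLoad c x) N : ℕ) : ℝ) ∂π ≤ ∫ x, (portLoad c x : ℝ) ∂π :=
      integral_mono hmi hint fun x => Nat.cast_le.2 (min_le_left _ _)
    have h4 := mul_le_mul_of_nonneg_left h3 hκ
    linarith
  have hlimN : Tendsto (fun N : ℕ => E * π.real {x | portLoad c x + B ≤ N}) atTop (𝓝 (E * 1)) := by
    refine Tendsto.const_mul _ ?_
    have hm : Monotone fun N : ℕ => {x : Config n | portLoad c x + B ≤ N} := fun N N' hN x hx => by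
      have hx' : portLoad c x + B ≤ N := hx
      exact hx'.trans hN
    have h1 := tendsto_measure_iUnion_atTop (μ := π) hm
    have h2 : (⋃ N : ℕ, {x : Config n | portLoad c x + B ≤ N}) = Set.univ :=
      Set.eq_univ_of_forall fun x => Set.mem_iUnion.2 ⟨portLoad c x + B,
      show portLoad c x + B ≤ portLoad c x + B from le_rfl⟩
    rw [h2, measure_univ] at h1
    exact (ENNReal.tendsto_toReal ENNReal.one_ne_top).comp h1
  have hE_le : E ≤ 2 * κ * ∫ x, (portLoad c x : ℝ) ∂π + κ := by
    have := le_of_tendsto' hlimN key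
    rwa [mul_one] at this
  refine le_trans ?_ hE_le
  -- The load of the arrivals has mean `1 - κ`, so its second moment about `1` is its variance plus
  -- `κ ^ 2`.
  have hEeq : E = ∑ i, ∑ j, (c i j : ℝ) * c i j * arrivalVar A i j + κ ^ 2 := by
    have hcov := integral_dot_mul_dot hA (toReal c) (toReal c)
    have e1 : ∀ a, ((portLoad c a : ℝ) - 1) ^ 2 =
        dot (toReal c) (toReal a - arrivalMean A) * dot (toReal c) (toReal a - arrivalMean A) -
          2 * κ * ((portLoad c a : ℝ) - 1) - κ ^ 2 := by
      intro a
      rw [dot_sub_right, hmean, ← cast_portLoad]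
      ring
    rw [hE]
    simp_rw [e1]
    rw [integral_sub (integrable_arrival hA _) (integrable_const _),
      integral_sub (integrable_arrival hA _) (integrable_arrival hA _), hcov, integral_const_mul,
      integral_sub (integrable_arrival hA _) (integrable_const _),
      ← hF2' fun a => (portLoad c a : ℝ), hYm]
    simp only [integral_const, probReal_univ, smul_eq_mul, one_mul, toReal]
    ring
  rw [hEeq]
  nlinarith [sq_nonneg κ]

/-- Heavy traffic lower bound from a family of disjoint ports. -/
lemma le_liminf_of_portDominated {π : ℝ → Measure (Config n)} [∀ ε, IsProbabilityMeasure (π ε)]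
    {A : ℝ → Fin n → Fin n → PMF ℕ} {amax : ℕ} {ε₀ : ℝ} (hε₀ : 0 < ε₀)
    (hA : ∀ ε ∈ Set.Ioo 0 ε₀, ∀ i j, ∀ m, amax < m → A ε i j m = 0) {σ : RVec n}
    (hvar : ∀ i j, Tendsto (fun ε => arrivalVar (A ε) i j) (𝓝[>] 0) (𝓝 (σ i j ^ 2)))
    (c : Fin n → Config n) (S : Finset (Fin n)) (κ : Fin n → ℝ)
    (hdisj : ∀ i j, ∑ p ∈ S, c p i j ≤ 1)
    (hκ : ∀ p ∈ S, 0 < κ p)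
    (hmean : ∀ ε ∈ Set.Ioo 0 ε₀, ∀ p ∈ S,
      dot (toReal (c p)) (arrivalMean (A ε)) = 1 - ε * κ p)
    (hdom : ∀ ε ∈ Set.Ioo 0 ε₀, ∀ p ∈ S, PortDominated (A ε) (π ε) (c p)) :
    ENNReal.ofReal (∑ p ∈ S, (∑ i, ∑ j, (c p i j : ℝ) * c p i j * σ i j ^ 2) / (2 * κ p)) ≤
      liminf (fun ε => ENNReal.ofReal ε * meanTotal (π ε)) (𝓝[>] 0) := by
  set lb : ℝ → ℝ := fun ε => ∑ p ∈ S,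
    (∑ i, ∑ j, (c p i j : ℝ) * c p i j * arrivalVar (A ε) i j - ε * κ p) / (2 * κ p) with hlb
  have hid : Tendsto (fun ε : ℝ => ε) (𝓝[>] 0) (𝓝 0) := tendsto_id.mono_left nhdsWithin_le_nhds
  have hl : Tendsto (fun ε => ENNReal.ofReal (lb ε)) (𝓝[>] 0) (𝓝 (ENNReal.ofReal
      (∑ p ∈ S, (∑ i, ∑ j, (c p i j : ℝ) * c p i j * σ i j ^ 2) / (2 * κ p)))) := by
    refine ENNReal.tendsto_ofReal (tendsto_finsetSum _ fun p _ => ?_)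
    have h1 : Tendsto (fun ε => ∑ i, ∑ j, (c p i j : ℝ) * c p i j * arrivalVar (A ε) i j)
        (𝓝[>] 0) (𝓝 (∑ i, ∑ j, (c p i j : ℝ) * c p i j * σ i j ^ 2)) :=
      tendsto_finsetSum _ fun i _ => tendsto_finsetSum _ fun j _ => (hvar i j).const_mul _
    have := (h1.sub (hid.mul_const (κ p))).div_const (2 * κ p)
    rwa [zero_mul, sub_zero] at this
  rw [← hl.liminf_eq]
  refine liminf_le_liminf ?_
  filter_upwards [Ioo_mem_nhdsGT hε₀] with ε hε
  -- An infinite mean makes the bound trivial; otherwise all port loads are integrable, as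
  -- `PortDominated.var_le` requires.
  by_cases htop : meanTotal (π ε) = ∞
  · rw [htop, ENNReal.mul_top (by simpa using hε.1)]
    exact le_top
  have htot : Integrable (fun q : Config n => dot (ones n) (toReal q)) (π ε) := by
    refine ⟨(measurable_of_countable _).aestronglyMeasurable, ?_⟩
    rw [hasFiniteIntegral_iff_ofReal (ae_of_all _ fun q =>
      (Nat.cast_nonneg _).trans_eq (dot_ones_toReal q).symm)]
    simp_rw [dot_ones_toReal, ENNReal.ofReal_natCast]
    exact lt_top_iff_ne_top.2 htop
  have hsumle : ∀ q : Config n, ∑ p ∈ S, (portLoad (c p) q : ℝ) ≤ dot (ones n) (toReal q) := by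
    intro q
    rw [dot_ones_toReal]
    have : ∑ p ∈ S, portLoad (c p) q ≤ ∑ i, ∑ j, q i j := by
      simp only [portLoad]
      rw [Finset.sum_comm]
      refine Finset.sum_le_sum fun i _ => ?_
      rw [Finset.sum_comm]
      refine Finset.sum_le_sum fun j _ => ?_
      rw [← Finset.sum_mul]
      exact (Nat.mul_le_mul_right _ (hdisj i j)).trans_eq (one_mul _)
    exact_mod_cast this
  have hint : ∀ p ∈ S, Integrable (fun q => (portLoad (c p) q : ℝ)) (π ε) := fun p hp =>
    htot.mono' (measurable_of_countable _).aestronglyMeasurable (ae_of_all _ fun q => by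
      rw [Real.norm_of_nonneg (Nat.cast_nonneg _)]
      exact (Finset.single_le_sum (f := fun p => (portLoad (c p) q : ℝ))
        (fun _ _ => Nat.cast_nonneg _) hp).trans (hsumle q))
  rw [meanTotal_eq htot, ← ENNReal.ofReal_mul hε.1.le]
  refine ENNReal.ofReal_le_ofReal ?_
  calc lb ε ≤ ∑ p ∈ S, ε * ∫ q, (portLoad (c p) q : ℝ) ∂π ε := by
        refine Finset.sum_le_sum fun p hp => ?_
        have hκp := hκ p hp
        have h1 := (hdom ε hε p hp).var_le (hA ε hε) (κ := ε * κ p)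
          (by have := hε.1; positivity) (hmean ε hε p hp) (hint p hp)
        rw [div_le_iff₀ (by positivity)]
        linarith
    _ = ε * ∫ q, ∑ p ∈ S, (portLoad (c p) q : ℝ) ∂π ε := by
        rw [integral_finsetSum _ hint, Finset.mul_sum]
    _ ≤ ε * ∫ q, dot (ones n) (toReal q) ∂π ε :=
        mul_le_mul_of_nonneg_left (integral_mono (integrable_finsetSum _ hint) htot hsumle)
          hε.1.le

/-- The indicator of input port `p`. -/
def rowPort (p : Fin n) : Config n := fun i _ => if i = p then 1 else 0

/-- The indicator of output port `p`. -/
def colPort (p : Fin n) : Config n := fun _ j => if j = p then 1 else 0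

lemma portLoad_rowPort (p : Fin n) (x : Config n) : portLoad (rowPort p) x = ∑ j, x p j := by
  simp [portLoad, rowPort]

lemma portLoad_colPort (p : Fin n) (x : Config n) : portLoad (colPort p) x = ∑ i, x i p := by
  simp [portLoad, colPort]

lemma dot_rowPort (p : Fin n) (x : RVec n) : dot (toReal (rowPort p)) x = rowSum x p := by
  simp [dot, toReal, rowPort, rowSum]

lemma dot_colPort (p : Fin n) (x : RVec n) : dot (toReal (colPort p)) x = colSum x p := by
  simp [dot, toReal, colPort, colSum]

/-- The universal heavy traffic lower bound. -/
theorem stable_heavyTraffic {n₁ n₂ : ℕ} {ν : RVec n} (hν : ν ∈ face n n₁ n₂) {k : RVec n}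
    (hk_row : ∀ i : Fin n, (i : ℕ) < n₁ → 0 < rowSum k i)
    (hk_col : ∀ j : Fin n, (j : ℕ) < n₂ → 0 < colSum k j) {ε₀ : ℝ} (hε₀ : 0 < ε₀)
    {A : ℝ → Fin n → Fin n → PMF ℕ} {amax : ℕ}
    (hA : ∀ ε ∈ Set.Ioo 0 ε₀, ∀ i j, ∀ m, amax < m → A ε i j m = 0)
    (hmean : ∀ ε ∈ Set.Ioo 0 ε₀, arrivalMean (A ε) = ν - ε • k)
    {σ : RVec n}
    (hvar : ∀ i j, Tendsto (fun ε => arrivalVar (A ε) i j) (𝓝[>] 0) (𝓝 (σ i j ^ 2)))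
    {π : ℝ → Measure (Config n)} [∀ ε, IsProbabilityMeasure (π ε)]
    (hdom : ∀ ε ∈ Set.Ioo 0 ε₀, ∀ c : Config n,
      (∀ s ∈ feasibleSchedules n, portLoad c s ≤ 1) → PortDominated (A ε) (π ε) c) :
    ENNReal.ofReal (1 / 2 * max (dot (fun i j => σ i j ^ 2) (zetaRow n₁ k))
        (dot (fun i j => σ i j ^ 2) (zetaCol n₂ k)))
      ≤ liminf (fun ε => ENNReal.ofReal ε * meanTotal (π ε)) (𝓝[>] 0) := by
  -- Rows and columns overlap, so each family is treated as a separate disjoint one and the better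
  -- bound is kept.
  rw [mul_max_of_nonneg _ _ (by norm_num), ENNReal.ofReal_max]
  refine max_le ?_ ?_
  · have h := le_liminf_of_portDominated hε₀ hA hvar rowPort
      (Finset.univ.filter fun p : Fin n => (p : ℕ) < n₁) (rowSum k)
      (fun i j => by
        refine (Finset.sum_le_sum_of_subset (Finset.filter_subset _ _)).trans ?_
        simp [rowPort])
      (fun p hp => hk_row p (Finset.mem_filter.1 hp).2)
      (fun ε hε p hp => by
        rw [dot_rowPort, hmean ε hε, rowSum_sub, rowSum_smul, hν.2.1 p (Finset.mem_filter.1 hp).2])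
      (fun ε hε p _ => hdom ε hε _ fun s hs => by rw [portLoad_rowPort]; exact hs.1 p)
    refine le_trans (le_of_eq ?_) h
    congr 1
    rw [Finset.sum_filter, dot, Finset.mul_sum]
    refine Finset.sum_congr rfl fun i _ => ?_
    simp only [zetaRow, rowPort]
    split_ifs with hi
    · rw [← Finset.sum_mul]
      simp
      ring
    · simp
  · have h := le_liminf_of_portDominated hε₀ hA hvar colPort
      (Finset.univ.filter fun p : Fin n => (p : ℕ) < n₂) (colSum k)
      (fun i j => by
        refine (Finset.sum_le_sum_of_subset (Finset.filter_subset _ _)).trans ?_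
        simp [colPort])
      (fun p hp => hk_col p (Finset.mem_filter.1 hp).2)
      (fun ε hε p hp => by
        rw [dot_colPort, hmean ε hε, colSum_sub, colSum_smul, hν.2.2 p (Finset.mem_filter.1 hp).2])
      (fun ε hε p _ => hdom ε hε _ fun s hs => by rw [portLoad_colPort]; exact hs.2 p)
    refine le_trans (le_of_eq ?_) h
    congr 1
    rw [Finset.sum_filter, dot, Finset.sum_comm, Finset.mul_sum]
    refine Finset.sum_congr rfl fun i _ => ?_
    simp only [zetaCol, colPort]
    split_ifs with hi
    · rw [← Finset.sum_mul]
      simp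
      ring
    · simp

end Switch
theorem mainTheorem5 (n n₁ n₂ : ℕ) (hn₁ : n₁ < n) (hn₂ : n₂ < n)
    (ν : Switch.RVec n) (hν : ν ∈ intrinsicInterior ℝ (Switch.face n n₁ n₂))
    (hν_pos : ∀ i j, 0 < ν i j)
    (k : Switch.RVec n) (hk_nonneg : ∀ i j, 0 ≤ k i j)
    (hk_norm : ∑ i, ∑ j, k i j = (n : ℝ))
    (hk_row : ∀ i : Fin n, (i : ℕ) < n₁ → 0 < Switch.rowSum k i)
    (hk_col : ∀ j : Fin n, (j : ℕ) < n₂ → 0 < Switch.colSum k j)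
    (ε₀ : ℝ) (hε₀ : 0 < ε₀)
    (A : ℝ → Fin n → Fin n → PMF ℕ) (amax : ℕ)
    (hA_bdd : ∀ ε ∈ Set.Ioo 0 ε₀, ∀ i j, ∀ m, amax < m → A ε i j m = 0)
    (hA_mean : ∀ ε ∈ Set.Ioo 0 ε₀, ∀ i j,
      ∫ m : ℕ, (m : ℝ) ∂(A ε i j).toMeasure = ν i j - ε * k i j)
    (σ : Switch.RVec n)
    (hA_var : ∀ i j, Tendsto (fun ε => variance (fun m : ℕ => (m : ℝ)) (A ε i j).toMeasure)
      (𝓝[>] 0) (𝓝 (σ i j ^ 2))) :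
    -- the switches operating under MaxWeight
    (∀ pol : ℝ → Switch.Policy n, (∀ ε ∈ Set.Ioo 0 ε₀, (pol ε).IsMaxWeight) →
      (∀ ε ∈ Set.Ioo 0 ε₀,
        ∃! π : Measure (Switch.Config n),
          Switch.IsSteadyState (Switch.queueKernel (A ε) (pol ε)) π) ∧
      ∀ π : ℝ → Measure (Switch.Config n),
        (∀ ε ∈ Set.Ioo 0 ε₀,
          Switch.IsSteadyState (Switch.queueKernel (A ε) (pol ε)) (π ε)) →
        ENNReal.ofReal (Switch.dot (fun i j => σ i j ^ 2) (Switch.zeta n n₁ n₂)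
              / (2 * Switch.kappaMax n₁ n₂ k))
            ≤ liminf (fun ε => ENNReal.ofReal ε * Switch.meanTotal (π ε)) (𝓝[>] 0) ∧
          limsup (fun ε => ENNReal.ofReal ε * Switch.meanTotal (π ε)) (𝓝[>] 0)
            ≤ ENNReal.ofReal (Switch.dot (fun i j => σ i j ^ 2) (Switch.zeta n n₁ n₂)
              / (2 * Switch.kappaMin n₁ n₂ k))) ∧
    -- the same switches operating under arbitrary stable scheduling policies
    (∀ (Ω : ℝ → Type*) [mΩ : ∀ ε, MeasurableSpace (Ω ε)] (P : ∀ ε, Measure (Ω ε))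
        [∀ ε, IsProbabilityMeasure (P ε)] (ℱ : ∀ ε, Filtration ℕ (mΩ ε))
        (a s q : ∀ ε, ℕ → Ω ε → Switch.Config n)
        (π : ℝ → Measure (Switch.Config n)) [∀ ε, IsProbabilityMeasure (π ε)],
      (∀ ε ∈ Set.Ioo 0 ε₀,
        Switch.IsSwitchProcess (P ε) (A ε) (ℱ ε) (a ε) (s ε) (q ε) ∧
        TendstoInDistribution (q ε) atTop id (fun _ => P ε) (π ε)) →
      ENNReal.ofReal (1 / 2 * max
          (Switch.dot (fun i j => σ i j ^ 2) (Switch.zetaRow n₁ k))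
          (Switch.dot (fun i j => σ i j ^ 2) (Switch.zetaCol n₂ k)))
        ≤ liminf (fun ε => ENNReal.ofReal ε * Switch.meanTotal (π ε)) (𝓝[>] 0)) := by
  have hmean : ∀ ε ∈ Set.Ioo 0 ε₀, Switch.arrivalMean (A ε) = ν - ε • k := fun ε hε =>
    funext fun i => funext fun j => hA_mean ε hε i j
  refine ⟨fun pol hpol => Switch.maxWeight_heavyTraffic hn₁ hn₂ hν hν_pos hk_nonneg hk_norm hk_row
    hk_col hε₀ hA_bdd hmean hA_var hpol, ?_⟩
  intro Ω mΩ P _ ℱ a s q π _ h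
  exact Switch.stable_heavyTraffic (Switch.intrinsicInterior_face_lt hn₁ hn₂ hν).1 hk_row hk_col hε₀
    hA_bdd hmean hA_var fun ε hε c hc =>
      Switch.portDominated_of_process (h ε hε).1 (h ε hε).2 hc
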